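/- **Setting.** Let $\omega=(\alpha,\beta)$ be a point of the Thoma simplex: $\alpha=(\alpha_1\ge\alpha_2\ge\cdots\ge 0)$, $\beta=(\beta_1\ge\beta_2\ge\cdots\ge 0)$ with $\sum_i\alpha_i+\sum_i\beta_i=1-\gamma$, $\gamma\ge 0$. For a partition $\lambda$, $s_\lambda(\omega)$ denotes the image of the Schur function $s_\lambda$ under the algebra morphism from the algebra of symmetric functions $\mathbb{Q}[p_1,p_2,\dots]$ to $\mathbb{R}$ that sends the power sum $p_1$ to $\sum_i\alpha_i+\sum_i\beta_i+\gamma=1$ and $p_k$, $k\ge 2$, to $\sum_i\alpha_i^k+(-1)^{k-1}\sum_i\beta_i^k$. An $\omega$-shuffle of a deck of $n$ cards ordered $1,\dots,n$ is the following random procedure. (1) Cut the deck into consecutive blocks of sizes $n_1,n_2,\dots,m_1,m_2,\dots,l$ (in this order, with sum $n$), chosen with probability $$\frac{n!}{\prod_i n_i!\,\prod_j m_j!\;l!}\,\prod_i\alpha_i^{n_i}\,\prod_j\beta_j^{m_j}\,\gamma^{l}.$$ (2) Reverse the order of the cards in each of the blocks of sizes $m_1,m_2,\dots$, and put the cards of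 the last block (of size $l$) in a uniformly random order. (3) Shuffle the blocks together, all interleavings that preserve the order of the cards inside each block being equally likely. The resulting permutation $\sigma$ of $\{1,\dots,n\}$ is the word $\sigma(1)\sigma(2)\cdots\sigma(n)$ of the cards read from top to bottom. For $0\le k\le n$, let $\Lambda_k(\sigma)$ be the shape of the tableau obtained by Robinson–Schensted (row) insertion of the first $k$ letters of $\sigma$. Write $\lambda\nearrow\Lambda$ if the Young diagram $\Lambda$ is obtained from $\lambda$ by adding one box. **Theorem 6.4.** For every $\omega$ in the Thoma simplex and every $n\ge 0$, if $\sigma$ is a random permutation obtained by an $\omega$-shuffle of $n$ cards, then $(\Lambda_k(\sigma))_{0\le k\le n}$ is a Markov chain on the set of partitions, started at $\Lambda_0(\sigma)=\emptyset$, with transition probabilities $$p(\lambda,\Lambda)=\mathbf{1}_{\lambda\nearrow\Lambda}\,\frac{s_\Lambda(\omega)}{s_\lambda(\omega)}.$$ That is, every partition $\lambda$ visited by the chain with positive probability satisfies $s_\lambda(\omega)>0$, and for every $k<n$, all partitions $\lambda^{(0)},\dots,\lambda^{(k)}$ with $\mathbb{P}[\Lambda_0(\sigma)=\lambda^{(0)},\dots,\Lambda_k(\sigma)=\lambda^{(k)}]>0$,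 and every partition $\Lambda$, $$\mathbb{P}\big[\Lambda_{k+1}(\sigma)=\Lambda \,\big|\, \Lambda_0(\sigma)=\lambda^{(0)},\dots,\Lambda_k(\sigma)=\lambda^{(k)}\big]=p(\lambda^{(k)},\Lambda).$$ -/

import Mathlib

open Finset MeasureTheory ProbabilityTheory
open scoped ENNReal

namespace OmegaShuffle

/-- The Thoma simplex: pairs of non-increasing sequences of non-negative reals whose sums add up
to at most one. The sequences are indexed from zero. -/
structure ThomaSimplex where
  α : ℕ → ℝ
  β : ℕ → ℝ
  α_nonneg : ∀ i, 0 ≤ α i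
  β_nonneg : ∀ i, 0 ≤ β i
  α_antitone : Antitone α
  β_antitone : Antitone β
  α_summable : Summable α
  β_summable : Summable β
  sum_le_one : ∑' i, α i + ∑' i, β i ≤ 1

/-- The defect of a point of the Thoma simplex. -/
noncomputable def ThomaSimplex.γ (ω : ThomaSimplex) : ℝ :=
  1 - (∑' i, ω.α i + ∑' i, ω.β i)

/-! Blocks of cards. -/

/-- Labels of the blocks into which the deck is cut: the blocks with parameters `α i`, those with
parameters `β j`, and the last block, with parameter `γ`. -/
inductive Block where
  | up (i : ℕ)
  | down (j : ℕ)
  | last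

/-- The order of the blocks in the deck: `up 0, up 1, …, down 0, down 1, …, last`. -/
def Block.key : Block → ℕ ×ₗ ℕ
  | .up i => toLex (0, i)
  | .down j => toLex (1, j)
  | .last => toLex (2, 0)

theorem Block.key_injective : Function.Injective Block.key := by
  rintro (i | i | _) (j | j | _) h <;> simp_all [Block.key]

noncomputable instance : LinearOrder Block := LinearOrder.lift' Block.key Block.key_injective

/-- The parameter of a block. -/
noncomputable def ThomaSimplex.weight (ω : ThomaSimplex) : Block → ℝ
  | .up i => ω.α i
  | .down j => ω.β j
  | .last => ω.γ

theorem ThomaSimplex.weight_nonneg (ω : ThomaSimplex) (b : Block) : 0 ≤ ω.weight b := by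
  cases b with
  | up i => exact ω.α_nonneg i
  | down j => exact ω.β_nonneg j
  | last => exact sub_nonneg.2 ω.sum_le_one

def Block.equivSum : (ℕ ⊕ ℕ) ⊕ Unit ≃ Block where
  toFun := Sum.elim (Sum.elim .up .down) fun _ => .last
  invFun
    | .up i => .inl (.inl i)
    | .down j => .inl (.inr j)
    | .last => .inr ()
  left_inv := by rintro ((i | j) | u) <;> rfl
  right_inv := by rintro (i | j | _) <;> rfl

theorem ThomaSimplex.tsum_weight (ω : ThomaSimplex) :
    ∑' b, ENNReal.ofReal (ω.weight b) = 1 := by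
  rw [← Block.equivSum.tsum_eq, ENNReal.summable.tsum_sum ENNReal.summable,
    ENNReal.summable.tsum_sum ENNReal.summable]
  simp only [Block.equivSum, Equiv.coe_fn_mk, Sum.elim_inl, Sum.elim_inr, ThomaSimplex.weight,
    tsum_fintype, Finset.univ_unique, Finset.sum_singleton]
  rw [← ENNReal.ofReal_tsum_of_nonneg ω.α_nonneg ω.α_summable,
    ← ENNReal.ofReal_tsum_of_nonneg ω.β_nonneg ω.β_summable,
    ← ENNReal.ofReal_add (tsum_nonneg ω.α_nonneg) (tsum_nonneg ω.β_nonneg),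
    ← ENNReal.ofReal_add (add_nonneg (tsum_nonneg ω.α_nonneg) (tsum_nonneg ω.β_nonneg))
      (show 0 ≤ ω.γ from ω.weight_nonneg .last)]
  simp [ThomaSimplex.γ]

/-- The probability distribution `(α, β, γ)` on the set of blocks. -/
noncomputable def ThomaSimplex.blockLaw (ω : ThomaSimplex) : PMF Block :=
  ⟨fun b => ENNReal.ofReal (ω.weight b), ω.tsum_weight ▸ ENNReal.summable.hasSum⟩

/-! The multinomial law. -/

/-- Families of sizes `(c b)` with sum `n`. -/
abbrev Sizes (ι : Type*) (n : ℕ) : Type _ := {c : ι →₀ ℕ // c.sum (fun _ m => m) = n}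

theorem tsum_multinomial {ι : Type*} (p : PMF ι) (n : ℕ) :
    ∑' c : Sizes ι n, (c.1.multinomial : ℝ≥0∞) * c.1.prod (fun b m => p b ^ m) = 1 := by
  classical
  set f : (ι →₀ ℕ) → ℝ≥0∞ := fun c => (c.multinomial : ℝ≥0∞) * c.prod (fun b m => p b ^ m)
    with hf
  have key : ∀ s : Finset ι, ∑ c ∈ s.finsuppAntidiag n, f c = (∑ b ∈ s, p b) ^ n := by
    intro s
    rw [Finset.sum_pow_eq_sum_piAntidiag]
    refine Finset.sum_bij (fun c _ => (c : ι → ℕ)) ?_ ?_ ?_ ?_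
    · intro c hc
      rw [mem_finsuppAntidiag] at hc
      rw [mem_piAntidiag]
      exact ⟨hc.1, fun i hi => hc.2 (Finsupp.mem_support_iff.2 hi)⟩
    · intro a _ b _ h
      exact DFunLike.coe_injective h
    · intro g hg
      rw [mem_piAntidiag] at hg
      refine ⟨Finsupp.onFinset s g (fun i hi => hg.2 i hi), ?_, rfl⟩
      rw [mem_finsuppAntidiag]
      exact ⟨hg.1, Finsupp.support_onFinset_subset⟩
    · intro c hc
      rw [mem_finsuppAntidiag] at hc
      simp only [hf]
      rw [Finsupp.multinomial_eq_of_support_subset hc.2,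
        Finsupp.prod_of_support_subset c hc.2 _ (fun _ _ => pow_zero _)]
  have mem : ∀ (s : Finset ι) (c : ι →₀ ℕ), c ∈ s.finsuppAntidiag n ↔
      c.sum (fun _ m => m) = n ∧ c.support ⊆ s := fun s c => mem_finsuppAntidiag'
  apply le_antisymm
  · rw [ENNReal.tsum_eq_iSup_sum]
    refine iSup_le fun T => ?_
    set s : Finset ι := T.biUnion fun c => c.1.support
    calc ∑ c ∈ T, f c.1 = ∑ c ∈ T.map (Function.Embedding.subtype _), f c := by simp
      _ ≤ ∑ c ∈ s.finsuppAntidiag n, f c := by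
        refine Finset.sum_le_sum_of_subset fun c hc => ?_
        obtain ⟨d, hd, rfl⟩ := Finset.mem_map.1 hc
        exact (mem _ _).2 ⟨d.2, fun x hx => Finset.mem_biUnion.2 ⟨d, hd, hx⟩⟩
      _ = (∑ b ∈ s, p b) ^ n := key s
      _ ≤ 1 := pow_le_one' (p.tsum_coe ▸ ENNReal.sum_le_tsum s) n
  · have lim : Filter.Tendsto (fun s : Finset ι => (∑ b ∈ s, p b) ^ n) Filter.atTop
        (nhds (1 ^ n)) := ((ENNReal.continuous_pow n).tendsto 1).comp p.2
    rw [one_pow] at lim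
    refine le_of_tendsto' lim fun s => ?_
    rw [← key]
    calc ∑ c ∈ s.finsuppAntidiag n, f c
        = ∑ c ∈ (s.finsuppAntidiag n).subtype (fun c => c.sum (fun _ m => m) = n), f c.1 := by
          rw [Finset.sum_subtype_of_mem (f := f)]
          exact fun c hc => ((mem _ _).1 hc).1
      _ ≤ _ := ENNReal.sum_le_tsum _

/-- The multinomial law of size `n` and parameters `p`:
`ℙ[c] = n! / ∏ (c b)! * ∏ (p b) ^ (c b)`. -/
noncomputable def multinomialLaw {ι : Type*} (p : PMF ι) (n : ℕ) : PMF (Sizes ι n) :=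
  ⟨fun c => (c.1.multinomial : ℝ≥0∞) * c.1.prod (fun b m => p b ^ m),
    tsum_multinomial p n ▸ ENNReal.summable.hasSum⟩

/-! The shuffle. A state of the deck is a permutation `ρ` of `Fin n`, `ρ x` being the card in
position `x` from the top; in other words, the deck is the word `ρ 0, ρ 1, …, ρ (n - 1)`. -/

theorem card_toMultiset_sizes {n : ℕ} (c : Sizes Block n) :
    (c.1.toMultiset.sort (· ≤ ·)).length = n := by
  rw [Multiset.length_sort, Finsupp.card_toMultiset]
  exact c.2

/-- The block of each card when the ordered deck is cut into consecutive blocks of sizes `c`: the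
list of the blocks of the successive cards is the sorted list with `c b` copies of each `b`. -/
noncomputable def blockOf {n : ℕ} (c : Sizes Block n) (x : Fin n) : Block :=
  (c.1.toMultiset.sort (· ≤ ·)).get (x.cast (card_toMultiset_sizes c).symm)

theorem blockOf_monotone {n : ℕ} (c : Sizes Block n) : Monotone (blockOf c) := by
  intro x y h
  exact (Multiset.pairwise_sort c.1.toMultiset (· ≤ ·)).sortedLE.monotone_get h

open Classical in
/-- The decks obtained from the ordered deck by reversing the blocks with parameters `β j` and by
rearranging arbitrarily the cards of the last block, the other blocks being left unchanged. -/
noncomputable def rearrangements {n : ℕ} (b : Fin n → Block) : Finset (Equiv.Perm (Fin n)) :=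
  Finset.univ.filter fun ρ => (∀ x, b (ρ x) = b x) ∧
    ∀ x y, x < y → b x = b y →
      match b x with
      | .up _ => ρ x < ρ y
      | .down _ => ρ y < ρ x
      | .last => True

open Classical in
/-- The shuffles of the blocks of the deck `ρ`: the decks in which the cards of each block appear
in the same relative order as in `ρ`. -/
noncomputable def riffles {n : ℕ} (b : Fin n → Block) (ρ : Equiv.Perm (Fin n)) :
    Finset (Equiv.Perm (Fin n)) :=
  Finset.univ.filter fun σ => ∀ x y, x < y → b (ρ x) = b (ρ y) → σ.symm (ρ x) < σ.symm (ρ y)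

theorem rearrangements_nonempty {n : ℕ} (b : Fin n → Block) (hb : Monotone b) :
    (rearrangements b).Nonempty := by
  classical
  let f : Fin n → Block ×ₗ ℤ := fun x => toLex (b x, match b x with
    | .down _ => -(x : ℤ)
    | _ => (x : ℤ))
  have hmono : Monotone (f ∘ Tuple.sort f) := Tuple.monotone_sort f
  set ρ := Tuple.sort f with hρ
  have hbm : Monotone (b ∘ ρ) := by
    intro x y h
    have := hmono h
    simp only [Function.comp, f, Prod.Lex.toLex_le_toLex] at this
    rcases this with h | h
    · exact h.le
    · exact h.1.le
  have hbρ : ∀ x, b (ρ x) = b x := by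
    have h1 := Tuple.comp_sort_eq_comp_iff_monotone.2 hbm
    have h2 := (Tuple.comp_sort_eq_comp_iff_monotone (f := b) (σ := 1)).2 (by simpa using hb)
    intro x
    exact congrFun (h1.trans h2.symm) x
  refine ⟨ρ, ?_⟩
  simp only [rearrangements, Finset.mem_filter, Finset.mem_univ, true_and]
  refine ⟨hbρ, fun x y hxy hb' => ?_⟩
  have hne : ρ x ≠ ρ y := fun h => hxy.ne (ρ.injective h)
  have := hmono hxy.le
  simp only [Function.comp, f, Prod.Lex.toLex_le_toLex, hbρ, hb', lt_irrefl, false_or,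
    true_and] at this
  rw [hb']
  cases hby : b y <;> simp only [hby] at this ⊢ <;> grind

theorem riffles_nonempty {n : ℕ} (b : Fin n → Block) (ρ : Equiv.Perm (Fin n)) :
    (riffles b ρ).Nonempty :=
  ⟨ρ, by simpa [riffles] using fun x y h _ => h⟩

/-- The law of the deck after an `ω`-shuffle of `n` cards: the sizes of the blocks are chosen
with the multinomial law; the blocks with parameters `β j` are reversed and the last one is
randomized uniformly; then a shuffle of the blocks is chosen uniformly. -/
noncomputable def shuffle (ω : ThomaSimplex) (n : ℕ) : PMF (Equiv.Perm (Fin n)) :=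
  (multinomialLaw ω.blockLaw n).bind fun c =>
    (PMF.uniformOfFinset (rearrangements (blockOf c))
      (rearrangements_nonempty _ (blockOf_monotone c))).bind fun ρ =>
        PMF.uniformOfFinset (riffles (blockOf c) ρ) (riffles_nonempty _ ρ)

/-! Robinson-Schensted insertion. A tableau is the list of its rows. -/

/-- Insertion of `a` into a row: the first entry greater than `a` is replaced by `a` and returned,
or `a` is added at the end of the row if there is no such entry. -/
def rowInsert {A : Type*} [LinearOrder A] (a : A) : List A → List A × Option A
  | [] => ([a], none)
  | b :: r => if a < b then (a :: r, some b) else (b :: (rowInsert a r).1, (rowInsert a r).2)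

/-- Insertion of `a` into a tableau. -/
def insertion {A : Type*} [LinearOrder A] (a : A) : List (List A) → List (List A)
  | [] => [[a]]
  | r :: T =>
    match (rowInsert a r).2 with
    | none => (rowInsert a r).1 :: T
    | some b => (rowInsert a r).1 :: insertion b T

/-- The tableau `P(w)` obtained by inserting successively the letters of `w`, starting from the
empty tableau. -/
def tableauP {A : Type*} [LinearOrder A] (w : List A) : List (List A) :=
  w.foldl (fun T a => insertion a T) []

/-- The row `s` can stand after the row `r` in a tableau with increasing columns. -/
def Below {A : Type*} [LinearOrder A] : List A → List A → Prop
  | _, [] => True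
  | [], _ :: _ => False
  | a :: r, b :: s => a < b ∧ Below r s

theorem Below.length_le {A : Type*} [LinearOrder A] :
    ∀ {r s : List A}, Below r s → s.length ≤ r.length
  | _, [], _ => by simp
  | [], _ :: _, h => h.elim
  | _ :: _, _ :: _, h => by simpa using h.2.length_le

theorem lt_of_rowInsert {A : Type*} [LinearOrder A] (a b : A) :
    ∀ r : List A, (rowInsert a r).2 = some b → a < b
  | [], h => by simp [rowInsert] at h
  | x :: r, h => by
    by_cases hx : a < x
    · simp [rowInsert, hx] at h; exact h ▸ hx
    · simp [rowInsert, hx] at h; exact lt_of_rowInsert a b r h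

theorem Below.rowInsert_left {A : Type*} [LinearOrder A] (a : A) :
    ∀ {r s : List A}, Below r s → Below (rowInsert a r).1 s
  | _, [], _ => by simp [Below]
  | [], _ :: _, h => h.elim
  | x :: r, y :: s, h => by
    by_cases hx : a < x
    · simp only [rowInsert, hx, if_true, Below]; exact ⟨hx.trans h.1, h.2⟩
    · simp only [rowInsert, hx, if_false, Below]; exact ⟨h.1, h.2.rowInsert_left a⟩

theorem Below.rowInsert_rowInsert {A : Type*} [LinearOrder A] (a b : A) :
    ∀ {r s : List A}, Below r s → (rowInsert a r).2 = some b →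
      Below (rowInsert a r).1 (rowInsert b s).1
  | [], _, _, hb => by simp [rowInsert] at hb
  | x :: r, s, h, hb => by
    by_cases hx : a < x
    · simp only [rowInsert, hx, if_true, Option.some.injEq] at hb ⊢
      subst hb
      cases s with
      | nil => simp [rowInsert, Below, hx]
      | cons y s => simp [rowInsert, h.1, Below, hx, h.2]
    · simp only [rowInsert, hx, if_false] at hb ⊢
      have hab := lt_of_rowInsert a b r hb
      have hxb : x < b := (not_lt.1 hx).trans_lt hab
      cases s with
      | nil => simp [rowInsert, Below, hxb]
      | cons y s =>
        by_cases hy : b < y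
        · simp only [rowInsert, hy, if_true, Below]
          exact ⟨hxb, h.2.rowInsert_left a⟩
        · simp only [rowInsert, hy, if_false, Below]
          exact ⟨h.1, h.2.rowInsert_rowInsert a b hb⟩

theorem insertion_isChain {A : Type*} [LinearOrder A] :
    ∀ (T : List (List A)) (a : A), T.IsChain Below → (insertion a T).IsChain Below
  | [], a, _ => by simp [insertion]
  | [r], a, _ => by
    cases hb : (rowInsert a r).2 with
    | none => simp [insertion, hb]
    | some b =>
      have := Below.rowInsert_rowInsert a b (r := r) (s := []) (by simp [Below]) hb
      simpa [insertion, hb, rowInsert] using this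
  | r :: s :: T, a, h => by
    rw [List.isChain_cons_cons] at h
    cases hb : (rowInsert a r).2 with
    | none =>
      simp only [insertion, hb, List.isChain_cons_cons]
      exact ⟨h.1.rowInsert_left a, h.2⟩
    | some b =>
      have ih := insertion_isChain (s :: T) b h.2
      have h1 := h.1.rowInsert_rowInsert a b hb
      cases hb' : (rowInsert b s).2 with
      | none =>
        simp only [insertion, hb, hb', List.isChain_cons_cons] at ih ⊢
        exact ⟨h1, ih⟩
      | some b' =>
        simp only [insertion, hb, hb'] at ih ⊢
        exact List.isChain_cons_cons.2 ⟨h1, ih⟩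

theorem tableauP_isChain {A : Type*} [LinearOrder A] (w : List A) :
    (tableauP w).IsChain Below := by
  induction w using List.reverseRecOn with
  | nil => simp [tableauP]
  | append_singleton w a ih =>
    rw [tableauP, List.foldl_append]
    exact insertion_isChain _ a ih

theorem tableauP_sortedGE {A : Type*} [LinearOrder A] (w : List A) :
    ((tableauP w).map List.length).SortedGE := by
  rw [List.sortedGE_iff_isChain, List.isChain_map]
  exact (tableauP_isChain w).imp fun _ _ h => h.length_le

/-- The shape of the tableau obtained by inserting the letters of `w`. -/
def insertionShape {A : Type*} [LinearOrder A] (w : List A) : YoungDiagram :=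
  YoungDiagram.ofRowLens ((tableauP w).map List.length) (tableauP_sortedGE w)

/-- `Λ_k(σ)`: the shape of the tableau obtained by inserting the `k` first letters of the word
`σ(1) σ(2) … σ(n)`. -/
def shapeProcess {n : ℕ} (σ : Equiv.Perm (Fin n)) (k : ℕ) : YoungDiagram :=
  insertionShape ((List.ofFn σ).take k)

/-- `λ ↗ μ`: the diagram `μ` is obtained from `λ` by adding a box. -/
def AddBox (l m : YoungDiagram) : Prop := l ≤ m ∧ m.card = l.card + 1

/-! Symmetric functions, as polynomials in the power sums. -/

/-- The algebra of symmetric functions with rational coefficients: the polynomial algebra on the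
power sums `p_1, p_2, …`, the variable `X k` being `p_(k+1)`. -/
abbrev SymFun : Type := MvPolynomial ℕ ℚ

/-- The specialization of the symmetric functions with given power sums
(`p k` is the value of `p_(k+1)`). -/
noncomputable def specialize {R : Type*} [CommRing R] [Algebra ℚ R] (p : ℕ → R) :
    SymFun →ₐ[ℚ] R := MvPolynomial.aeval p

/-- The complete homogeneous symmetric functions, by the recursion
`(n + 1) h_(n+1) = p_1 h_n + p_2 h_(n-1) + ⋯ + p_(n+1) h_0`. -/
noncomputable def completeHom : ℕ → SymFun
  | 0 => 1
  | n + 1 => MvPolynomial.C ((n + 1 : ℚ)⁻¹) *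
      ∑ k : Fin (n + 1), MvPolynomial.X (k : ℕ) * completeHom (n - k)

/-- The `N × N` matrix `(h_(λ_i - i + j))`, with `h_m = 0` for `m < 0`. -/
noncomputable def jacobiTrudi (l : YoungDiagram) (N : ℕ) : Matrix (Fin N) (Fin N) SymFun :=
  fun i j => if (i : ℕ) ≤ l.rowLen i + j then completeHom (l.rowLen i + j - i) else 0

/-- The Schur function `s_λ`, by the Jacobi-Trudi formula. By `schurFun_eq` below, it is the
symmetric function whose value at variables `x_1, …, x_N`, `N ≥ ℓ(λ)`, is the quotient of
alternants `a_(λ+δ) / a_δ`. -/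
noncomputable def schurFun (l : YoungDiagram) : SymFun := (jacobiTrudi l (l.colLen 0)).det

/-- The alternant `∑ ε(τ) ∏ x_i ^ e_(τ i)`. -/
noncomputable def alternant {R : Type*} [CommRing R] {N : ℕ} (x : Fin N → R) (e : Fin N → ℕ) : R :=
  ∑ τ : Equiv.Perm (Fin N), ((Equiv.Perm.sign τ : ℤ) : R) * ∏ i, x i ^ e (τ i)

theorem alternant_eq_det {R : Type*} [CommRing R] {N : ℕ} (x : Fin N → R) (e : Fin N → ℕ) :
    alternant x e = (Matrix.of fun i j => x i ^ e j : Matrix (Fin N) (Fin N) R).det := by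
  rw [← Matrix.det_transpose, Matrix.det_apply']
  simp [alternant]

theorem det_jacobiTrudi (l : YoungDiagram) (k : ℕ) :
    (jacobiTrudi l (l.colLen 0 + k)).det = schurFun l := by
  induction k with
  | zero => rfl
  | succ k ih =>
    have hrow : l.rowLen (l.colLen 0 + k) = 0 := by
      by_contra h
      have : (l.colLen 0 + k, 0) ∈ l := YoungDiagram.mem_iff_lt_rowLen.2 (Nat.pos_of_ne_zero h)
      have := YoungDiagram.mem_iff_lt_colLen.1 this
      omega
    change (jacobiTrudi l (l.colLen 0 + k + 1)).det = _
    rw [Matrix.det_succ_row _ (Fin.last _), Finset.sum_eq_single (Fin.last _)]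
    · rw [← ih]
      have : (jacobiTrudi l (l.colLen 0 + k + 1)).submatrix (Fin.last _).succAbove
          (Fin.last _).succAbove = jacobiTrudi l (l.colLen 0 + k) := by
        ext i j
        simp [jacobiTrudi]
      rw [this]
      simp [jacobiTrudi, hrow, completeHom, ← two_mul]
    · intro j _ hj
      have : (j : ℕ) < l.colLen 0 + k := by
        have := Fin.val_lt_last hj
        simpa using this
      simp [jacobiTrudi, hrow, this]
    · simp

open PowerSeries in
theorem specialize_completeHom {R : Type*} [CommRing R] [Algebra ℚ R] {N : ℕ} (x : Fin N → R)
    (n : ℕ) : specialize (fun k => ∑ i, x i ^ (k + 1)) (completeHom n) =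
      coeff n (∏ i, PowerSeries.mk fun m => x i ^ m) := by
  have hg : ∀ a : R, (PowerSeries.mk fun m => a ^ m) * (1 - C a * X) = 1 := by
    intro a
    ext m
    rw [mul_sub, mul_one, ← mul_assoc, map_sub, mul_comm _ (C a)]
    cases m with
    | zero => simp
    | succ m => simp [coeff_succ_mul_X, coeff_one, pow_succ']
  have hg' : ∀ a : R, d⁄dX R (PowerSeries.mk fun m => a ^ m) =
      (PowerSeries.mk fun m => a ^ m) * PowerSeries.mk fun m => a ^ (m + 1) := by
    intro a
    have h1 : (PowerSeries.mk fun m => a ^ (m + 1)) = C a * PowerSeries.mk fun m => a ^ m := by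
      ext m; simp [pow_succ']
    set g := PowerSeries.mk fun m => a ^ m
    have h2 := congrArg (d⁄dX R) (hg a)
    simp only [Derivation.leibniz, map_sub, derivative_one, smul_eq_mul, derivative_C,
      derivative_X, zero_sub, mul_zero, add_zero, mul_one] at h2
    rw [h1]
    linear_combination g * h2 - (d⁄dX R g) * hg a
  have hG : ∀ s : Finset (Fin N), d⁄dX R (∏ i ∈ s, PowerSeries.mk fun m => x i ^ m) =
      (∏ i ∈ s, PowerSeries.mk fun m => x i ^ m) *
        PowerSeries.mk fun m => ∑ i ∈ s, x i ^ (m + 1) := by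
    intro s
    induction s using Finset.induction_on with
    | empty => simp; ext; simp
    | insert a s ha ih =>
      have : (PowerSeries.mk fun m => ∑ i ∈ insert a s, x i ^ (m + 1)) =
          (PowerSeries.mk fun m => x a ^ (m + 1)) +
            PowerSeries.mk fun m => ∑ i ∈ s, x i ^ (m + 1) := by
        ext m; simp [Finset.sum_insert ha]
      rw [Finset.prod_insert ha, Derivation.leibniz, ih, hg', this]
      simp only [smul_eq_mul]
      ring
  induction n using Nat.strong_induction_on with
  | _ n ih =>
    cases n with
    | zero => simp [completeHom, coeff_zero_eq_constantCoeff_apply, map_prod]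
    | succ n =>
      have h1 := congrArg (coeff n) (hG Finset.univ)
      rw [coeff_derivative, mul_comm (∏ i, _), coeff_mul, Finset.Nat.sum_antidiagonal_eq_sum_range_succ_mk,
        Finset.sum_range] at h1
      rw [completeHom, map_mul, map_sum]
      have h2 : ∀ k : Fin (n + 1), specialize (fun k => ∑ i, x i ^ (k + 1))
          (MvPolynomial.X (k : ℕ) * completeHom (n - k)) =
          coeff (k : ℕ) (PowerSeries.mk fun m => ∑ i, x i ^ (m + 1)) *
            coeff (n - k) (∏ i, PowerSeries.mk fun m => x i ^ m) := by
        intro k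
        rw [map_mul, ih (n - k) (by omega)]
        simp [specialize]
      rw [Finset.sum_congr rfl fun k _ => h2 k, ← h1]
      have h3 : specialize (fun k => ∑ i, x i ^ (k + 1)) (MvPolynomial.C ((n + 1 : ℚ)⁻¹)) =
          algebraMap ℚ R ((n + 1 : ℚ)⁻¹) := by simp [specialize]
      have h4 : ((n : R) + 1) = algebraMap ℚ R (n + 1) := by simp
      rw [h3, h4, mul_left_comm, ← map_mul, inv_mul_cancel₀ (by positivity), map_one, mul_one]

/-- There is a matrix `M`, independent of `λ`, such that
`x_i ^ (λ_j + N - 1 - j) = ∑ M_il h_(λ_j - j + l)`. -/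
theorem exists_matrix {R : Type*} [CommRing R] [Algebra ℚ R] {N : ℕ} (x : Fin N → R) :
    ∃ M : Matrix (Fin N) (Fin N) R, ∀ l : YoungDiagram,
      (Matrix.of fun i j => x i ^ (l.rowLen j + (N - 1 - j)) : Matrix (Fin N) (Fin N) R) =
        M * ((jacobiTrudi l N).map (specialize fun k => ∑ i, x i ^ (k + 1))).transpose := by
  classical
  let E : Fin N → Polynomial R := fun i =>
    ∏ j ∈ Finset.univ.erase i, (1 - Polynomial.C (x j) * Polynomial.X)
  have hdeg : ∀ i, (E i).natDegree ≤ N - 1 := by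
    intro i
    refine (Polynomial.natDegree_prod_le _ _).trans ?_
    refine (Finset.sum_le_card_nsmul _ _ 1 fun j _ => ?_).trans (by simp)
    compute_degree
  have hE : ∀ i, (∏ j, PowerSeries.mk fun m => x j ^ m) * (E i : PowerSeries R) =
      PowerSeries.mk fun m => x i ^ m := by
    intro i
    have hcoe : (E i : PowerSeries R) =
        ∏ j ∈ Finset.univ.erase i, (1 - PowerSeries.C (x j) * PowerSeries.X) := by
      change Polynomial.coeToPowerSeries.ringHom (E i) = _
      simp [E, map_prod]
    rw [hcoe, ← Finset.mul_prod_erase Finset.univ _ (Finset.mem_univ i), mul_assoc,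
      ← Finset.prod_mul_distrib, Finset.prod_eq_one, mul_one]
    intro j _
    ext m
    rw [mul_sub, mul_one, ← mul_assoc, map_sub, mul_comm _ (PowerSeries.C (x j))]
    cases m with
    | zero => simp
    | succ m => simp [PowerSeries.coeff_succ_mul_X, PowerSeries.coeff_one, pow_succ']
  refine ⟨Matrix.of fun i l => (E i).coeff (N - 1 - l), fun l => ?_⟩
  ext i j
  have h := congrArg (PowerSeries.coeff (l.rowLen j + (N - 1 - j))) (hE i)
  rw [PowerSeries.coeff_mk] at h
  rw [Matrix.of_apply, ← h, Matrix.mul_apply, mul_comm, PowerSeries.coeff_mul,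
    Finset.Nat.sum_antidiagonal_eq_sum_range_succ_mk]
  simp only [Matrix.of_apply, Polynomial.coeff_coe, Matrix.transpose_apply, Matrix.map_apply, jacobiTrudi]
  rw [← Equiv.sum_comp Fin.revPerm]
  set D := l.rowLen j + (N - 1 - j)
  set G := ∏ j, PowerSeries.mk fun m => x j ^ m with hGdef
  have e1 : ∀ k : Fin N, (E i).coeff (N - 1 - (Fin.revPerm k : Fin N)) *
      specialize (fun k => ∑ i, x i ^ (k + 1))
        (if (j : ℕ) ≤ l.rowLen j + (Fin.revPerm k : Fin N) then
          completeHom (l.rowLen j + (Fin.revPerm k : Fin N) - j) else 0) =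
      if (k : ℕ) ≤ D then (E i).coeff k * PowerSeries.coeff (D - k) G else 0 := by
    intro k
    have hk := k.2
    have hj := j.2
    have hr : ((Fin.revPerm k : Fin N) : ℕ) = N - (k + 1) := by simp [Fin.val_rev]
    rw [hr, show N - 1 - (N - (k + 1)) = (k : ℕ) by omega]
    by_cases hkD : (k : ℕ) ≤ D
    · rw [if_pos hkD, if_pos (by omega), specialize_completeHom,
        show l.rowLen j + (N - (k + 1)) - j = D - k by omega]
    · rw [if_neg hkD, if_neg (by omega), map_zero, mul_zero]
  rw [Finset.sum_congr rfl fun k _ => e1 k]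
  rw [Fin.sum_univ_eq_sum_range
    (fun k => if k ≤ D then (E i).coeff k * PowerSeries.coeff (D - k) G else 0) N,
    ← Finset.sum_filter]
  have hN := i.2
  have hset : (Finset.range N).filter (fun k => k ≤ D) =
      (Finset.range D.succ).filter (fun k => k < N) := by
    ext k; simp; omega
  rw [hset]
  symm
  refine Finset.sum_subset (Finset.filter_subset _ _) fun k hk hk' => ?_
  rw [Polynomial.coeff_eq_zero_of_natDegree_lt, zero_mul]
  simp at hk hk'
  have := hdeg i
  omega

theorem colLen_bot : (⊥ : YoungDiagram).colLen 0 = 0 := by simp [YoungDiagram.colLen]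

theorem schurFun_bot : schurFun ⊥ = 1 := by
  unfold schurFun
  rw [Matrix.det_eq_one_of_card_eq_zero (by simp [colLen_bot])]

/-- `s_λ(x_1, …, x_N) a_δ(x_1, …, x_N) = a_(λ+δ)(x_1, …, x_N)` for `N ≥ ℓ(λ)`. -/
theorem schurFun_eq {R : Type*} [CommRing R] [Algebra ℚ R] {N : ℕ} (x : Fin N → R)
    (l : YoungDiagram) (hl : l.colLen 0 ≤ N) :
    specialize (fun k => ∑ i, x i ^ (k + 1)) (schurFun l) * alternant x (fun j => N - 1 - j) =
      alternant x (fun j => l.rowLen j + (N - 1 - j)) := by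
  obtain ⟨M, hM⟩ := exists_matrix x
  have key : ∀ m : YoungDiagram, m.colLen 0 ≤ N →
      alternant x (fun j => m.rowLen j + (N - 1 - j)) =
        M.det * specialize (fun k => ∑ i, x i ^ (k + 1)) (schurFun m) := by
    intro m hm
    obtain ⟨k, rfl⟩ := Nat.exists_eq_add_of_le hm
    rw [alternant_eq_det, hM m, Matrix.det_mul, Matrix.det_transpose, ← det_jacobiTrudi m k]
    congr 1
    exact (AlgHom.map_det _ _).symm
  have h0 := key ⊥ (colLen_bot.trans_le N.zero_le)
  rw [schurFun_bot, map_one, mul_one] at h0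
  have hb : ∀ j, (⊥ : YoungDiagram).rowLen j = 0 := fun j => by simp [YoungDiagram.rowLen]
  simp only [hb, zero_add] at h0
  rw [h0, key l hl, mul_comm]

/-! The specialization of symmetric functions attached to a point of the Thoma simplex. -/

/-- The power sum `p_(k+1)(ω)`: `p_1(ω) = ∑ α_i + ∑ β_i + γ` and
`p_m(ω) = ∑ α_i ^ m + (-1) ^ (m - 1) ∑ β_i ^ m` for `m ≥ 2`. -/
noncomputable def ThomaSimplex.powerSum (ω : ThomaSimplex) (k : ℕ) : ℝ :=
  ∑' i, ω.α i ^ (k + 1) + (-1) ^ k * ∑' i, ω.β i ^ (k + 1) + if k = 0 then ω.γ else 0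

/-- `s_λ(ω)`. -/
noncomputable def ThomaSimplex.schur (ω : ThomaSimplex) (l : YoungDiagram) : ℝ :=
  specialize ω.powerSum (schurFun l)

open Classical in
/-- `p(λ, μ) = 1_{λ ↗ μ} s_μ(ω) / s_λ(ω)`. -/
noncomputable def ThomaSimplex.transition (ω : ThomaSimplex) (l m : YoungDiagram) : ℝ :=
  if AddBox l m then ω.schur m / ω.schur l else 0

/-- The process `X 0, …, X n`, with values in a discrete space, is a Markov chain with transition
probabilities `p`: given any history `X 0 = x 0, …, X k = x k` of positive probability with
`k < n`, the conditional law of `X (k + 1)` is `p (x k)`. -/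
def IsMarkovChain {Ω S : Type*} [MeasurableSpace Ω] (P : Measure Ω) (n : ℕ) (X : ℕ → Ω → S)
    (p : S → S → ℝ) : Prop :=
  ∀ k < n, ∀ x : ℕ → S, P (⋂ i ≤ k, X i ⁻¹' {x i}) ≠ 0 →
    ∀ y, (cond P (⋂ i ≤ k, X i ⁻¹' {x i})).real (X (k + 1) ⁻¹' {y}) = p (x k) y

end OmegaShuffle

/-! Give each of the `n` positions an independent random letter: a block, drawn with law (α, β, γ),
and a uniform real number. Rank the letters by block; letters of the same block are ranked by
increasing position in an `up` block, by decreasing position in a `down` block, and by their real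
numbers in the last block. The permutation of ranks has the law of the ω-shuffle (`shuffle_apply`).
Since insertion sees only relative order, the first `k` shapes are a function of the first `k`
independent letters.

A path of shapes carries the same information as the recording sequence of the word, which lists the
rows of the successive new boxes and is a lattice word. After reordering the letters by rank, the
event that the standardization is `t` depends on `t` only through the descents of `t⁻¹`
(`lettersLaw_std_congr`), and these are determined by the insertion tableau of `t`
(`symm_lt_symm_iff_of_tableauP_eq`). As the Robinson-Schensted map is a bijection, recording
sequences with the same final shape λ are equally likely (`recordProb_congr`). Their common
probability is `shapeProb`.

It remains to recognize s_λ(ω). By the row bumping lemma, `r` further letters add boxes in rows of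
weakly decreasing index, hence a horizontal strip, exactly when they are increasing for `Precedes`.
They are independent of the previous letters, so `shapeProb` obeys the Pieri rule with
`increasingProb ω r` in the role of h_r (`shapeProb_mul_increasingProb`). A Pieri rule forces the
Jacobi-Trudi formula (`det_eq_of_pieri`). Finally `increasingProb ω r` is h_r(ω), because both have
generating function ∏ (1 - α_i z)⁻¹ ∏ (1 + β_j z) exp(γ z) (`increasingProb_eq_specialize`).

Hence each path from ∅ to λ has probability s_λ(ω), whatever the path, and the conditional
probability of the next step is a quotient of two such values. -/

namespace OmegaShuffle

/-! Row insertion and the rows of the new boxes. -/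

/-- The row of the box added to the shape of `T` by the insertion of `a`. -/
def newRow {A : Type*} [LinearOrder A] (a : A) : List (List A) → ℕ
  | [] => 0
  | r :: T =>
    match (rowInsert a r).2 with
    | none => 0
    | some b => newRow b T + 1

/-- The length of the row `i` of `T`. -/
def rowLength {A : Type*} (T : List (List A)) (i : ℕ) : ℕ := (T.map List.length).getD i 0

/-- Semistandard tableaux: non-empty sorted rows and increasing columns. -/
def IsTableau {A : Type*} [LinearOrder A] : List (List A) → Prop
  | [] => True
  | r :: T => r ≠ [] ∧ r.Pairwise (· ≤ ·) ∧ Below r (T.headD []) ∧ IsTableau T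

/-- The rows of the boxes added successively to the shape of `T` by the insertion of the letters
of a word. -/
def rowSeqFrom {A : Type*} [LinearOrder A] (T : List (List A)) : List A → List ℕ
  | [] => []
  | a :: w => newRow a T :: rowSeqFrom (insertion a T) w

/-- The recording sequence of a word: the rows of the boxes added successively. -/
def rowSeq {A : Type*} [LinearOrder A] (w : List A) : List ℕ := rowSeqFrom [] w

section
variable {A : Type*}

@[simp] theorem rowLength_nil (i : ℕ) : rowLength ([] : List (List A)) i = 0 := rfl

@[simp] theorem rowLength_cons_zero (r : List A) (T) : rowLength (r :: T) 0 = r.length := rfl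

@[simp] theorem rowLength_cons_succ (r : List A) (T) (i : ℕ) :
    rowLength (r :: T) (i + 1) = rowLength T i := by simp [rowLength]

theorem rowLength_zero (T : List (List A)) : rowLength T 0 = (T.headD []).length := by
  cases T <;> simp

variable [LinearOrder A]

theorem rowInsert_ne_nil (a : A) (r : List A) : (rowInsert a r).1 ≠ [] := by
  cases r with
  | nil => simp [rowInsert]
  | cons x r => by_cases h : a < x <;> simp [rowInsert, h]

theorem rowInsert_eq_none {a : A} : ∀ {r : List A}, (rowInsert a r).2 = none →
    (rowInsert a r).1 = r ++ [a] ∧ ∀ x ∈ r, x ≤ a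
  | [], _ => by simp [rowInsert]
  | x :: r, h => by
    by_cases hx : a < x
    · simp [rowInsert, hx] at h
    · simp only [rowInsert, hx, if_false] at h ⊢
      obtain ⟨h1, h2⟩ := rowInsert_eq_none h
      simp [h1]
      exact ⟨not_lt.1 hx, h2⟩

theorem rowInsert_of_forall_le {a : A} : ∀ {r : List A}, (∀ x ∈ r, x ≤ a) →
    rowInsert a r = (r ++ [a], none)
  | [], _ => by simp [rowInsert]
  | x :: r, h => by
    have hx : ¬ a < x := not_lt.2 (h x (by simp))
    simp [rowInsert, hx, rowInsert_of_forall_le (r := r) fun y hy => h y (by simp [hy])]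

theorem rowInsert_perm (a : A) : ∀ r : List A,
    ((rowInsert a r).2.toList ++ (rowInsert a r).1).Perm (a :: r)
  | [] => by simp [rowInsert]
  | x :: r => by
    by_cases hx : a < x
    · simpa [rowInsert, hx] using List.Perm.swap a x r
    · simp only [rowInsert, hx, if_false]
      exact (List.perm_middle).trans (((rowInsert_perm a r).cons x).trans (List.Perm.swap a x r))

theorem mem_rowInsert {a y : A} {r : List A} (h : y ∈ (rowInsert a r).1) : y = a ∨ y ∈ r := by
  have := (rowInsert_perm a r).subset (List.mem_append_right _ h)
  simpa using this

theorem self_mem_rowInsert (a : A) : ∀ r : List A, a ∈ (rowInsert a r).1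
  | [] => by simp [rowInsert]
  | x :: r => by
    by_cases hx : a < x
    · simp [rowInsert, hx]
    · simp [rowInsert, hx, self_mem_rowInsert a r]

theorem pairwise_rowInsert (a : A) : ∀ {r : List A}, r.Pairwise (· ≤ ·) →
    (rowInsert a r).1.Pairwise (· ≤ ·)
  | [], _ => by simp [rowInsert]
  | x :: r, h => by
    rw [List.pairwise_cons] at h
    by_cases hx : a < x
    · simp only [rowInsert, hx, if_true, List.pairwise_cons]
      exact ⟨fun y hy => hx.le.trans (h.1 y hy), h.2⟩
    · simp only [rowInsert, hx, if_false, List.pairwise_cons]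
      refine ⟨fun y hy => ?_, pairwise_rowInsert a h.2⟩
      rcases mem_rowInsert hy with rfl | hy
      exacts [not_lt.1 hx, h.1 y hy]

theorem length_rowInsert (a : A) (r : List A) :
    (rowInsert a r).1.length = r.length + if (rowInsert a r).2 = none then 1 else 0 := by
  have := (rowInsert_perm a r).length_eq
  cases h : (rowInsert a r).2 <;> simp [h] at this ⊢ <;> omega

theorem headD_insertion (b : A) (T : List (List A)) :
    (insertion b T).headD [] = (rowInsert b (T.headD [])).1 := by
  cases T with
  | nil => simp [insertion, rowInsert]
  | cons r T => cases h : (rowInsert b r).2 <;> simp [insertion, h]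

theorem IsTableau.insertion : ∀ {T : List (List A)} (a : A), IsTableau T →
    IsTableau (insertion a T)
  | [], a, _ => by simp [OmegaShuffle.insertion, IsTableau, Below]
  | r :: T, a, h => by
    obtain ⟨h1, h2, h3, h4⟩ := h
    cases hb : (rowInsert a r).2 with
    | none =>
      simp only [OmegaShuffle.insertion, hb, IsTableau]
      exact ⟨rowInsert_ne_nil a r, pairwise_rowInsert a h2, h3.rowInsert_left a, h4⟩
    | some b =>
      simp only [OmegaShuffle.insertion, hb, IsTableau]
      refine ⟨rowInsert_ne_nil a r, pairwise_rowInsert a h2, ?_, h4.insertion b⟩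
      rw [headD_insertion]
      exact h3.rowInsert_rowInsert a b hb

theorem rowLength_insertion : ∀ (T : List (List A)) (a : A) (i : ℕ),
    rowLength (insertion a T) i = rowLength T i + if newRow a T = i then 1 else 0
  | [], a, i => by
    cases i <;> simp [insertion, newRow]
  | r :: T, a, i => by
    have hl := length_rowInsert a r
    cases hb : (rowInsert a r).2 with
    | none =>
      simp only [hb, if_true] at hl
      cases i <;> simp [insertion, newRow, hb, hl]
    | some b =>
      cases i with
      | zero => simpa [insertion, newRow, hb] using hl
      | succ i => simp [insertion, newRow, hb, rowLength_insertion T b i]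

theorem insertion_flatten_perm : ∀ (T : List (List A)) (a : A),
    (insertion a T).flatten.Perm (a :: T.flatten)
  | [], a => by simp [insertion]
  | r :: T, a => by
    have h := rowInsert_perm a r
    cases hb : (rowInsert a r).2 with
    | none =>
      simp only [hb, Option.toList_none, List.nil_append] at h
      simpa [insertion, hb] using h.append_right T.flatten
    | some b =>
      simp only [hb, Option.toList_some, List.singleton_append] at h
      simp only [insertion, hb, List.flatten_cons]
      refine ((insertion_flatten_perm T b).append_left _).trans ?_
      exact List.perm_middle.trans (h.append_right T.flatten)

/-! Reverse insertion. -/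

/-- Reverse row insertion of `b` into the row `x :: r`, for `x < b`: the last entry less than `b`
is replaced by `b` and returned. -/
def unbump (b x : A) : List A → A × List A
  | [] => (x, [b])
  | y :: r => if y < b then ((unbump b y r).1, x :: (unbump b y r).2) else (x, b :: y :: r)

theorem unbump_le (b : A) : ∀ (r : List A) (x : A), (x :: r).Pairwise (· ≤ ·) →
    x ≤ (unbump b x r).1
  | [], x, _ => le_rfl
  | y :: r, x, h => by
    rw [List.pairwise_cons] at h
    by_cases hy : y < b
    · simp only [unbump, hy, if_true]
      exact (h.1 y (by simp)).trans (unbump_le b r y h.2)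
    · simp [unbump, hy]

theorem mem_unbump {b z : A} : ∀ {r : List A} {x : A}, z ∈ (unbump b x r).2 →
    z = b ∨ z ∈ x :: r
  | [], x, h => by simpa [unbump] using Or.inl h
  | y :: r, x, h => by
    by_cases hy : y < b
    · simp only [unbump, hy, if_true, List.mem_cons] at h
      rcases h with rfl | h
      · simp
      · rcases mem_unbump h with h | h
        · exact Or.inl h
        · exact Or.inr (List.mem_cons_of_mem _ h)
    · simp only [unbump, hy, if_false, List.mem_cons] at h
      simp; tauto

theorem pairwise_unbump {b : A} : ∀ {r : List A} {x : A}, x < b → (x :: r).Pairwise (· ≤ ·) →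
    (unbump b x r).2.Pairwise (· ≤ ·)
  | [], x, _, _ => by simp [unbump]
  | y :: r, x, hx, h => by
    have h' := h
    rw [List.pairwise_cons] at h
    by_cases hy : y < b
    · simp only [unbump, hy, if_true, List.pairwise_cons]
      refine ⟨fun z hz => ?_, pairwise_unbump hy h.2⟩
      rcases mem_unbump hz with rfl | hz
      exacts [hx.le, h.1 z hz]
    · simp only [unbump, hy, if_false]
      rw [List.pairwise_cons]
      refine ⟨fun z hz => ?_, h.2⟩
      rcases List.mem_cons.1 hz with rfl | hz
      · exact not_lt.1 hy
      · exact (not_lt.1 hy).trans ((List.pairwise_cons.1 h.2).1 z hz)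

/-- The entries before the replaced one are at most the ejected letter, so direct insertion skips
them and the first entry it bumps is `b`. -/
theorem rowInsert_unbump {b : A} : ∀ {r : List A} {x : A}, x < b → (x :: r).Pairwise (· ≤ ·) →
    rowInsert (unbump b x r).1 (unbump b x r).2 = (x :: r, some b)
  | [], x, hx, _ => by simp [unbump, rowInsert, hx]
  | y :: r, x, hx, h => by
    rw [List.pairwise_cons] at h
    by_cases hy : y < b
    · have h1 : ¬ (unbump b y r).1 < x :=
        not_lt.2 ((h.1 y (by simp)).trans (unbump_le b r y h.2))
      simp [unbump, hy, rowInsert, h1, rowInsert_unbump hy h.2]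
    · simp [unbump, hy, rowInsert, hx]

theorem below_unbump_of_forall_lt {b : A} : ∀ {r s : List A} {x : A}, Below (x :: r) s →
    (∀ z ∈ s, b < z) → Below (unbump b x r).2 s
  | r, [], x, _, _ => by simp [Below]
  | [], z :: s, x, h, hs => by
    simp only [Below, unbump] at h ⊢
    exact ⟨hs z (by simp), h.2⟩
  | y :: r, z :: s, x, h, hs => by
    simp only [Below] at h
    by_cases hy : y < b
    · simp only [unbump, hy, if_true, Below]
      exact ⟨h.1, below_unbump_of_forall_lt h.2 fun w hw => hs w (by simp [hw])⟩
    · simp only [unbump, hy, if_false, Below]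
      exact ⟨hs z (by simp), h.2⟩

/-- The row `(rowInsert b s).1` starts with `b` or with an entry at most `b`. This supplies the
inequality needed to reverse-insert `b` into the row above. -/
theorem lt_of_below_rowInsert {b x : A} {r s : List A} (h : Below (x :: r) (rowInsert b s).1) :
    x < b := by
  cases s with
  | nil => simpa [rowInsert, Below] using h
  | cons z s =>
    by_cases hz : b < z
    · simp only [rowInsert, hz, if_true, Below] at h; exact h.1
    · simp only [rowInsert, hz, if_false, Below] at h; exact h.1.trans_le (not_lt.1 hz)

/-- If `b` had bumped the head of `s`, then `b` is smaller than all of `s` and may replace any entry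
above it. Otherwise the two heads are untouched and the argument moves one column to the right. -/
theorem below_unbump {b : A} : ∀ {r s : List A} {x : A}, s.Pairwise (· ≤ ·) →
    Below (x :: r) (rowInsert b s).1 → Below (unbump b x r).2 s
  | r, [], x, _, _ => by simp [Below]
  | r, z :: s, x, hs, h => by
    have hx := lt_of_below_rowInsert h
    rw [List.pairwise_cons] at hs
    by_cases hz : b < z
    · refine below_unbump_of_forall_lt ?_ ?_
      · simp only [rowInsert, hz, if_true, Below] at h ⊢
        exact ⟨h.1.trans hz, h.2⟩
      · intro w hw
        rcases List.mem_cons.1 hw with rfl | hw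
        exacts [hz, hz.trans_le (hs.1 w hw)]
    · simp only [rowInsert, hz, if_false, Below] at h
      -- `r` cannot be empty, since the non-empty row `(rowInsert b s).1` sits below it.
      cases r with
      | nil =>
        have := rowInsert_ne_nil b s
        cases h' : (rowInsert b s).1 with
        | nil => exact absurd h' this
        | cons u v => rw [h'] at h; exact h.2.elim
      | cons y r =>
        have hy := lt_of_below_rowInsert h.2
        simp only [unbump, hy, if_true, Below]
        exact ⟨h.1, below_unbump hs.2 h.2⟩

theorem Below.dropLast_left {a : A} : ∀ {r s : List A}, Below (r ++ [a]) s →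
    s.length ≤ r.length → Below r s
  | _, [], _, _ => by simp [Below]
  | [], _ :: _, _, h => by simp at h
  | x :: r, y :: s, h, hl => by
    simp only [List.cons_append, Below] at h ⊢
    exact ⟨h.1, h.2.dropLast_left (by simpa using hl)⟩

theorem IsTableau.eq_nil_of_head {T : List (List A)} (h : IsTableau T) (h' : T.headD [] = []) :
    T = [] := by
  cases T with
  | nil => rfl
  | cons r T => exact absurd h' h.1

/-- The last box of row `i` is a corner, and insertion can be run backwards from it: in the top row
the last entry is removed; lower down, the letter ejected by the rows below is reverse-inserted into
the row above. -/
theorem exists_insertion_eq : ∀ {U : List (List A)} (i : ℕ), IsTableau U →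
    rowLength U (i + 1) < rowLength U i →
    ∃ (T : List (List A)) (a : A), IsTableau T ∧ insertion a T = U ∧ newRow a T = i
  | [], i, _, h => by simp at h
  | r :: U, 0, ⟨h1, h2, h3, h4⟩, h => by
    simp only [rowLength_cons_succ, rowLength_zero, List.headD_cons] at h
    obtain ⟨r0, a, rfl⟩ : ∃ r0 a, r = r0 ++ [a] :=
      ⟨_, _, (List.dropLast_append_getLast h1).symm⟩
    rw [List.pairwise_append] at h2
    rw [List.length_append, List.length_singleton] at h
    -- Rows of a tableau are non-empty, so a top row with a single box must disappear altogether; no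
    -- row can stand below it.
    by_cases hr : r0 = []
    · subst hr
      have : U = [] := h4.eq_nil_of_head (List.eq_nil_of_length_eq_zero (by simpa using h))
      subst this
      exact ⟨[], a, trivial, by simp [insertion], by simp [newRow]⟩
    · have hle := rowInsert_of_forall_le (a := a) (r := r0) fun x hx => h2.2.2 x hx a (by simp)
      refine ⟨r0 :: U, a, ⟨hr, h2.1, h3.dropLast_left (by omega), h4⟩, ?_, ?_⟩
      · simp [insertion, hle]
      · simp [newRow, hle]
  | r :: U, i + 1, ⟨h1, h2, h3, h4⟩, h => by
    simp only [rowLength_cons_succ] at h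
    obtain ⟨T, b, hT, hU, hi⟩ := exists_insertion_eq i h4 h
    rw [← hU, headD_insertion] at h3
    cases r with
    | nil => exact absurd rfl h1
    | cons x r =>
      have hx := lt_of_below_rowInsert h3
      have hs : (T.headD []).Pairwise (· ≤ ·) := by
        cases T with
        | nil => simp
        | cons s T => exact hT.2.1
      have hins := rowInsert_unbump hx h2
      refine ⟨(unbump b x r).2 :: T, (unbump b x r).1,
        ⟨?_, pairwise_unbump hx h2, below_unbump hs h3, hT⟩, ?_, ?_⟩
      · intro h0
        rw [h0] at hins
        simp [rowInsert] at hins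
      · simp [insertion, hins, hU]
      · simp [newRow, hins, hi]

/-- Scanning from the left, both insertions must bump in the same column: if only the first bumps
the head, its remaining row contains `a'` and has entries at least `b`, whereas `a' < b`. -/
theorem rowInsert_injective {b : A} : ∀ {r r' : List A} {a a' : A}, r.Pairwise (· ≤ ·) →
    r'.Pairwise (· ≤ ·) → (rowInsert a r).2 = some b → rowInsert a r = rowInsert a' r' →
    a = a' ∧ r = r'
  | [], _, _, _, _, _, h, _ => by simp [rowInsert] at h
  | x :: r, [], a, a', _, _, h, h' => by rw [h'] at h; simp [rowInsert] at h
  | x :: r, x' :: r', a, a', hr, hr', h, h' => by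
    have hb := lt_of_rowInsert a b _ h
    have hb' := lt_of_rowInsert a' b _ (h' ▸ h)
    by_cases hx : a < x <;> by_cases hx' : a' < x'
    · simp [rowInsert, hx, hx'] at h'
      simp [h']
    · simp only [rowInsert, hx, hx', if_true, if_false, Prod.mk.injEq, List.cons.injEq,
        Option.some.injEq] at h' h
      have : a' ∈ r := h'.1.2 ▸ self_mem_rowInsert a' r'
      have := (List.pairwise_cons.1 hr).1 _ this
      exact absurd hb' (not_lt.2 (h ▸ this))
    · simp only [rowInsert, hx, hx', if_true, if_false, Prod.mk.injEq, List.cons.injEq] at h' h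
      have : a ∈ r' := h'.1.2 ▸ self_mem_rowInsert a r
      have := (List.pairwise_cons.1 hr').1 _ this
      have e : x' = b := by rw [h] at h'; simpa using h'.2.symm
      exact absurd hb (not_lt.2 (e ▸ this))
    · simp only [rowInsert, hx, hx', if_false, Prod.mk.injEq, List.cons.injEq] at h' h
      obtain ⟨h1, h2⟩ := rowInsert_injective (List.pairwise_cons.1 hr).2
        (List.pairwise_cons.1 hr').2 h (Prod.ext h'.1.2 h'.2)
      exact ⟨h1, by rw [h'.1.1, h2]⟩

/-- Equal new rows make both bumping cascades stop at the same depth; the letters and rows are then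
recovered from the bottom up. -/
theorem insertion_injective : ∀ {T T' : List (List A)} {a a' : A}, IsTableau T → IsTableau T' →
    insertion a T = insertion a' T' → newRow a T = newRow a' T' → a = a' ∧ T = T'
  | [], [], a, a', _, _, h, _ => by simpa [insertion] using h
  | [], r' :: T', a, a', _, hT', h, hn => by
    cases hb : (rowInsert a' r').2 with
    | none =>
      simp only [insertion, hb, (rowInsert_eq_none hb).1] at h
      have := hT'.1
      cases r' <;> simp_all
    | some b => simp [newRow, hb] at hn
  | r :: T, [], a, a', hT, _, h, hn => by
    cases hb : (rowInsert a r).2 with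
    | none =>
      simp only [insertion, hb, (rowInsert_eq_none hb).1] at h
      have := hT.1
      cases r <;> simp_all
    | some b => simp [newRow, hb] at hn
  | r :: T, r' :: T', a, a', hT, hT', h, hn => by
    cases hb : (rowInsert a r).2 with
    | none =>
      cases hb' : (rowInsert a' r').2 with
      | none =>
        simp only [insertion, hb, hb', (rowInsert_eq_none hb).1, (rowInsert_eq_none hb').1,
          List.cons.injEq] at h
        have := List.append_inj' h.1 rfl
        simp_all
      | some b' => simp [newRow, hb, hb'] at hn
    | some b =>
      cases hb' : (rowInsert a' r').2 with
      | none => simp [newRow, hb, hb'] at hn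
      | some b' =>
        simp only [insertion, hb, hb', List.cons.injEq] at h
        simp only [newRow, hb, hb', add_left_inj] at hn
        obtain ⟨rfl, rfl⟩ := insertion_injective hT.2.2.2 hT'.2.2.2 h.2 hn
        obtain ⟨rfl, rfl⟩ := rowInsert_injective hT.2.1 hT'.2.1 hb
          (Prod.ext h.1 (hb.trans hb'.symm))
        simp

/-! Successive insertions. -/

/-- Row bumping lemma. The comparison between the two inserted letters is inherited by the letters
they bump, so it propagates down the rows until one of the cascades stops. -/
theorem newRow_insertion : ∀ {T : List (List A)} (a a' : A), IsTableau T →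
    (newRow a' (insertion a T) ≤ newRow a T ↔ a ≤ a')
  | [], a, a', _ => by
    by_cases h : a' < a
    · simp [insertion, newRow, rowInsert, h]
    · simp [insertion, newRow, rowInsert, h, not_lt.1 h]
  | r :: T, a, a', hT => by
    -- One row. For `a ≤ a'`, the second insertion bumps only if the first did, and then a letter at
    -- least as large; for `a' < a`, it always bumps, and a strictly smaller letter.
    have main : ∀ {r : List A}, r.Pairwise (· ≤ ·) →
        (a ≤ a' → ∀ b', (rowInsert a' (rowInsert a r).1).2 = some b' →
          ∃ b, (rowInsert a r).2 = some b ∧ b ≤ b') ∧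
        (a' < a → ∃ b', (rowInsert a' (rowInsert a r).1).2 = some b' ∧
          ∀ b, (rowInsert a r).2 = some b → b' < b) := by
      intro r
      induction r with
      | nil =>
        intro _
        refine ⟨fun h b' hb' => ?_, fun h => ?_⟩
        · simp [rowInsert, not_lt.2 h] at hb'
        · simp [rowInsert, h]
      | cons x r ih =>
        intro hr
        rw [List.pairwise_cons] at hr
        refine ⟨fun h b' hb' => ?_, fun h => ?_⟩
        · by_cases hx : a < x
          · simp only [rowInsert, hx, if_true, not_lt.2 h, if_false] at hb' ⊢
            refine ⟨x, rfl, ?_⟩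
            have := (rowInsert_perm a' r).subset (List.mem_append_left _ (by rw [hb']; simp : b' ∈ _))
            rcases List.mem_cons.1 this with rfl | h'
            · exact absurd hb' fun hb' => (lt_of_rowInsert _ _ _ hb').false
            · exact hr.1 _ h'
          · simp only [rowInsert, hx, if_false] at hb' ⊢
            rw [if_neg (not_lt.2 ((not_lt.1 hx).trans h))] at hb'
            exact (ih hr.2).1 h b' hb'
        · by_cases hx : a < x
          · simp [rowInsert, hx, h]
          · simp only [rowInsert, hx, if_false]
            by_cases hx' : a' < x
            · simp only [hx', if_true]
              refine ⟨x, rfl, fun b hb => (not_lt.1 hx).trans_lt (lt_of_rowInsert _ _ _ hb)⟩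
            · simp only [hx', if_false]
              exact (ih hr.2).2 h
    obtain ⟨m1, m2⟩ := main hT.2.1
    rcases le_or_gt a a' with h | h
    · simp only [h, iff_true]
      cases hb' : (rowInsert a' (rowInsert a r).1).2 with
      | none => cases hb : (rowInsert a r).2 <;> simp [insertion, newRow, hb, hb']
      | some b' =>
        obtain ⟨b, hb, hbb⟩ := m1 h b' hb'
        simp only [insertion, newRow, hb, hb', add_le_add_iff_right]
        exact (newRow_insertion b b' hT.2.2.2).2 hbb
    · simp only [not_le.2 h, iff_false]
      obtain ⟨b', hb', hbb⟩ := m2 h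
      cases hb : (rowInsert a r).2 with
      | none => simp [insertion, newRow, hb, hb']
      | some b =>
        simp only [insertion, newRow, hb, hb', add_le_add_iff_right]
        rw [newRow_insertion b b' hT.2.2.2]
        exact not_le.2 (hbb b hb)

/-- The tableau obtained from `T` by successive insertion of the letters of a word. -/
def insertList (T : List (List A)) (w : List A) : List (List A) :=
  w.foldl (fun T a => insertion a T) T

theorem IsTableau.insertList {T : List (List A)} (hT : IsTableau T) (w : List A) :
    IsTableau (insertList T w) := by
  induction w generalizing T with
  | nil => exact hT
  | cons a w ih => exact ih (hT.insertion a)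

theorem isTableau_tableauP (w : List A) : IsTableau (tableauP w) :=
  IsTableau.insertList (T := []) trivial w

theorem rowSeqFrom_append (T : List (List A)) (u v : List A) :
    rowSeqFrom T (u ++ v) = rowSeqFrom T u ++ rowSeqFrom (insertList T u) v := by
  induction u generalizing T with
  | nil => rfl
  | cons a u ih => simp [rowSeqFrom, ih, insertList]

theorem rowSeq_append_singleton (w : List A) (a : A) :
    rowSeq (w ++ [a]) = rowSeq w ++ [newRow a (tableauP w)] :=
  rowSeqFrom_append [] w [a]

theorem tableauP_append_singleton (w : List A) (a : A) :
    tableauP (w ++ [a]) = insertion a (tableauP w) := by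
  simp [tableauP]

@[simp] theorem length_rowSeqFrom (T : List (List A)) (w : List A) :
    (rowSeqFrom T w).length = w.length := by
  induction w generalizing T with
  | nil => rfl
  | cons a w ih => simp [rowSeqFrom, ih]

@[simp] theorem length_rowSeq (w : List A) : (rowSeq w).length = w.length :=
  length_rowSeqFrom [] w

theorem rowSeq_take (w : List A) (k : ℕ) : rowSeq (w.take k) = (rowSeq w).take k := by
  by_cases hk : k ≤ w.length
  · conv_rhs => rw [← List.take_append_drop k w, rowSeq, rowSeqFrom_append]
    rw [List.take_left' (by simpa using hk)]
    rfl
  · rw [List.take_of_length_le (by omega), List.take_of_length_le (by simp; omega)]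

theorem rowLength_insertList (T : List (List A)) (w : List A) (i : ℕ) :
    rowLength (insertList T w) i = rowLength T i + (rowSeqFrom T w).count i := by
  induction w generalizing T with
  | nil => simp [insertList, rowSeqFrom]
  | cons a w ih =>
    change rowLength (insertList (insertion a T) w) i = _
    rw [ih, rowLength_insertion, rowSeqFrom, List.count_cons]
    simp only [beq_iff_eq]
    omega

theorem rowLength_tableauP (w : List A) (i : ℕ) :
    rowLength (tableauP w) i = (rowSeq w).count i :=
  (rowLength_insertList [] w i).trans (zero_add _)

theorem isChain_rowSeqFrom {T : List (List A)} (hT : IsTableau T) (w : List A) :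
    (rowSeqFrom T w).IsChain (· ≥ ·) ↔ w.IsChain (· ≤ ·) := by
  induction w generalizing T with
  | nil => simp [rowSeqFrom]
  | cons a w ih =>
    cases w with
    | nil => simp [rowSeqFrom]
    | cons a' w =>
      have := ih (hT.insertion a)
      simp only [rowSeqFrom, List.isChain_cons_cons] at this ⊢
      rw [this, ge_iff_le, newRow_insertion a a' hT]

theorem antitone_rowLength_tableauP (w : List A) : Antitone (rowLength (tableauP w)) := by
  have h : ∀ {T : List (List A)}, IsTableau T → Antitone (rowLength T) := by
    intro T hT
    refine antitone_nat_of_succ_le fun i => ?_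
    induction T generalizing i with
    | nil => simp
    | cons r T ih =>
      cases i with
      | zero =>
        rw [rowLength_cons_succ, rowLength_zero, rowLength_cons_zero]
        exact hT.2.2.1.length_le
      | succ i => simpa using ih hT.2.2.2 i
  exact h (isTableau_tableauP w)

/-! ### The Robinson-Schensted bijection, with lattice words as recording objects. -/

/-- Lattice words: every prefix contains `i` at least as often as `i + 1`. -/
def IsLattice (p : List ℕ) : Prop := ∀ k, Antitone fun i => (p.take k).count i

theorem isLattice_rowSeq (w : List A) : IsLattice (rowSeq w) := by
  intro k
  simp only [← rowSeq_take, ← rowLength_tableauP]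
  exact antitone_rowLength_tableauP _

/-- The last letter of the lattice word designates a corner of `U`; undo the insertion there and
recurse. -/
theorem exists_word {U : List (List A)} (hU : IsTableau U) {p : List ℕ} (hp : IsLattice p)
    (h : ∀ i, rowLength U i = p.count i) : ∃ w, tableauP w = U ∧ rowSeq w = p := by
  induction p using List.reverseRecOn generalizing U with
  | nil =>
    refine ⟨[], ?_, rfl⟩
    have := h 0
    rw [rowLength_zero] at this
    exact (hU.eq_nil_of_head (List.eq_nil_of_length_eq_zero (by simpa using this))).symm
  | append_singleton p i ih =>
    have hp' : IsLattice p := by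
      intro k
      have := hp (min k p.length)
      rw [List.take_append_of_le_length (min_le_right _ _)] at this
      rwa [List.take_eq_take_min]
    -- Before its last letter the word already contains `i` at least as often as `i + 1`; the last
    -- letter makes the inequality strict.
    have hlt : rowLength U (i + 1) < rowLength U i := by
      have h2 := hp p.length i.le_succ
      simp only [List.take_left'] at h2
      rw [h, h]
      simp only [List.count_append, List.count_singleton]
      simpa using Nat.lt_succ_of_le h2
    obtain ⟨T, a, hT, rfl, rfl⟩ := exists_insertion_eq i hU hlt
    have hc : ∀ j, rowLength T j = p.count j := by
      intro j
      have := h j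
      rw [rowLength_insertion, List.count_append, List.count_singleton] at this
      simpa using this
    obtain ⟨w, rfl, rfl⟩ := ih hT hp' hc
    exact ⟨w ++ [a], tableauP_append_singleton w a, rowSeq_append_singleton w a⟩

/-- The recording sequence tells in which row each insertion has to be undone, and undoing it is
unambiguous. -/
theorem eq_of_tableauP_eq {w w' : List A} (h : tableauP w = tableauP w')
    (h' : rowSeq w = rowSeq w') : w = w' := by
  induction w using List.reverseRecOn generalizing w' with
  | nil =>
    have := congrArg List.length h'
    simp at this
    exact (List.eq_nil_of_length_eq_zero this.symm).symm
  | append_singleton w a ih =>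
    have hl := congrArg List.length h'
    rcases List.eq_nil_or_concat' w' with rfl | ⟨w', a', rfl⟩
    · simp at hl
    · rw [rowSeq_append_singleton, rowSeq_append_singleton] at h'
      have h1 := List.append_inj' h' rfl
      rw [tableauP_append_singleton, tableauP_append_singleton] at h
      obtain ⟨rfl, h2⟩ := insertion_injective (isTableau_tableauP w) (isTableau_tableauP w') h
        (by simpa using h1.2)
      rw [ih h2 h1.1]

theorem tableauP_flatten_perm (w : List A) : (tableauP w).flatten.Perm w := by
  induction w using List.reverseRecOn with
  | nil => simp [tableauP]
  | append_singleton w a ih =>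
    rw [tableauP_append_singleton]
    exact (insertion_flatten_perm _ a).trans ((ih.cons a).trans (List.perm_append_singleton a w).symm)

/-! Insertion commutes with increasing maps. -/

theorem rowInsert_map {B : Type*} [LinearOrder B] {f : A → B} (hf : StrictMono f) (a : A)
    (r : List A) : rowInsert (f a) (r.map f) =
      ((rowInsert a r).1.map f, (rowInsert a r).2.map f) := by
  induction r with
  | nil => simp [rowInsert]
  | cons x r ih => by_cases h : a < x <;> simp [rowInsert, hf.lt_iff_lt, h, ih]

theorem insertion_map {B : Type*} [LinearOrder B] {f : A → B} (hf : StrictMono f) (a : A)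
    (T : List (List A)) : insertion (f a) (T.map (List.map f)) =
      (insertion a T).map (List.map f) := by
  induction T generalizing a with
  | nil => simp [insertion]
  | cons r T ih =>
    cases h : (rowInsert a r).2 <;> simp [insertion, rowInsert_map hf, h, ih]

theorem newRow_map {B : Type*} [LinearOrder B] {f : A → B} (hf : StrictMono f) (a : A)
    (T : List (List A)) : newRow (f a) (T.map (List.map f)) = newRow a T := by
  induction T generalizing a with
  | nil => simp [newRow]
  | cons r T ih =>
    cases h : (rowInsert a r).2 <;> simp [newRow, rowInsert_map hf, h, ih]

theorem rowSeq_map {B : Type*} [LinearOrder B] {f : A → B} (hf : StrictMono f) (w : List A) :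
    rowSeq (w.map f) = rowSeq w := by
  have : ∀ (w : List A) (T : List (List A)),
      rowSeqFrom (T.map (List.map f)) (w.map f) = rowSeqFrom T w := by
    intro w
    induction w with
    | nil => intro T; rfl
    | cons a w ih => intro T; simp [rowSeqFrom, newRow_map hf, insertion_map hf, ih]
  exact this w []

/-! The shape of the insertion tableau. -/

theorem rowLen_insertionShape (w : List A) (i : ℕ) :
    (insertionShape w).rowLen i = (rowSeq w).count i := by
  rw [← rowLength_tableauP]
  refine eq_of_forall_lt_iff fun j => ?_
  rw [← YoungDiagram.mem_iff_lt_rowLen, insertionShape, YoungDiagram.mem_ofRowLens, rowLength]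
  by_cases h : i < ((tableauP w).map List.length).length
  · simp at h; simp [h]
  · simp at h; simp [h]

theorem youngDiagram_ext_rowLen {l m : YoungDiagram} (h : ∀ i, l.rowLen i = m.rowLen i) :
    l = m := by
  ext ⟨i, j⟩
  rw [YoungDiagram.mem_cells, YoungDiagram.mem_cells, YoungDiagram.mem_iff_lt_rowLen, YoungDiagram.mem_iff_lt_rowLen, h]

end

/-! The insertion tableau determines the relative order of consecutive values. -/

/-- Two words with the same letters, in which two values that are consecutive among these letters
appear in the same order. -/
def SameDescents {A : Type*} [LinearOrder A] (l l' : List A) : Prop :=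
  l.Perm l' ∧ ∀ x y, x < y → (∀ z ∈ l, ¬ (x < z ∧ z < y)) → ([x, y].Sublist l ↔ [x, y].Sublist l')

/-- The reading word of a tableau: its rows, from bottom to top. -/
def readingWord {A : Type*} : List (List A) → List A
  | [] => []
  | r :: T => readingWord T ++ r

section
variable {A : Type*}

theorem pair_sublist_append {x y : A} {u v : List A} : [x, y].Sublist (u ++ v) ↔
    [x, y].Sublist u ∨ (x ∈ u ∧ y ∈ v) ∨ [x, y].Sublist v := by
  constructor
  · intro h
    obtain ⟨a, b, hab, ha, hb⟩ := List.sublist_append_iff.1 h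
    rcases a with _ | ⟨a1, _ | ⟨a2, a⟩⟩
    · simp only [List.nil_append] at hab; subst hab; exact Or.inr (Or.inr hb)
    · simp only [List.cons_append, List.nil_append, List.cons.injEq] at hab
      obtain ⟨rfl, rfl⟩ := hab
      exact Or.inr (Or.inl ⟨by simpa using ha, by simpa using hb⟩)
    · simp only [List.cons_append, List.cons.injEq] at hab
      obtain ⟨rfl, rfl, h3⟩ := hab
      have := List.nil_eq_append_iff.1 h3
      rw [this.1] at ha
      exact Or.inl ha
  · rintro (h | ⟨h1, h2⟩ | h)
    · exact h.trans (List.sublist_append_left _ _)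
    · exact (List.singleton_sublist.2 h1).append (List.singleton_sublist.2 h2)
    · exact h.trans (List.sublist_append_right _ _)

variable [LinearOrder A]

theorem SameDescents.refl (l : List A) : SameDescents l l := ⟨.refl _, fun _ _ _ _ => Iff.rfl⟩

theorem SameDescents.symm {l l' : List A} (h : SameDescents l l') : SameDescents l' l :=
  ⟨h.1.symm, fun x y hxy hz => (h.2 x y hxy fun z hz' => hz z (h.1.subset hz')).symm⟩

theorem SameDescents.trans {l l' l'' : List A} (h : SameDescents l l')
    (h' : SameDescents l' l'') : SameDescents l l'' :=
  ⟨h.1.trans h'.1, fun x y hxy hz => (h.2 x y hxy hz).trans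
    (h'.2 x y hxy fun z hz' => hz z (h.1.symm.subset hz'))⟩

theorem SameDescents.append {l l' m m' : List A} (h : SameDescents l l')
    (h' : SameDescents m m') : SameDescents (l ++ m) (l' ++ m') := by
  refine ⟨h.1.append h'.1, fun x y hxy hz => ?_⟩
  rw [pair_sublist_append, pair_sublist_append,
    h.2 x y hxy fun z hz' => hz z (List.mem_append_left _ hz'),
    h'.2 x y hxy fun z hz' => hz z (List.mem_append_right _ hz'), h.1.mem_iff, h'.1.mem_iff]

/-- An elementary Knuth move: as `z` lies strictly between `p` and `q`, these two are not
consecutive among the letters, and no other pair changes order. -/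
theorem sameDescents_swap {u v : List A} {p q z : A} (hpq : p < q) (hz : z ∈ u ++ v)
    (h1 : p < z) (h2 : z < q) : SameDescents (u ++ p :: q :: v) (u ++ q :: p :: v) := by
  refine ⟨(List.Perm.swap q p v).append_left u, fun x y hxy hn => ?_⟩
  have hzm : z ∈ u ++ p :: q :: v := by simp at hz ⊢; tauto
  have key : ∀ a b : A, [x, y].Sublist [a, b] ↔ x = a ∧ y = b := by
    intro a b
    refine ⟨fun h => by simpa using h.eq_of_length rfl, ?_⟩
    rintro ⟨rfl, rfl⟩
    exact .refl _
  have e : ∀ a b : A, a :: b :: v = [a, b] ++ v := fun _ _ => rfl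
  rw [e, e]
  simp only [pair_sublist_append, key]
  have n1 : ¬ (x = p ∧ y = q) := by rintro ⟨rfl, rfl⟩; exact hn z hzm ⟨h1, h2⟩
  have n2 : ¬ (x = q ∧ y = p) := by rintro ⟨rfl, rfl⟩; exact hxy.not_gt hpq
  simp [n1, n2]
  tauto

/-- Bumping in one row is a chain of Knuth moves. In the reading word, the bumped letter comes out
on the left of the row, ready for insertion into the row below. -/
theorem sameDescents_rowInsert {a b : A} : ∀ {r : List A}, (r ++ [a]).Nodup →
    r.Pairwise (· ≤ ·) → (rowInsert a r).2 = some b →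
    SameDescents (r ++ [a]) (b :: (rowInsert a r).1)
  | [], _, _, h => by simp [rowInsert] at h
  | x :: r, hn, hr, h => by
    rw [List.pairwise_cons] at hr
    by_cases hx : a < x
    · simp only [rowInsert, hx, if_true, Option.some.injEq] at h ⊢
      subst h
      have hxr : x ∉ r := by simp at hn; tauto
      -- The letter `a` travels left across the row; the head `x` stays in front and its value
      -- separates `a` from every entry that is crossed.
      have : ∀ r' : List A, (∀ z ∈ r', x < z) →
          SameDescents (x :: (r' ++ [a])) (x :: a :: r') := by
        intro r'
        induction r' using List.reverseRecOn with
        | nil => intro _; exact .refl _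
        | append_singleton r' y ih =>
          intro hy
          have h1 := (ih fun z hz => hy z (by simp [hz])).append (.refl [y])
          refine SameDescents.trans ?_ (by simpa using h1)
          have := sameDescents_swap (u := x :: r') (v := []) (p := a) (q := y) (z := x)
            (hx.trans (hy y (by simp))) (by simp) hx (hy y (by simp))
          simpa using this.symm
      exact this r fun z hz => lt_of_le_of_ne (hr.1 z hz) (by rintro rfl; exact hxr hz)
    · simp only [rowInsert, hx, if_false] at h ⊢
      have hxa : x < a := lt_of_le_of_ne (not_lt.1 hx) (by rintro rfl; simp at hn)
      have ih := sameDescents_rowInsert (List.nodup_cons.1 hn).2 hr.2 h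
      have hab := lt_of_rowInsert a b r h
      refine ((SameDescents.refl [x]).append ih).trans ?_
      -- Now `b` passes over `x`; the intermediate value is `a`, which is in the row after the
      -- insertion.
      exact sameDescents_swap (u := []) (z := a) (hxa.trans hab)
        (by simpa using self_mem_rowInsert a r) hxa hab

theorem sameDescents_insertion {a : A} : ∀ {T : List (List A)}, IsTableau T →
    (readingWord T ++ [a]).Nodup → SameDescents (readingWord T ++ [a]) (readingWord (insertion a T))
  | [], _, _ => .refl _
  | r :: T, hT, hn => by
    have hn' : (r ++ [a]).Nodup := by
      rw [readingWord, List.append_assoc] at hn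
      exact hn.sublist (List.sublist_append_right _ _)
    cases hb : (rowInsert a r).2 with
    | none =>
      simp only [insertion, hb, readingWord, (rowInsert_eq_none hb).1, List.append_assoc]
      exact .refl _
    | some b =>
      have h1 := sameDescents_rowInsert hn' hT.2.1 hb
      simp only [insertion, hb, readingWord, List.append_assoc] at hn ⊢
      have h2 := (SameDescents.refl (readingWord T)).append h1
      have h3 : (readingWord T ++ [b]).Nodup := by
        have := h2.1.nodup hn
        rw [show readingWord T ++ b :: (rowInsert a r).1 =
          (readingWord T ++ [b]) ++ (rowInsert a r).1 by simp] at this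
        exact this.sublist (List.sublist_append_left _ _)
      refine h2.trans ?_
      have := (sameDescents_insertion hT.2.2.2 h3).append (.refl (rowInsert a r).1)
      simpa using this

theorem sameDescents_readingWord {w : List A} (hw : w.Nodup) :
    SameDescents w (readingWord (tableauP w)) := by
  induction w using List.reverseRecOn with
  | nil => exact .refl _
  | append_singleton w a ih =>
    have h1 := (ih (hw.sublist (List.sublist_append_left _ _))).append (.refl [a])
    rw [tableauP_append_singleton]
    exact h1.trans (sameDescents_insertion (isTableau_tableauP w) (h1.1.nodup hw))

theorem sameDescents_of_tableauP_eq {w w' : List A} (hw : w.Nodup)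
    (h : tableauP w = tableauP w') : SameDescents w w' := by
  have hp : w.Perm w' :=
    (tableauP_flatten_perm w).symm.trans (h ▸ tableauP_flatten_perm w')
  exact (sameDescents_readingWord hw).trans (h ▸ (sameDescents_readingWord (hp.nodup hw)).symm)

end

theorem pair_sublist_ofFn {A : Type*} {n : ℕ} {f : Fin n → A} (hf : Function.Injective f)
    (i j : Fin n) : [f i, f j].Sublist (List.ofFn f) ↔ i < j := by
  rw [List.sublist_iff_exists_fin_orderEmbedding_get_eq]
  constructor
  · rintro ⟨e, he⟩
    have h0 := he ⟨0, by simp⟩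
    have h1 := he ⟨1, by simp⟩
    have hlt : e ⟨0, by simp⟩ < e ⟨1, by simp⟩ := e.lt_iff_lt.2 (by simp)
    simp only [List.get_eq_getElem, List.getElem_cons_zero, List.getElem_cons_succ,
      List.getElem_ofFn] at h0 h1
    rw [Fin.lt_def, hf h0, hf h1]
    exact hlt
  · intro h
    have hl : (List.ofFn f).length = n := by simp
    refine ⟨OrderEmbedding.ofStrictMono (fun k => if (k : ℕ) = 0 then i.cast hl.symm
      else j.cast hl.symm) ?_, ?_⟩
    · intro a b hab
      have ha := a.2
      have hb := b.2
      simp only [List.length_cons, List.length_nil] at ha hb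
      have h1 : (a : ℕ) = 0 := by have := Fin.lt_def.1 hab; omega
      have h2 : (b : ℕ) ≠ 0 := by have := Fin.lt_def.1 hab; omega
      simpa [h1, h2] using h
    · intro k
      have hk := k.2
      simp only [List.length_cons, List.length_nil] at hk
      by_cases h0 : (k : ℕ) = 0
      · have : k = ⟨0, by simp⟩ := Fin.ext h0
        subst this; simp
      · have : k = ⟨1, by simp⟩ := Fin.ext (by simp; omega)
        subst this; simp

/-- If two permutations have the same insertion tableau, then their inverses have the same
descents. -/
theorem symm_lt_symm_iff_of_tableauP_eq {n : ℕ} {s t : Equiv.Perm (Fin n)}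
    (h : tableauP (List.ofFn s) = tableauP (List.ofFn t)) {x y : Fin n} (hxy : (y : ℕ) = x + 1) :
    s.symm x < s.symm y ↔ t.symm x < t.symm y := by
  have hd := sameDescents_of_tableauP_eq (List.nodup_ofFn.2 s.injective) h
  have := hd.2 x y (Fin.lt_def.2 (by omega)) fun z _ hz => by
    have h1 := Fin.lt_def.1 hz.1
    have h2 := Fin.lt_def.1 hz.2
    omega
  rw [← pair_sublist_ofFn s.injective, ← pair_sublist_ofFn t.injective]
  simpa using this

/-- Recording sequences with the same content are in bijection, by a bijection preserving the
insertion tableau. -/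
theorem exists_perm_rowSeq {n : ℕ} (s : Equiv.Perm (Fin n)) {p : List ℕ} (hp : IsLattice p)
    (h : p.Perm (rowSeq (List.ofFn s))) : ∃ t : Equiv.Perm (Fin n),
      tableauP (List.ofFn t) = tableauP (List.ofFn s) ∧ rowSeq (List.ofFn t) = p := by
  -- Keep the insertion tableau of `s` and prescribe the recording sequence `p`. The resulting word
  -- has the letters of `s`, so it is again a permutation.
  obtain ⟨w, hw, hw'⟩ := exists_word (isTableau_tableauP (List.ofFn s)) hp fun i => by
    rw [rowLength_tableauP, h.count_eq]
  have hperm : w.Perm (List.ofFn s) :=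
    (tableauP_flatten_perm w).symm.trans (hw ▸ tableauP_flatten_perm _)
  have hl : w.length = n := by simpa using hperm.length_eq
  set f : Fin n → Fin n := fun i => w.get (i.cast hl.symm) with hf
  have hfw : List.ofFn f = w := by
    refine List.ext_getElem (by simp [hl]) fun i h1 h2 => ?_
    simp [hf]
  have hinj : Function.Injective f :=
    List.nodup_ofFn.1 (hfw ▸ hperm.symm.nodup (List.nodup_ofFn.2 s.injective))
  refine ⟨Equiv.ofBijective f (Finite.injective_iff_bijective.1 hinj), ?_, ?_⟩ <;>
    simpa [hfw]

/-! Horizontal strips and lattice words. -/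

/-- The sequence of row lengths `m` is obtained from `l` by adding a horizontal strip. -/
def HorizontalStrip (l m : ℕ → ℕ) : Prop := ∀ j, l j ≤ m j ∧ m (j + 1) ≤ l j

/-- The condition is the worst case, in which all letters `j + 1` of `q` come before any of its
letters `j`; it therefore suffices for every ordering of `q`. -/
theorem IsLattice.append {p q : List ℕ} (hp : IsLattice p)
    (h : ∀ j, p.count (j + 1) + q.count (j + 1) ≤ p.count j) : IsLattice (p ++ q) := by
  intro k
  refine antitone_nat_of_succ_le fun j => ?_
  rw [List.take_append, List.count_append, List.count_append]
  rcases le_total k p.length with hk | hk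
  · rw [Nat.sub_eq_zero_of_le hk]
    simpa using hp k j.le_succ
  · rw [List.take_of_length_le hk]
    have := ((q.take_sublist (k - p.length)).count_le (j + 1))
    have := h j
    omega

theorem isChain_ge_iff {q : List ℕ} : q.IsChain (· ≥ ·) ↔ q.Pairwise (· ≥ ·) :=
  List.isChain_iff_pairwise

/-- For a weakly decreasing `q` the worst case occurs: larger letters come first. With
`IsLattice.append`, this identifies weakly decreasing continuations with horizontal strips. -/
theorem IsLattice.count_le {p q : List ℕ} (h : IsLattice (p ++ q)) (hq : q.Pairwise (· ≥ ·))
    (j : ℕ) : p.count (j + 1) + q.count (j + 1) ≤ p.count j := by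
  obtain ⟨a, b, hab, ha, hb⟩ : ∃ a b, q = a ++ b ∧ (∀ x ∈ a, j + 1 ≤ x) ∧ ∀ x ∈ b, x ≤ j := by
    clear h
    induction q with
    | nil => exact ⟨[], [], rfl, by simp, by simp⟩
    | cons x q ih =>
      rw [List.pairwise_cons] at hq
      by_cases hx : x ≤ j
      · refine ⟨[], x :: q, rfl, by simp, fun y hy => ?_⟩
        rcases List.mem_cons.1 hy with rfl | hy
        exacts [hx, (hq.1 y hy).trans hx]
      · obtain ⟨a, b, rfl, ha, hb⟩ := ih hq.2
        refine ⟨x :: a, b, rfl, fun y hy => ?_, hb⟩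
        rcases List.mem_cons.1 hy with rfl | hy
        exacts [by omega, ha y hy]
  -- The prefix `p ++ a` contains all letters `j + 1` of `q` and none of its letters `j`.
  have h1 := h (p ++ a).length j.le_succ
  rw [hab, ← List.append_assoc, List.take_left'  rfl] at h1
  simp only [List.count_append] at h1
  have h2 : a.count j = 0 := List.count_eq_zero.2 fun hj => by have := ha j hj; omega
  have h3 : b.count (j + 1) = 0 := List.count_eq_zero.2 fun hj => by have := hb _ hj; omega
  rw [hab, List.count_append]
  simp only [Nat.succ_eq_add_one] at h1
  omega

/-- Fill the rows one after the other, from the top. -/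
theorem exists_isLattice {l : ℕ → ℕ} (hl : Antitone l) (N : ℕ) :
    ∃ p : List ℕ, IsLattice p ∧ ∀ i, p.count i = if i < N then l i else 0 := by
  induction N with
  | zero => exact ⟨[], fun _ => by simpa using antitone_const, by simp⟩
  | succ N ih =>
    obtain ⟨p, hp, hc⟩ := ih
    refine ⟨p ++ List.replicate (l N) N, hp.append fun j => ?_, fun i => ?_⟩
    · have := hl j.le_succ
      simp only [Nat.succ_eq_add_one] at this
      rw [hc, hc, List.count_replicate]
      by_cases h1 : N = j + 1
      · subst h1; simpa
      · simp only [beq_iff_eq, h1, if_false]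
        split_ifs <;> omega
    · rw [List.count_append, hc, List.count_replicate]
      by_cases h1 : N = i
      · subst h1; simp
      · simp only [beq_iff_eq, h1, if_false]
        split_ifs <;> omega

/-- The weakly decreasing list with `m i` entries equal to `i`, for `i < N`. -/
def descList (m : ℕ → ℕ) : ℕ → List ℕ
  | 0 => []
  | N + 1 => List.replicate (m N) N ++ descList m N

theorem count_descList (m : ℕ → ℕ) (N i : ℕ) :
    (descList m N).count i = if i < N then m i else 0 := by
  induction N with
  | zero => simp [descList]
  | succ N ih =>
    rw [descList, List.count_append, ih, List.count_replicate]
    by_cases h1 : N = i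
    · subst h1; simp
    · simp only [beq_iff_eq, h1, if_false]
      split_ifs <;> omega

theorem pairwise_descList (m : ℕ → ℕ) (N : ℕ) : (descList m N).Pairwise (· ≥ ·) := by
  induction N with
  | zero => simp [descList]
  | succ N ih =>
    rw [descList, List.pairwise_append]
    refine ⟨List.pairwise_replicate.2 (Or.inr le_rfl), ih, fun x hx y hy => ?_⟩
    have h1 := List.count_pos_iff.2 hy
    rw [count_descList] at h1
    have h2 := List.eq_of_mem_replicate hx
    split_ifs at h1 <;> omega

theorem length_eq_sum_count {q : List ℕ} {N : ℕ} (h : ∀ i, N ≤ i → q.count i = 0) :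
    q.length = ∑ i ∈ range N, q.count i := by
  rw [← Multiset.coe_card, ← Multiset.sum_count_eq_card (s := range N)]
  · simp
  · intro a ha
    by_contra h'
    have := h a (by simpa using h')
    exact absurd (List.count_pos_iff.2 (Multiset.mem_coe.1 ha)) (by omega)

/-! A Pieri rule implies a Jacobi-Trudi formula. -/

/-- The sequence `l 0, …, l (i - 1), l (i + 1) - 1, l (i + 2) - 1, …`. -/
def eraseRow (l : ℕ → ℕ) (i j : ℕ) : ℕ := if j < i then l j else l (j + 1) - 1

theorem eraseRow_antitone {l : ℕ → ℕ} (hl : Antitone l) (i : ℕ) : Antitone (eraseRow l i) := by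
  refine antitone_nat_of_succ_le fun j => ?_
  have h1 := hl j.le_succ
  have h2 := hl (j + 1).le_succ
  simp only [Nat.succ_eq_add_one] at h1 h2
  simp only [eraseRow]
  split_ifs <;> omega

/-- Expanding the Jacobi-Trudi determinant along its last column pairs h of index `l i + M - i` with
the minor of shape `eraseRow l i`; the total degree is that of `l`. Positivity of the parts makes
the truncated subtraction in `eraseRow` exact. -/
theorem sum_eraseRow {l : ℕ → ℕ} {M : ℕ} (hpos : ∀ j ≤ M, 0 < l j) (i : Fin (M + 1)) :
    ∑ j ∈ range M, eraseRow l i j + (l i + M - i) = ∑ j ∈ range (M + 1), l j := by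
  have h1 : ∑ j : Fin M, (l (i.succAbove j) : ℕ) =
      ∑ j : Fin M, (eraseRow l i j + if (i : ℕ) ≤ j then 1 else 0) := by
    refine Finset.sum_congr rfl fun j _ => ?_
    have := hpos (j + 1) (by omega)
    by_cases h : (j : ℕ) < i
    · rw [Fin.succAbove_of_castSucc_lt _ _ (by simpa [Fin.lt_def] using h)]
      simp [eraseRow, h]
    · rw [Fin.succAbove_of_le_castSucc _ _ (by simpa [Fin.le_def] using not_lt.1 h)]
      simp [eraseRow, h, not_lt.1 h]
      omega
  have h2 : ∑ j : Fin M, (if (i : ℕ) ≤ j then 1 else 0) = M - i := by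
    rw [Fin.sum_univ_eq_sum_range (fun j => if (i : ℕ) ≤ j then 1 else 0), ← Finset.sum_filter,
      Finset.sum_const, smul_eq_mul, mul_one,
      show (range M).filter (fun j => (i : ℕ) ≤ j) = Ico (i : ℕ) M by ext; simp; omega, Nat.card_Ico]
  rw [← Fin.sum_univ_eq_sum_range l, Fin.sum_univ_succAbove _ i, h1, Finset.sum_add_distrib, h2,
    Fin.sum_univ_eq_sum_range (eraseRow l i)]
  omega

theorem sum_neg_one_pow_mul_add {R : Type*} [CommRing R] (e : ℕ → R) (M : ℕ) :
    ∑ i ∈ range (M + 1), (-1) ^ (i + M) * (e i + e (i + 1)) = e (M + 1) + (-1) ^ M * e 0 := by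
  induction M with
  | zero => simp [add_comm]
  | succ M ih =>
    rw [Finset.sum_range_succ]
    have : ∀ i ∈ range (M + 1), (-1 : R) ^ (i + (M + 1)) * (e i + e (i + 1)) =
        -((-1) ^ (i + M) * (e i + e (i + 1))) := fun i _ => by rw [← add_assoc, pow_succ]; ring
    rw [Finset.sum_congr rfl this, Finset.sum_neg_distrib, ih, ← two_mul, pow_mul]
    simp
    ring

-- The strips over `eraseRow l i` split in two classes according to whether `m i < l i`; one class
-- is shared with index `i - 1`, the other with index `i + 1`. The alternating sum telescopes.
open Classical in
theorem sum_horizontalStrip_eraseRow {R : Type*} [CommRing R] {l m : ℕ → ℕ} {M : ℕ}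
    (hl : Antitone l) (hpos : ∀ j ≤ M, 0 < l j) (hl0 : ∀ j, M + 1 ≤ j → l j = 0)
    (hm0 : ∀ j, M + 1 ≤ j → m j = 0)
    (hsum : ∑ j ∈ range (M + 1), m j = ∑ j ∈ range (M + 1), l j) :
    ∑ i ∈ range (M + 1), (-1 : R) ^ (i + M) * (if HorizontalStrip (eraseRow l i) m then 1 else 0) =
      if m = l then 1 else 0 := by
  -- `E d`: `m` dominates `l` before `d` and is strictly below it from `d` on, together with the
  -- interlacing conditions left over. The strips for index `i` are the disjoint union of `E i` and
  -- `E (i + 1)`.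
  let E : ℕ → Prop := fun d => (∀ j < d, l j ≤ m j) ∧ (∀ j, d ≤ j → j ≤ M → m j < l j) ∧
    (∀ j, j + 1 < d → m (j + 1) ≤ l j) ∧ (∀ j, d ≤ j → j + 1 ≤ M → l (j + 1) - 1 ≤ m j)
  have hE : ∀ i ∈ range (M + 1), (-1 : R) ^ (i + M) *
      (if HorizontalStrip (eraseRow l i) m then 1 else 0) =
      (-1 : R) ^ (i + M) * ((if E i then 1 else 0) + (if E (i + 1) then 1 else 0)) := by
    intro i hi
    rw [Finset.mem_range] at hi
    congr 1
    have hC : HorizontalStrip (eraseRow l i) m ↔ (∀ j < i, l j ≤ m j) ∧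
        (∀ j, i ≤ j → j + 1 ≤ M → l (j + 1) - 1 ≤ m j) ∧ (∀ j < i, m (j + 1) ≤ l j) ∧
        (∀ j, i < j → j ≤ M → m j < l j) := by
      constructor
      · intro h
        refine ⟨fun j hj => ?_, fun j hj hj' => ?_, fun j hj => ?_, fun j hj hj' => ?_⟩
        · have := (h j).1; simpa [eraseRow, hj] using this
        · have := (h j).1; simpa [eraseRow, not_lt.2 hj] using this
        · have := (h j).2; simpa [eraseRow, hj] using this
        · obtain ⟨j, rfl⟩ := Nat.exists_eq_add_of_lt hj
          have := (h (i + j)).2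
          have := hpos _ hj'
          simp [eraseRow] at *
          omega
      · rintro ⟨h1, h2, h3, h4⟩ j
        by_cases hj : j < i
        · simpa [eraseRow, hj] using ⟨h1 j hj, h3 j hj⟩
        · simp only [eraseRow, hj, if_false]
          by_cases hj' : j + 1 ≤ M
          · have := h2 j (by omega) hj'
            have := h4 (j + 1) (by omega) hj'
            omega
          · have := hl0 (j + 1) (by omega)
            have := hm0 (j + 1) (by omega)
            omega
    have h1 : E i ↔ HorizontalStrip (eraseRow l i) m ∧ m i < l i := by
      rw [hC]
      constructor
      · rintro ⟨h1, h2, h3, h4⟩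
        refine ⟨⟨h1, h4, fun j hj => ?_, fun j hj hj' => h2 j hj.le hj'⟩, h2 i le_rfl (by omega)⟩
        by_cases hj' : j + 1 < i
        · exact h3 j hj'
        · have e : i = j + 1 := by omega
          subst e
          exact (h2 _ le_rfl (by omega)).le.trans (hl j.le_succ)
      · rintro ⟨⟨h1, h2, h3, h4⟩, h5⟩
        refine ⟨h1, fun j hj hj' => ?_, fun j hj => h3 j (by omega), h2⟩
        rcases hj.eq_or_lt with rfl | hj
        exacts [h5, h4 j hj hj']
    have h2 : E (i + 1) ↔ HorizontalStrip (eraseRow l i) m ∧ ¬ m i < l i := by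
      rw [hC]
      constructor
      · rintro ⟨h1, h2, h3, h4⟩
        refine ⟨⟨fun j hj => h1 j (by omega), fun j hj hj' => ?_, fun j hj => h3 j (by omega),
          fun j hj hj' => h2 j (by omega) hj'⟩, not_lt.2 (h1 i (by omega))⟩
        rcases hj.eq_or_lt with rfl | hj
        · have := h1 i (by omega)
          have := hl i.le_succ
          simp only [Nat.succ_eq_add_one] at this
          omega
        · exact h4 j hj hj'
      · rintro ⟨⟨h1, h2, h3, h4⟩, h5⟩
        refine ⟨fun j hj => ?_, fun j hj hj' => h4 j (by omega) hj', fun j hj => h3 j (by omega),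
          fun j hj hj' => h2 j (by omega) hj'⟩
        rcases (Nat.lt_succ_iff.1 hj).eq_or_lt with rfl | hj
        exacts [not_lt.1 h5, h1 j hj]
    by_cases c1 : HorizontalStrip (eraseRow l i) m <;> by_cases c2 : m i < l i <;> simp [h1, h2, c1, c2]
  rw [Finset.sum_congr rfl hE, sum_neg_one_pow_mul_add fun d => (if E d then (1 : R) else 0)]
  -- `E 0` would make every part of `m` smaller than that of `l`, contradicting equality of the
  -- sums; likewise `E (M + 1)` leaves room only for `m = l`.
  have h0 : ¬ E 0 := by
    rintro ⟨-, h, -, -⟩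
    have : ∑ j ∈ range (M + 1), m j < ∑ j ∈ range (M + 1), l j :=
      Finset.sum_lt_sum_of_nonempty (by simp) fun j hj =>
        h j (by omega) (by rw [Finset.mem_range] at hj; omega)
    omega
  have h1 : E (M + 1) ↔ m = l := by
    constructor
    · rintro ⟨h, -, -, -⟩
      have := (Finset.sum_eq_sum_iff_of_le fun j hj => h j (Finset.mem_range.1 hj)).1 hsum.symm
      funext j
      by_cases hj : j < M + 1
      · exact (this j (Finset.mem_range.2 hj)).symm
      · rw [hm0 j (by omega), hl0 j (by omega)]
    · rintro rfl
      exact ⟨fun _ _ => le_rfl, fun j h1 h2 => by omega, fun j _ => hl j.le_succ,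
        fun j h1 h2 => by omega⟩
  simp [h0, h1]

-- Induction on the number of rows. An empty last row contributes only a corner entry 1. Otherwise
-- expand along the last column: the minors are given by induction, Pieri turns each product into a
-- sum over strips, and all terms but `g l` cancel.
open Classical in
theorem det_eq_of_pieri {R : Type*} [CommRing R] (g : (ℕ → ℕ) → R) (h : ℕ → R) (g0 : g 0 = 1)
    (h0 : h 0 = 1)
    (pieri : ∀ (N : ℕ) (l : ℕ → ℕ), Antitone l → (∀ i, N ≤ i → l i = 0) → ∀ r, g l * h r =
      ∑ m ∈ (range (N + 1)).piAntidiag (∑ i ∈ range N, l i + r),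
        if HorizontalStrip l m then g m else 0) :
    ∀ (N : ℕ) (l : ℕ → ℕ), Antitone l → (∀ i, N ≤ i → l i = 0) →
      (Matrix.of fun i j : Fin N =>
        if (i : ℕ) ≤ l i + j then h (l i + j - i) else 0).det = g l := by
  intro N
  induction N with
  | zero =>
    intro l _ hl0
    have : l = 0 := funext fun i => hl0 i (Nat.zero_le _)
    simp [this, g0]
  | succ M ih =>
    intro l hl hl0
    by_cases hM : l M = 0
    · rw [← ih l hl fun i hi => by
        rcases hi.eq_or_lt with rfl | hi
        exacts [hM, hl0 i hi]]
      rw [Matrix.det_succ_row _ (Fin.last _), Finset.sum_eq_single (Fin.last _)]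
      · have : ((-1 : R) ^ (M + M)) = 1 := by rw [← two_mul, pow_mul]; simp
        simp only [Fin.val_last, this, Matrix.of_apply, hM, zero_add, le_refl, if_true,
          Nat.sub_self, h0, one_mul]
        congr 1
        ext i j
        simp
      · intro j _ hj
        have : (j : ℕ) < M := Fin.val_lt_last hj
        simp [hM, this]
      · simp
    · have hpos : ∀ j ≤ M, 0 < l j := fun j hj => (Nat.pos_of_ne_zero hM).trans_le (hl hj)
      rw [Matrix.det_succ_column _ (Fin.last _)]
      have hterm : ∀ i : Fin (M + 1), (-1 : R) ^ ((i : ℕ) + (Fin.last M : ℕ)) *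
          (Matrix.of fun i j : Fin (M + 1) => if (i : ℕ) ≤ l i + j then h (l i + j - i) else 0) i
            (Fin.last M) * ((Matrix.of fun i j : Fin (M + 1) =>
              if (i : ℕ) ≤ l i + j then h (l i + j - i) else 0).submatrix i.succAbove
                (Fin.last M).succAbove).det =
          ∑ m ∈ (range (M + 1)).piAntidiag (∑ j ∈ range (M + 1), l j),
            (-1 : R) ^ ((i : ℕ) + M) *
              (if HorizontalStrip (eraseRow l i) m then 1 else 0) * g m := by
        intro i
        have hs : (Matrix.of fun i j : Fin (M + 1) =>
              if (i : ℕ) ≤ l i + j then h (l i + j - i) else 0).submatrix i.succAbove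
                (Fin.last M).succAbove = Matrix.of fun a b : Fin M =>
              if (a : ℕ) ≤ eraseRow l i a + b then h (eraseRow l i a + b - a) else 0 := by
          ext a b
          simp only [Matrix.submatrix_apply, Matrix.of_apply, Fin.succAbove_last, Fin.val_castSucc]
          by_cases ha : (a : ℕ) < i
          · rw [Fin.succAbove_of_castSucc_lt _ _ (by simpa [Fin.lt_def] using ha)]
            simp [eraseRow, ha]
          · rw [Fin.succAbove_of_le_castSucc _ _ (by simpa [Fin.le_def] using not_lt.1 ha)]
            have := hpos (a + 1) (by omega)
            simp only [Fin.val_succ, eraseRow, ha, if_false]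
            by_cases hab : (a : ℕ) + 1 ≤ l (a + 1) + b
            · rw [if_pos hab, if_pos (by omega)]
              congr 1
              omega
            · rw [if_neg hab, if_neg (by omega)]
        rw [hs, ih _ (eraseRow_antitone hl i) fun j hj => ?_]
        · simp only [Matrix.of_apply, Fin.val_last]
          rw [if_pos (by omega), mul_assoc, mul_comm (h _), pieri M _ (eraseRow_antitone hl i)
            (fun j hj => by simp [eraseRow, hl0 (j + 1) (by omega)]; omega), sum_eraseRow hpos,
            Finset.mul_sum]
          refine Finset.sum_congr rfl fun m _ => ?_
          split_ifs <;> simp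
        · simp [eraseRow, hl0 (j + 1) (by omega)]; omega
      rw [Finset.sum_congr rfl fun i _ => hterm i, Finset.sum_comm]
      have hinner : ∀ m ∈ (range (M + 1)).piAntidiag (∑ j ∈ range (M + 1), l j),
          ∑ i : Fin (M + 1), (-1 : R) ^ ((i : ℕ) + M) *
              (if HorizontalStrip (eraseRow l i) m then 1 else 0) * g m =
            (if m = l then 1 else 0) * g m := by
        intro m hm
        rw [Finset.mem_piAntidiag] at hm
        rw [← Finset.sum_mul, Fin.sum_univ_eq_sum_range (fun i => (-1 : R) ^ (i + M) *
          (if HorizontalStrip (eraseRow l i) m then 1 else 0)),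
          sum_horizontalStrip_eraseRow hl hpos hl0 (fun j hj => ?_) hm.1]
        by_contra h
        have := hm.2 j h
        rw [Finset.mem_range] at this
        omega
      rw [Finset.sum_congr rfl hinner]
      simp only [ite_mul, one_mul, zero_mul]
      rw [Finset.sum_ite_eq' _ l, if_pos]
      rw [Finset.mem_piAntidiag]
      exact ⟨rfl, fun i hi => by
        by_contra h
        exact hi (hl0 i (by simpa using h))⟩

/-! Standardization of a sequence of random letters. A letter is the label of a block together
with a real number, which is used to order the letters of the last block. -/

instance : MeasurableSpace Block := ⊤

instance : DiscreteMeasurableSpace Block := ⟨fun _ => trivial⟩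

instance : Countable Block := Block.equivSum.symm.injective.countable

/-- The uniform law on `[0, 1]`. -/
noncomputable def uniformLaw : Measure ℝ := volume.restrict (Set.Icc 0 1)

instance : IsProbabilityMeasure uniformLaw := ⟨by simp [uniformLaw]⟩

instance : NullSingletonClass uniformLaw := by unfold uniformLaw; infer_instance

/-- The law of a random letter. -/
noncomputable def letterLaw (ω : ThomaSimplex) : Measure (Block × ℝ) :=
  ω.blockLaw.toMeasure.prod uniformLaw

instance (ω : ThomaSimplex) : IsProbabilityMeasure (letterLaw ω) := by
  unfold letterLaw; infer_instance

/-- The law of `n` independent random letters. -/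
noncomputable def lettersLaw (ω : ThomaSimplex) (n : ℕ) : Measure (Fin n → Block × ℝ) :=
  Measure.pi fun _ => letterLaw ω

instance (ω : ThomaSimplex) (n : ℕ) : IsProbabilityMeasure (lettersLaw ω n) := by
  unfold lettersLaw; infer_instance

/-- The letter `a` in some position receives a smaller value than the letter `b` in a later
position. -/
def Precedes (a b : Block × ℝ) : Prop :=
  a.1 < b.1 ∨ a.1 = b.1 ∧
    match a.1 with
    | .up _ => True
    | .down _ => False
    | .last => a.2 ≤ b.2

theorem measurableSet_precedes : MeasurableSet {p : (Block × ℝ) × (Block × ℝ) |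
    Precedes p.1 p.2} := by
  have e : {p : (Block × ℝ) × (Block × ℝ) | Precedes p.1 p.2} =
      (fun p : (Block × ℝ) × (Block × ℝ) => (p.1.1, p.2.1)) ⁻¹'
        {q | q.1 < q.2 ∨ q.1 = q.2 ∧ ∃ i, q.1 = .up i} ∪
      (fun p : (Block × ℝ) × (Block × ℝ) => (p.1.1, p.2.1)) ⁻¹' {q | q.1 = q.2 ∧ q.1 = .last} ∩
        {p | p.1.2 ≤ p.2.2} := by
    ext ⟨⟨a, u⟩, ⟨b, v⟩⟩
    cases a <;> simp [Precedes]
  rw [e]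
  have hm : Measurable fun p : (Block × ℝ) × (Block × ℝ) => (p.1.1, p.2.1) := by fun_prop
  refine (hm (MeasurableSet.of_discrete)).union ((hm (MeasurableSet.of_discrete)).inter ?_)
  exact measurableSet_le (by fun_prop) (by fun_prop)

/-- The sorting key of the letter `a` in position `i`. -/
noncomputable def letterKey (i : ℕ) (a : Block × ℝ) : Block ×ₗ (ℝ ×ₗ ℝ) :=
  toLex (a.1, toLex ((match a.1 with
    | .up _ => 0
    | .down _ => -(i : ℝ)
    | .last => a.2), (i : ℝ)))

/-- The middle component is constant, decreasing in the position, or the random real, according to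
the kind of block; the final component breaks ties in favour of the earlier position. Hence the
non-strict inequality in `Precedes` for the last block. -/
theorem letterKey_lt_iff {i j : ℕ} (hij : i < j) (a b : Block × ℝ) :
    letterKey i a < letterKey j b ↔ Precedes a b := by
  have h : (i : ℝ) < j := by exact_mod_cast hij
  rcases a with ⟨a, u⟩
  rcases b with ⟨b, v⟩
  simp only [letterKey, Prod.Lex.toLex_lt_toLex, Precedes]
  refine or_congr_right (and_congr_right ?_)
  rintro rfl
  cases a <;> simp [h, h.not_gt, h.ne, le_iff_lt_or_eq]

theorem letterKey_ne {i j : ℕ} (hij : i ≠ j) (a b : Block × ℝ) :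
    letterKey i a ≠ letterKey j b := by
  intro h
  simp only [letterKey, EmbeddingLike.apply_eq_iff_eq, Prod.mk.injEq, Nat.cast_inj] at h
  exact hij h.2.2

theorem letterKey_gt_iff {i j : ℕ} (hij : i < j) (a b : Block × ℝ) :
    letterKey j b < letterKey i a ↔ ¬ Precedes a b := by
  rw [← letterKey_lt_iff hij, not_lt, le_iff_lt_or_eq]
  simp [letterKey_ne hij.ne']

theorem injective_letterKey {n : ℕ} (x : Fin n → Block × ℝ) :
    Function.Injective fun i : Fin n => letterKey i (x i) := by
  intro i j h
  by_contra hne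
  exact letterKey_ne (fun h => hne (Fin.ext h)) _ _ h

/-- The standardization of a sequence of letters. -/
noncomputable def std {n : ℕ} (x : Fin n → Block × ℝ) : Equiv.Perm (Fin n) :=
  (Tuple.sort fun i : Fin n => letterKey i (x i))⁻¹

theorem std_lt_std_iff' {n : ℕ} (x : Fin n → Block × ℝ) (i j : Fin n) :
    std x i < std x j ↔ letterKey i (x i) < letterKey j (x j) := by
  set f := fun i : Fin n => letterKey i (x i) with hf
  have hs : StrictMono (f ∘ Tuple.sort f) :=
    (Tuple.monotone_sort f).strictMono_of_injective
      ((injective_letterKey x).comp (Tuple.sort f).injective)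
  have := hs.lt_iff_lt (a := std x i) (b := std x j)
  simpa [std, hf] using this.symm

theorem std_lt_std_iff {n : ℕ} (x : Fin n → Block × ℝ) {i j : Fin n} (hij : i < j) :
    std x i < std x j ↔ Precedes (x i) (x j) := by
  rw [std_lt_std_iff', letterKey_lt_iff hij]

theorem perm_ext_of_lt_iff {n : ℕ} {s t : Equiv.Perm (Fin n)}
    (h : ∀ i j, i < j → (s i < s j ↔ t i < t j)) : s = t := by
  have h' : ∀ i j, s i < s j ↔ t i < t j := by
    intro i j
    rcases lt_trichotomy i j with hij | rfl | hij
    · exact h i j hij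
    · simp
    · rw [← not_le, ← not_le, le_iff_lt_or_eq, le_iff_lt_or_eq, h j i hij]
      simp
  have hm : Monotone (s.symm.trans t) := by
    refine StrictMono.monotone fun a b hab => ?_
    rw [← s.apply_symm_apply a, ← s.apply_symm_apply b, h'] at hab
    exact hab
  have := (Equiv.Perm.monotone_iff _).1 hm
  ext i
  have := Equiv.congr_fun this (s i)
  simp at this
  rw [this]

theorem std_eq_iff {n : ℕ} (x : Fin n → Block × ℝ) (t : Equiv.Perm (Fin n)) :
    std x = t ↔ ∀ i j, i < j → (Precedes (x i) (x j) ↔ t i < t j) := by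
  constructor
  · rintro rfl i j hij
    exact (std_lt_std_iff x hij).symm
  · intro h
    exact perm_ext_of_lt_iff fun i j hij => (std_lt_std_iff x hij).trans (h i j hij)

theorem measurableSet_precedes_apply {ι : Type*} (i j : ι) :
    MeasurableSet {x : ι → Block × ℝ | Precedes (x i) (x j)} :=
  (show Measurable fun x : ι → Block × ℝ => (x i, x j) by fun_prop) measurableSet_precedes

theorem measurableSet_std_eq {n : ℕ} (t : Equiv.Perm (Fin n)) :
    MeasurableSet {x : Fin n → Block × ℝ | std x = t} := by
  simp only [std_eq_iff, Set.ofPred_forall]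
  refine MeasurableSet.iInter fun i => .iInter fun j => .iInter fun _ => ?_
  by_cases h : t i < t j
  · simpa only [h, iff_true] using measurableSet_precedes_apply i j
  · simp only [h, iff_false]
    exact (measurableSet_precedes_apply i j).compl

theorem measurableSet_std {n : ℕ} (Q : Equiv.Perm (Fin n) → Prop) :
    MeasurableSet {x : Fin n → Block × ℝ | Q (std x)} := by
  have : {x : Fin n → Block × ℝ | Q (std x)} = ⋃ t ∈ {t | Q t}, {x | std x = t} := by
    ext x; simp
  rw [this]
  exact .biUnion (Set.to_countable _) fun t _ => measurableSet_std_eq t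

theorem lettersLaw_std (ω : ThomaSimplex) {n : ℕ} (Q : Equiv.Perm (Fin n) → Prop)
    [DecidablePred Q] :
    (lettersLaw ω n) {x | Q (std x)} =
      ∑ t with Q t, (lettersLaw ω n) {x | std x = t} := by
  have : {x : Fin n → Block × ℝ | Q (std x)} =
      ⋃ t ∈ (Finset.univ.filter Q), {x | std x = t} := by
    ext x; simp
  rw [this, measure_biUnion_finset _ fun t _ => measurableSet_std_eq t]
  intro s _ t _ hst
  exact Set.disjoint_left.2 fun x hx hx' => hst (hx.symm.trans hx')

/-! Reordering and concatenation of independent letters. -/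

/-- Selecting or permuting coordinates of an i.i.d. family leaves it i.i.d. -/
theorem pi_map_comp_of_injective {ι κ X : Type*} [Fintype ι] [Fintype κ] [MeasurableSpace X]
    (μ : Measure X) [IsProbabilityMeasure μ] {e : κ → ι} (he : Function.Injective e) :
    (Measure.pi fun _ : ι => μ).map (fun x i => x (e i)) = Measure.pi fun _ : κ => μ := by
  have h := (iIndepFun_pi (μ := fun _ : ι => μ) (X := fun _ x => x)
    fun _ => aemeasurable_id).precomp he
  rw [iIndepFun_iff_map_fun_eq_pi_map fun i => (measurable_pi_apply _).aemeasurable] at h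
  rw [h]
  congr 1
  funext i
  exact (measurePreserving_eval (fun _ : ι => μ) (e i)).map_eq

theorem lettersLaw_append (ω : ThomaSimplex) {k r : ℕ} {s : Set (Fin k → Block × ℝ)}
    {t : Set (Fin r → Block × ℝ)} (hs : MeasurableSet s) (ht : MeasurableSet t) :
    (lettersLaw ω (k + r)) {x | (fun i => x (Fin.castAdd r i)) ∈ s ∧
      (fun i => x (Fin.natAdd k i)) ∈ t} = lettersLaw ω k s * lettersLaw ω r t := by
  have hm : Measurable fun p : (Fin k → Block × ℝ) × (Fin r → Block × ℝ) =>
      Fin.append p.1 p.2 := by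
    rw [measurable_pi_iff]
    intro i
    refine Fin.addCases (fun i => ?_) (fun i => ?_) i
    · simp only [Fin.append_left]; fun_prop
    · simp only [Fin.append_right]; fun_prop
  have hmap : ((lettersLaw ω k).prod (lettersLaw ω r)).map
      (fun p => Fin.append p.1 p.2) = lettersLaw ω (k + r) := by
    symm
    refine Measure.pi_eq fun u hu => ?_
    rw [Measure.map_apply hm (.univ_pi hu)]
    have : (fun p : (Fin k → Block × ℝ) × (Fin r → Block × ℝ) => Fin.append p.1 p.2) ⁻¹'
        Set.univ.pi u = (Set.univ.pi fun i => u (Fin.castAdd r i)) ×ˢ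
          Set.univ.pi fun i => u (Fin.natAdd k i) := by
      ext p
      simp [Fin.forall_fin_add]
    rw [this, Measure.prod_prod, lettersLaw, lettersLaw, Measure.pi_pi, Measure.pi_pi,
      Fin.prod_univ_add]
  rw [← hmap, Measure.map_apply hm, ← Measure.prod_prod]
  · congr 1
    ext p
    simp
  · exact ((show Measurable fun (x : Fin (k + r) → Block × ℝ) i => x (Fin.castAdd r i) by
      fun_prop) hs).inter ((show Measurable fun (x : Fin (k + r) → Block × ℝ) i =>
        x (Fin.natAdd k i) by fun_prop) ht)

/-! The law of the standardization. -/

theorem std_eq_iff_strictMono {n : ℕ} (x : Fin n → Block × ℝ) (t : Equiv.Perm (Fin n)) :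
    std x = t ↔ StrictMono fun c => letterKey (t.symm c) (x (t.symm c)) := by
  constructor
  · rintro rfl a b hab
    rw [← std_lt_std_iff']
    simpa
  · intro h
    refine perm_ext_of_lt_iff fun i j _ => ?_
    rw [std_lt_std_iff']
    simpa using h.lt_iff_lt (a := t i) (b := t j)

theorem measurableSet_strictMono_letterKey {n : ℕ} (t : Equiv.Perm (Fin n)) :
    MeasurableSet {y : Fin n → Block × ℝ | StrictMono fun c => letterKey (t.symm c) (y c)} := by
  have hm : Measurable fun (y : Fin n → Block × ℝ) i => y (t i) := by fun_prop
  have := hm (measurableSet_std_eq t)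
  simpa [Set.preimage_ofPred_eq, std_eq_iff_strictMono] using this

/-- By exchangeability, the letters may be indexed by the rank they should receive instead of by
their position; then `t` enters only through the positions used in the keys. -/
theorem lettersLaw_std_eq (ω : ThomaSimplex) {n : ℕ} (t : Equiv.Perm (Fin n)) :
    (lettersLaw ω n) {x | std x = t} =
      (lettersLaw ω n) {y | StrictMono fun c => letterKey (t.symm c) (y c)} := by
  conv_rhs => rw [lettersLaw, ← pi_map_comp_of_injective (letterLaw ω) t.symm.injective]
  rw [Measure.map_apply (by fun_prop) (measurableSet_strictMono_letterKey t)]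
  simp only [Set.preimage_ofPred_eq, ← std_eq_iff_strictMono, lettersLaw]

theorem strictMono_fin_iff {n : ℕ} {A : Type*} [Preorder A] {f : Fin n → A} :
    StrictMono f ↔ ∀ x y : Fin n, (y : ℕ) = x + 1 → f x < f y := by
  cases n with
  | zero => exact ⟨fun _ x => x.elim0, fun _ x => x.elim0⟩
  | succ n =>
    rw [Fin.strictMono_iff_lt_succ]
    constructor
    · intro h x y hxy
      have hx : (x : ℕ) < n := by omega
      have e : y = Fin.succ ⟨x, hx⟩ := Fin.ext hxy
      rw [e]
      exact h ⟨x, hx⟩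
    · intro h i
      exact h _ _ (by simp)

/-- It is enough to compare the keys of consecutive ranks, and such a comparison depends on the
positions only through their order, that is, through a descent of the inverse permutation. The two
events coincide. -/
theorem lettersLaw_std_congr (ω : ThomaSimplex) {n : ℕ} {s t : Equiv.Perm (Fin n)}
    (h : tableauP (List.ofFn s) = tableauP (List.ofFn t)) :
    (lettersLaw ω n) {x | std x = s} = (lettersLaw ω n) {x | std x = t} := by
  rw [lettersLaw_std_eq, lettersLaw_std_eq]
  congr 1
  ext y
  simp only [Set.mem_ofPred_eq, strictMono_fin_iff]
  refine forall_congr' fun a => forall_congr' fun b => imp_congr_right fun hab => ?_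
  have hd := symm_lt_symm_iff_of_tableauP_eq h hab
  have hne : ∀ u : Equiv.Perm (Fin n), u.symm a ≠ u.symm b := fun u hu => by
    have := u.symm.injective hu
    subst this; omega
  rcases lt_or_gt_of_ne (hne s) with h1 | h1
  · rw [letterKey_lt_iff h1, letterKey_lt_iff (hd.1 h1)]
  · have h2 : t.symm b < t.symm a :=
      lt_of_le_of_ne (not_lt.1 (hd.not.1 h1.not_gt)) (hne t).symm
    rw [letterKey_gt_iff h1, letterKey_gt_iff h2]

/-! Recording sequences of random words. -/

/-- The probability that `p` is the recording sequence of a random word of length `n`. -/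
noncomputable def recordProb (ω : ThomaSimplex) (n : ℕ) (p : List ℕ) : ℝ :=
  (lettersLaw ω n).real {x | rowSeq (List.ofFn (std x)) = p}

theorem ofFn_perm_injective {n : ℕ} {s t : Equiv.Perm (Fin n)}
    (h : List.ofFn s = List.ofFn t) : s = t :=
  Equiv.ext (congrFun (List.ofFn_injective h))

/-- Change the recording sequence from `p` to `q` while keeping the insertion tableau: this is a
bijection between the two sets of permutations, and it preserves probabilities. -/
theorem recordProb_congr (ω : ThomaSimplex) (n : ℕ) {p q : List ℕ} (hp : IsLattice p)
    (hq : IsLattice q) (hpq : p.Perm q) : recordProb ω n p = recordProb ω n q := by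
  unfold recordProb Measure.real
  rw [lettersLaw_std ω fun t => rowSeq (List.ofFn t) = p,
    lettersLaw_std ω fun t => rowSeq (List.ofFn t) = q]
  congr 1
  have key : ∀ s ∈ Finset.univ.filter (fun s : Equiv.Perm (Fin n) => rowSeq (List.ofFn s) = p),
      ∃ t : Equiv.Perm (Fin n),
        tableauP (List.ofFn t) = tableauP (List.ofFn s) ∧ rowSeq (List.ofFn t) = q := by
    intro s hs
    exact exists_perm_rowSeq s hq ((Finset.mem_filter.1 hs).2 ▸ hpq.symm)
  refine Finset.sum_bij (fun s hs => (key s hs).choose) ?_ ?_ ?_ ?_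
  · intro s hs
    simpa using (key s hs).choose_spec.2
  · intro s hs s' hs' h
    refine ofFn_perm_injective (eq_of_tableauP_eq ?_ ?_)
    · rw [← (key s hs).choose_spec.1, ← (key s' hs').choose_spec.1, h]
    · rw [(Finset.mem_filter.1 hs).2, (Finset.mem_filter.1 hs').2]
  · intro t ht
    obtain ⟨s, hs1, hs2⟩ := exists_perm_rowSeq t hp ((Finset.mem_filter.1 ht).2 ▸ hpq)
    have hs : s ∈ Finset.univ.filter
      (fun s : Equiv.Perm (Fin n) => rowSeq (List.ofFn s) = p) := by simpa using hs2
    refine ⟨s, hs, ofFn_perm_injective (eq_of_tableauP_eq ?_ ?_)⟩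
    · rw [(key s hs).choose_spec.1, hs1]
    · rw [(key s hs).choose_spec.2, (Finset.mem_filter.1 ht).2]
  · intro s hs
    exact lettersLaw_std_congr ω (key s hs).choose_spec.1.symm

theorem recordProb_nil (ω : ThomaSimplex) : recordProb ω 0 [] = 1 := by
  simp [recordProb, rowSeq, rowSeqFrom]

/-- The probability that a random word of length `r` is increasing. -/
noncomputable def increasingProb (ω : ThomaSimplex) (r : ℕ) : ℝ :=
  (lettersLaw ω r).real {x | ∀ i j, i < j → Precedes (x i) (x j)}

theorem increasingProb_eq (ω : ThomaSimplex) (r : ℕ) :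
    increasingProb ω r = (lettersLaw ω r).real {x | std x = 1} := by
  unfold increasingProb
  congr 1
  ext x
  simp only [Set.mem_ofPred_eq, std_eq_iff]
  refine forall_congr' fun i => forall_congr' fun j => forall_congr' fun hij => ?_
  simp [hij]

theorem rowSeq_ofFn_eq {k n : ℕ} {u : Fin k → Fin n} {s : Equiv.Perm (Fin k)}
    (h : ∀ i j, i < j → (s i < s j ↔ u i < u j)) (hu : Function.Injective u) :
    rowSeq (List.ofFn u) = rowSeq (List.ofFn s) := by
  have h' : ∀ i j, s i < s j ↔ u i < u j := by
    intro i j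
    rcases lt_trichotomy i j with hij | rfl | hij
    · exact h i j hij
    · simp
    · rw [← not_le, ← not_le, le_iff_lt_or_eq, le_iff_lt_or_eq, h j i hij]
      simp [hu.eq_iff]
  have hm : StrictMono (u ∘ s.symm) := by
    intro a b hab
    rw [← s.apply_symm_apply a, ← s.apply_symm_apply b, h'] at hab
    exact hab
  have : List.ofFn u = (List.ofFn s).map (u ∘ s.symm) := by
    rw [List.map_ofFn]
    congr 1
    funext i
    simp
  rw [this, rowSeq_map hm]

/-- Standardizing a prefix gives the same relative order as restricting the standardization, and
recording sequences depend on nothing else. -/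
theorem take_rowSeq_std {k r : ℕ} (x : Fin (k + r) → Block × ℝ) :
    (rowSeq (List.ofFn (std x))).take k =
      rowSeq (List.ofFn (std fun i => x (Fin.castAdd r i))) := by
  rw [← rowSeq_take, List.ofFn_add, List.take_left' (by simp)]
  refine rowSeq_ofFn_eq (fun i j hij => ?_) ((std x).injective.comp (Fin.castAdd_injective k r))
  rw [std_lt_std_iff _ hij, ← std_lt_std_iff x (show Fin.castAdd r i < Fin.castAdd r j from hij)]
  rfl

theorem drop_rowSeq_std {k r : ℕ} (x : Fin (k + r) → Block × ℝ) :
    ((rowSeq (List.ofFn (std x))).drop k).Pairwise (· ≥ ·) ↔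
      ∀ i j : Fin r, i < j → Precedes (x (Fin.natAdd k i)) (x (Fin.natAdd k j)) := by
  rw [List.ofFn_add, rowSeq, rowSeqFrom_append, List.drop_left' (by simp), ← isChain_ge_iff,
    isChain_rowSeqFrom (IsTableau.insertList (T := []) trivial _), List.isChain_iff_pairwise,
    List.pairwise_ofFn]
  refine forall_congr' fun i => forall_congr' fun j => forall_congr' fun hij => ?_
  have hlt : Fin.natAdd k i < Fin.natAdd k j := by simpa using hij
  rw [← std_lt_std_iff x hlt, le_iff_lt_or_eq, (std x).injective.eq_iff]
  simp [hlt.ne]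

/-- The first factor concerns the first `p.length` letters, the second one the next `r` letters,
which are independent of them. -/
theorem recordProb_mul_increasingProb (ω : ThomaSimplex) (r : ℕ) (p : List ℕ) :
    recordProb ω p.length p * increasingProb ω r = (lettersLaw ω (p.length + r)).real
      {x | ∃ q : List ℕ, q.Pairwise (· ≥ ·) ∧ rowSeq (List.ofFn (std x)) = p ++ q} := by
  have hinc : MeasurableSet {x : Fin r → Block × ℝ | ∀ i j, i < j → Precedes (x i) (x j)} := by
    simp only [Set.ofPred_forall]
    exact .iInter fun i => .iInter fun j => .iInter fun _ => measurableSet_precedes_apply i j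
  unfold recordProb increasingProb Measure.real
  rw [← ENNReal.toReal_mul, ← lettersLaw_append ω
    (measurableSet_std fun t => rowSeq (List.ofFn t) = p) hinc]
  congr 2
  ext x
  simp only [Set.mem_ofPred_eq, ← take_rowSeq_std, ← drop_rowSeq_std]
  constructor
  · rintro ⟨h1, h2⟩
    refine ⟨_, h2, ?_⟩
    conv_lhs => rw [← List.take_append_drop p.length (rowSeq (List.ofFn (std x))), h1]
  · rintro ⟨q, h1, h2⟩
    rw [h2]
    simpa using h1

/-! ### Pieri rule and determinantal formula for the probabilities of shapes. -/

/-- The probability of a recording sequence with `l i` entries equal to `i`. -/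
noncomputable def shapeProb (ω : ThomaSimplex) (l : ℕ → ℕ) : ℝ :=
  open Classical in
  if h : ∃ p : List ℕ, IsLattice p ∧ ∀ i, p.count i = l i then
    recordProb ω h.choose.length h.choose else 0

theorem shapeProb_eq (ω : ThomaSimplex) {p : List ℕ} (hp : IsLattice p) {l : ℕ → ℕ}
    (hl : ∀ i, p.count i = l i) : shapeProb ω l = recordProb ω p.length p := by
  have h : ∃ p : List ℕ, IsLattice p ∧ ∀ i, p.count i = l i := ⟨p, hp, hl⟩
  have hperm : h.choose.Perm p :=
    List.perm_iff_count.2 fun i => (h.choose_spec.2 i).trans (hl i).symm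
  rw [shapeProb, dif_pos h, hperm.length_eq]
  exact recordProb_congr ω _ h.choose_spec.1 hp hperm

-- Continue a fixed word of content `l` by a weakly decreasing word of length `r`. The result is a
-- lattice word exactly when its content is obtained by a horizontal strip, and the content
-- determines the continuation; so the event splits into one recording sequence per strip.
open Classical in
theorem shapeProb_mul_increasingProb (ω : ThomaSimplex) (N : ℕ) (l : ℕ → ℕ) (hl : Antitone l)
    (hl0 : ∀ i, N ≤ i → l i = 0) (r : ℕ) : shapeProb ω l * increasingProb ω r =
      ∑ m ∈ (range (N + 1)).piAntidiag (∑ i ∈ range N, l i + r),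
        if HorizontalStrip l m then shapeProb ω m else 0 := by
  obtain ⟨p, hp, hc'⟩ := exists_isLattice hl N
  have hc : ∀ i, p.count i = l i := fun i => by
    rw [hc']
    split_ifs with h
    exacts [rfl, (hl0 i (not_lt.1 h)).symm]
  have hlen : p.length = ∑ i ∈ range N, l i := by
    rw [length_eq_sum_count (N := N) fun i hi => by rw [hc, hl0 i hi]]
    simp only [hc]
  rw [shapeProb_eq ω hp hc, recordProb_mul_increasingProb, ← hlen, ← Finset.sum_filter]
  have hcq : ∀ m ∈ ((range (N + 1)).piAntidiag (p.length + r)).filter (HorizontalStrip l), ∀ i,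
      p.count i + (descList (fun j => m j - l j) (N + 1)).count i = m i := by
    intro m hm i
    rw [Finset.mem_filter, Finset.mem_piAntidiag] at hm
    rw [hc, count_descList]
    have h1 := (hm.2 i).1
    have h2 := hm.1.2 i
    rw [Finset.mem_range] at h2
    split_ifs <;> omega
  have hset : {x : Fin (p.length + r) → Block × ℝ | ∃ q : List ℕ, q.Pairwise (· ≥ ·) ∧
      rowSeq (List.ofFn (std x)) = p ++ q} =
      ⋃ m ∈ ((range (N + 1)).piAntidiag (p.length + r)).filter (HorizontalStrip l),
        {x | rowSeq (List.ofFn (std x)) = p ++ descList (fun j => m j - l j) (N + 1)} := by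
    ext x
    simp only [Set.mem_ofPred_eq, Set.mem_iUnion]
    constructor
    · rintro ⟨q, hq, hx⟩
      have hlat : IsLattice (p ++ q) := hx ▸ isLattice_rowSeq _
      have hcount := hlat.count_le hq
      have hql : (p ++ q).length = p.length + r := by rw [← hx]; simp
      have hstrip : HorizontalStrip l fun i => (p ++ q).count i := by
        intro j
        have := hcount j
        rw [hc] at this
        simp only [List.count_append, hc] at this ⊢
        omega
      -- A horizontal strip opens at most one new row; hence the range `N + 1`.
      have h0 : ∀ i, N + 1 ≤ i → (p ++ q).count i = 0 := by
        intro i hi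
        obtain ⟨i, rfl⟩ : ∃ j, i = j + 1 := ⟨i - 1, by omega⟩
        have := (hstrip i).2
        rw [hl0 i (by omega)] at this
        simpa using this
      refine ⟨fun i => (p ++ q).count i, ?_, ?_⟩
      · rw [Finset.mem_filter, Finset.mem_piAntidiag]
        refine ⟨⟨?_, fun i hi => ?_⟩, hstrip⟩
        · rw [← hql]
          exact (length_eq_sum_count h0).symm
        · by_contra h
          exact hi (h0 i (by simpa using h))
      · rw [hx]
        congr 1
        -- A weakly decreasing word is determined by its content.
        refine List.Perm.eq_of_pairwise (le := (· ≥ ·)) (fun a b _ _ h1 h2 => le_antisymm h2 h1) hq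
          (pairwise_descList _ _) (List.perm_iff_count.2 fun i => ?_)
        rw [count_descList]
        have := h0 i
        simp only [List.count_append, hc] at this ⊢
        split_ifs <;> omega
    · rintro ⟨m, -, hx⟩
      exact ⟨_, pairwise_descList _ _, hx⟩
  rw [hset, measureReal_biUnion_finset]
  · refine Finset.sum_congr rfl fun m hm => ?_
    have hm' := Finset.mem_filter.1 hm
    have hlat : IsLattice (p ++ descList (fun j => m j - l j) (N + 1)) := by
      refine hp.append fun j => ?_
      rw [hcq m hm, hc]
      exact (hm'.2 j).2
    have hcnt : ∀ i, (p ++ descList (fun j => m j - l j) (N + 1)).count i = m i := fun i => by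
      rw [List.count_append, hcq m hm]
    have hlen' : (p ++ descList (fun j => m j - l j) (N + 1)).length = p.length + r := by
      rw [length_eq_sum_count (N := N + 1) fun i hi => ?_]
      · simp only [hcnt]
        exact (Finset.mem_piAntidiag.1 hm'.1).1
      · rw [hcnt]
        by_contra h
        have := (Finset.mem_piAntidiag.1 hm'.1).2 i h
        rw [Finset.mem_range] at this
        omega
    rw [shapeProb_eq ω hlat hcnt, hlen', recordProb]
  · intro m hm m' hm' hne
    refine Set.disjoint_left.2 fun x hx hx' => hne ?_
    funext i
    have := congrArg (List.count i) (hx.symm.trans hx')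
    rw [List.count_append, List.count_append, hcq m hm, hcq m' hm'] at this
    exact this
  · intro m _
    exact measurableSet_std fun t => rowSeq (List.ofFn t) = _

theorem increasingProb_zero (ω : ThomaSimplex) : increasingProb ω 0 = 1 := by
  simp [increasingProb]

theorem det_increasingProb (ω : ThomaSimplex) (N : ℕ) {l : ℕ → ℕ} (hl : Antitone l)
    (hl0 : ∀ i, N ≤ i → l i = 0) : (Matrix.of fun i j : Fin N =>
      if (i : ℕ) ≤ l i + j then increasingProb ω (l i + j - i) else 0).det = shapeProb ω l := by
  refine det_eq_of_pieri (shapeProb ω) (increasingProb ω) ?_ (increasingProb_zero ω)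
    (shapeProb_mul_increasingProb ω) N l hl hl0
  rw [shapeProb_eq ω (p := []) (fun _ => by simpa using antitone_const) (by simp)]
  exact recordProb_nil ω

/-! Relative order of independent uniform variables. -/

theorem ae_injective_uniform (n : ℕ) :
    ∀ᵐ u ∂(Measure.pi fun _ : Fin n => uniformLaw), Function.Injective u := by
  have h : ∀ i j : Fin n, i ≠ j → ∀ᵐ u ∂(Measure.pi fun _ : Fin n => uniformLaw), u i ≠ u j := by
    intro i j hij
    have hind := (iIndepFun_pi (μ := fun _ : Fin n => uniformLaw) (X := fun _ x => x)
      fun _ => aemeasurable_id).indepFun hij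
    rw [indepFun_iff_map_prod_eq_prod_map_map (measurable_pi_apply i).aemeasurable
      (measurable_pi_apply j).aemeasurable,
      (measurePreserving_eval (fun _ : Fin n => uniformLaw) i).map_eq,
      (measurePreserving_eval (fun _ : Fin n => uniformLaw) j).map_eq] at hind
    have hd : MeasurableSet {p : ℝ × ℝ | p.1 = p.2} :=
      measurableSet_eq_fun measurable_fst measurable_snd
    have h0 : (uniformLaw.prod uniformLaw) {p : ℝ × ℝ | p.1 = p.2} = 0 := by
      rw [Measure.measure_prod_null hd]
      refine Filter.Eventually.of_forall fun a => ?_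
      have : Prod.mk a ⁻¹' {p : ℝ × ℝ | p.1 = p.2} = {a} := by ext b; simp [eq_comm]
      change uniformLaw (Prod.mk a ⁻¹' {p : ℝ × ℝ | p.1 = p.2}) = 0
      rw [this]
      exact measure_singleton a
    rw [← hind, Measure.map_apply (by fun_prop) hd] at h0
    rw [ae_iff]
    simpa using h0
  have h' : ∀ᵐ u ∂(Measure.pi fun _ : Fin n => uniformLaw), ∀ i j, i ≠ j → u i ≠ u j := by
    rw [ae_all_iff]
    intro i
    rw [ae_all_iff]
    intro j
    by_cases hij : i = j
    · simp [hij]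
    · simpa [hij] using h i j hij
  filter_upwards [h'] with u hu i j hij
  by_contra hne
  exact hu i j hne hij

theorem measurableSet_strictMono_comp {n l : ℕ} (e : Fin l → Fin n) :
    MeasurableSet {u : Fin n → ℝ | StrictMono (u ∘ e)} := by
  have : {u : Fin n → ℝ | StrictMono (u ∘ e)} =
      ⋂ i, ⋂ j, ⋂ (_ : i < j), {u : Fin n → ℝ | u (e i) < u (e j)} := by
    ext u
    simp [StrictMono]
  rw [this]
  exact .iInter fun i => .iInter fun j => .iInter fun _ =>
    measurableSet_lt (by fun_prop) (by fun_prop)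

theorem measurableSet_strictMono {l : ℕ} : MeasurableSet {u : Fin l → ℝ | StrictMono u} :=
  measurableSet_strictMono_comp id

/-- The `l!` orderings are equally likely and disjoint, and they exhaust the space up to the null
set where two coordinates agree. -/
theorem uniform_strictMono (l : ℕ) : (Measure.pi fun _ : Fin l => uniformLaw)
    {u | StrictMono u} = (l.factorial : ℝ≥0∞)⁻¹ := by
  set μ := Measure.pi fun _ : Fin l => uniformLaw with hμ
  have h1 : ∀ s : Equiv.Perm (Fin l), μ {u | StrictMono (u ∘ s)} = μ {u | StrictMono u} := by
    intro s
    conv_rhs => rw [hμ, ← pi_map_comp_of_injective uniformLaw s.injective]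
    rw [Measure.map_apply (by fun_prop) measurableSet_strictMono]
    rfl
  have h2 : μ (⋃ s ∈ (Finset.univ : Finset (Equiv.Perm (Fin l))), {u | StrictMono (u ∘ s)}) =
      1 := by
    rw [← prob_compl_eq_zero_iff (Finset.measurableSet_biUnion _ fun (s : Equiv.Perm (Fin l)) _ =>
      measurableSet_strictMono_comp s)]
    have hnull : μ {u | ¬ Function.Injective u} = 0 := ae_iff.1 (ae_injective_uniform l)
    refine measure_mono_null ?_ hnull
    intro u hu hu'
    refine hu ?_
    simp only [Finset.mem_univ, Set.iUnion_true, Set.mem_iUnion]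
    exact ⟨Tuple.sort u, (Tuple.monotone_sort u).strictMono_of_injective
      (Function.Injective.comp hu' (Tuple.sort u).injective)⟩
  rw [measure_biUnion_finset _ fun (s : Equiv.Perm (Fin l)) _ => measurableSet_strictMono_comp s,
    Finset.sum_congr rfl fun s _ => h1 s, Finset.sum_const, Finset.card_univ, Fintype.card_perm,
    Fintype.card_fin, nsmul_eq_mul, mul_comm] at h2
  · exact ENNReal.eq_inv_of_mul_eq_one_left h2
  · intro s _ s' _ hss
    refine Set.disjoint_left.2 fun u hu hu' => hss ?_
    have hinj : Function.Injective u := by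
      have := (StrictMono.injective hu).comp s.symm.injective
      simpa [Function.comp_assoc] using this
    have := Tuple.unique_monotone (StrictMono.monotone hu) (StrictMono.monotone hu')
    ext i
    exact congrArg _ (hinj (congrFun this i))

/-! The law of the standardization as a sum over the blocks. -/

/-- The condition on `t` for `t` to be a shuffle of a rearrangement of the blocks. -/
def Compatible {n : ℕ} (b : Fin n → Block) (t : Equiv.Perm (Fin n)) : Prop :=
  ∀ x y, x < y → b x = b y →
    match b x with
    | .up _ => t.symm x < t.symm y
    | .down _ => t.symm y < t.symm x
    | .last => True

/-- Separates the event into a condition on the blocks alone, a condition on blocks and `t`, and one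
on the real numbers in the last block, so that its probability factors. -/
theorem strictMono_letterKey_iff {n : ℕ} (t : Equiv.Perm (Fin n)) (y : Fin n → Block × ℝ) :
    (StrictMono fun c => letterKey (t.symm c) (y c)) ↔ Monotone (fun c => (y c).1) ∧
      Compatible (fun c => (y c).1) t ∧ ∀ a b, a < b → (y a).1 = .last → (y b).1 = .last →
        toLex ((y a).2, ((t.symm a : ℕ) : ℝ)) < toLex ((y b).2, ((t.symm b : ℕ) : ℝ)) := by
  have hne : ∀ a b, a < b → t.symm a ≠ t.symm b := fun a b h => t.symm.injective.ne h.ne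
  constructor
  · intro h
    refine ⟨monotone_iff_forall_lt.2 fun a b hab => ?_, fun a b hab he => ?_,
      fun a b hab ha hb => ?_⟩
    · have := h hab
      simp only [letterKey, Prod.Lex.toLex_lt_toLex] at this
      rcases this with h | h
      exacts [h.le, h.1.le]
    · have := h hab
      simp only [letterKey, Prod.Lex.toLex_lt_toLex, he, lt_irrefl, false_or, true_and] at this
      simp only [he]
      cases hb : (y b).1 <;> simp only [hb] at this ⊢
      · simpa using this
      · have h2 := hne a b hab
        simp only [neg_lt_neg_iff, neg_inj, Nat.cast_lt, Nat.cast_inj, Fin.val_inj,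
          Fin.val_fin_lt] at this
        tauto
    · have := h hab
      simp only [letterKey, Prod.Lex.toLex_lt_toLex, ha, hb, lt_irrefl, false_or, true_and] at this
      simpa [Prod.Lex.toLex_lt_toLex] using this
  · rintro ⟨h1, h2, h3⟩ a b hab
    have hm := h1 hab.le
    simp only at hm
    simp only [letterKey, Prod.Lex.toLex_lt_toLex]
    rcases hm.lt_or_eq with hm | hm
    · exact Or.inl hm
    · refine Or.inr ⟨hm, ?_⟩
      have h4 := h2 a b hab hm
      have h5 := h3 a b hab
      simp only [hm] at h4 h5 ⊢
      cases hb : (y b).1 <;> simp only [hb] at h4 h5 ⊢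
      · simpa using h4
      · left; simpa using h4
      · simpa [Prod.Lex.toLex_lt_toLex] using h5 trivial trivial

/-- Only the coordinates in the last block are constrained, and the tie-breaker `s` is almost surely
irrelevant. -/
theorem uniform_last {n : ℕ} (v : Fin n → Block) (s : Fin n → ℝ) :
    (Measure.pi fun _ : Fin n => uniformLaw) {u | ∀ a b, a < b → v a = .last → v b = .last →
      toLex (u a, s a) < toLex (u b, s b)} =
        ((Finset.univ.filter fun x => v x = .last).card.factorial : ℝ≥0∞)⁻¹ := by
  classical
  set S := Finset.univ.filter fun x => v x = .last with hS
  set e := S.orderEmbOfFin rfl with he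
  rw [← uniform_strictMono, ← pi_map_comp_of_injective uniformLaw e.injective,
    Measure.map_apply (by fun_prop) measurableSet_strictMono]
  refine measure_congr ?_
  filter_upwards [ae_injective_uniform n] with u hu
  refine propext ?_
  change (∀ a b, a < b → v a = .last → v b = .last → toLex (u a, s a) < toLex (u b, s b)) ↔
    StrictMono fun i => u (e i)
  have hmem : ∀ a, v a = .last ↔ ∃ i, e i = a := by
    intro a
    have : a ∈ Set.range e ↔ a ∈ (S : Set (Fin n)) := by rw [Finset.range_orderEmbOfFin]
    rw [← Set.mem_range, this]
    simp [hS]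
  constructor
  · intro h i j hij
    have := h (e i) (e j) (e.lt_iff_lt.2 hij) ((hmem _).2 ⟨i, rfl⟩) ((hmem _).2 ⟨j, rfl⟩)
    rw [Prod.Lex.toLex_lt_toLex] at this
    rcases this with h | h
    · exact h
    · exact absurd (e.injective (hu h.1)) hij.ne
  · intro h a b hab ha hb
    obtain ⟨i, rfl⟩ := (hmem a).1 ha
    obtain ⟨j, rfl⟩ := (hmem b).1 hb
    exact Prod.Lex.toLex_lt_toLex.2 (Or.inl (h (e.lt_iff_lt.1 hab)))

theorem lettersLaw_prod (ω : ThomaSimplex) {n : ℕ} (v : Fin n → Block) (C : Set (Fin n → ℝ)) :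
    (lettersLaw ω n) {y | (fun c => (y c).1) = v ∧ (fun c => (y c).2) ∈ C} =
      (∏ c, ω.blockLaw (v c)) * (Measure.pi fun _ : Fin n => uniformLaw) C := by
  have h := measurePreserving_arrowProdEquivProdArrow Block ℝ (Fin n)
    (fun _ => ω.blockLaw.toMeasure) (fun _ => uniformLaw)
  have h1 : (Measure.pi fun _ : Fin n => ω.blockLaw.toMeasure) {v} = ∏ c, ω.blockLaw (v c) := by
    rw [Measure.pi_singleton]
    exact Finset.prod_congr rfl fun c _ => PMF.toMeasure_apply_singleton _ _ (.singleton _)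
  rw [← h1, ← Measure.prod_prod, ← h.measure_preimage_equiv]
  rfl

open Classical in
theorem lettersLaw_std_eq_tsum (ω : ThomaSimplex) {n : ℕ} (t : Equiv.Perm (Fin n)) :
    (lettersLaw ω n) {x | std x = t} = ∑' v : Fin n → Block,
      if Monotone v ∧ Compatible v t then (∏ c, ω.blockLaw (v c)) *
        ((Finset.univ.filter fun x => v x = .last).card.factorial : ℝ≥0∞)⁻¹ else 0 := by
  rw [lettersLaw_std_eq]
  have hu : {y : Fin n → Block × ℝ | StrictMono fun c => letterKey (t.symm c) (y c)} =
      ⋃ v : Fin n → Block, {y | (fun c => (y c).1) = v} ∩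
        {y | StrictMono fun c => letterKey (t.symm c) (y c)} := by
    ext y; simp
  rw [hu, measure_iUnion]
  · refine tsum_congr fun v => ?_
    split_ifs with h
    · rw [← uniform_last v fun c => ((t.symm c : ℕ) : ℝ), ← lettersLaw_prod]
      congr 1
      ext y
      simp only [Set.mem_inter_iff, Set.mem_ofPred_eq, strictMono_letterKey_iff]
      refine and_congr_right fun hv => ?_
      subst hv
      simp [h]
    · convert measure_empty (μ := lettersLaw ω n)
      ext y
      simp only [Set.mem_inter_iff, Set.mem_ofPred_eq, strictMono_letterKey_iff,
        Set.mem_empty_iff_false, iff_false]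
      rintro ⟨rfl, h1, h2, -⟩
      exact h ⟨h1, h2⟩
  · intro v v' hne
    exact Set.disjoint_left.2 fun y hy hy' => hne (hy.1.symm.trans hy'.1)
  · intro v
    refine MeasurableSet.inter ?_ (measurableSet_strictMono_letterKey t)
    have hm : Measurable fun (y : Fin n → Block × ℝ) c => (y c).1 := by fun_prop
    exact hm (measurableSet_singleton v)

/-! Sizes of blocks and non-decreasing sequences of blocks. -/

theorem ofFn_blockOf {n : ℕ} (c : Sizes Block n) :
    List.ofFn (blockOf c) = c.1.toMultiset.sort (· ≤ ·) := by
  refine List.ext_getElem (by rw [card_toMultiset_sizes, List.length_ofFn]) fun i h1 h2 => ?_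
  simp [blockOf]

theorem map_blockOf {n : ℕ} (c : Sizes Block n) :
    (Finset.univ : Finset (Fin n)).val.map (blockOf c) = c.1.toMultiset := by
  rw [Fin.univ_val_map, ofFn_blockOf, Multiset.sort_eq]

theorem blockOf_injective {n : ℕ} : Function.Injective (blockOf (n := n)) := by
  intro c d h
  classical
  have h' : c.1.toMultiset = d.1.toMultiset := by rw [← map_blockOf, ← map_blockOf, h]
  refine Subtype.ext ?_
  rw [← Finsupp.toMultiset_toFinsupp c.1, h', Finsupp.toMultiset_toFinsupp]

theorem exists_blockOf_eq {n : ℕ} {v : Fin n → Block} (hv : Monotone v) :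
    ∃ c, blockOf c = v := by
  classical
  have hcard : ((Finset.univ : Finset (Fin n)).val.map v).toFinsupp.toMultiset =
      (Finset.univ : Finset (Fin n)).val.map v := Multiset.toFinsupp_toMultiset _
  refine ⟨⟨((Finset.univ : Finset (Fin n)).val.map v).toFinsupp, ?_⟩, ?_⟩
  · refine (Finsupp.card_toMultiset _).symm.trans ?_
    rw [hcard]
    simp
  · refine List.ofFn_injective ?_
    rw [ofFn_blockOf]
    rw [hcard]
    refine List.Perm.eq_of_pairwise (le := (· ≤ ·)) (fun a b _ _ h1 h2 => le_antisymm h1 h2)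
      (Multiset.pairwise_sort _ _) ?_ (Multiset.coe_eq_coe.1 ?_)
    · rw [List.pairwise_ofFn]
      exact fun i j hij => hv hij.le
    · rw [Multiset.sort_eq, Fin.univ_val_map]

theorem prod_blockOf {n : ℕ} {R : Type*} [CommMonoid R] (c : Sizes Block n) (f : Block → R) :
    ∏ x, f (blockOf c x) = c.1.prod fun b m => f b ^ m := by
  have : ∏ x, f (blockOf c x) = (((Finset.univ : Finset (Fin n)).val.map (blockOf c)).map f).prod := by
    rw [Multiset.map_map]; rfl
  rw [this, map_blockOf, Finsupp.toMultiset_map, Finsupp.prod_toMultiset,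
    Finsupp.prod_mapDomain_index (fun _ => pow_zero _) fun _ _ _ => pow_add _ _ _]

theorem card_blockOf_eq {n : ℕ} (c : Sizes Block n) (b : Block) [DecidablePred fun x => blockOf c x = b] :
    (Finset.univ.filter fun x => blockOf c x = b).card = c.1 b := by
  classical
  rw [← Finsupp.count_toMultiset, ← map_blockOf, Multiset.count_map]
  simp only [Finset.card, Finset.filter_val, eq_comm]

-- Indexed by rank, the blocks form a non-decreasing sequence, which is the same thing as a family
-- of block sizes.
open Classical in
theorem lettersLaw_std_eq_tsum_sizes (ω : ThomaSimplex) {n : ℕ} (t : Equiv.Perm (Fin n)) :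
    (lettersLaw ω n) {x | std x = t} = ∑' c : Sizes Block n,
      if Compatible (blockOf c) t then (c.1.prod fun b m => ω.blockLaw b ^ m) *
        ((c.1 .last).factorial : ℝ≥0∞)⁻¹ else 0 := by
  rw [lettersLaw_std_eq_tsum, ← blockOf_injective.tsum_eq]
  · refine tsum_congr fun c => ?_
    simp only [blockOf_monotone c, true_and, prod_blockOf, card_blockOf_eq]
  · intro v hv
    by_contra h
    refine hv (if_neg fun hv' => h ?_)
    exact exists_blockOf_eq hv'.1

/-! The number of rearrangements and the number of riffles. -/

section
variable {n : ℕ} {b : Fin n → Block}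

theorem strictMono_of_mem_riffles (hb : Monotone b) {r s : Equiv.Perm (Fin n)}
    (hr : ∀ x, b (r x) = b x) (hs : s ∈ riffles b r) :
    StrictMono fun x => toLex (b (r x), s.symm (r x)) := by
  intro x y hxy
  rw [Prod.Lex.toLex_lt_toLex]
  have h1 := hb hxy.le
  rcases h1.lt_or_eq with h | h
  · left; simpa [hr] using h
  · right
    simp only [hr, h, true_and]
    exact (Finset.mem_filter.1 hs).2 x y hxy (by rw [hr, hr, h])

/-- Collect the cards of each block in the order in which `s` shows them, that is, sort by block and
then by position in `s`. `eq_of_mem_riffles` says that this un-shuffling is unique. -/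
theorem exists_mem_riffles (hb : Monotone b) (s : Equiv.Perm (Fin n)) :
    ∃ r : Equiv.Perm (Fin n), (∀ x, b (r x) = b x) ∧ s ∈ riffles b r := by
  let f : Fin n → Block ×ₗ Fin n := fun x => toLex (b x, s.symm x)
  have hf : Function.Injective f := fun x y h => by
    simp only [f, EmbeddingLike.apply_eq_iff_eq, Prod.mk.injEq] at h
    exact h.2
  have hm := Tuple.monotone_sort f
  have hbm : Monotone (b ∘ Tuple.sort f) := fun x y h => by
    have := hm h
    simp only [Function.comp, f, Prod.Lex.toLex_le_toLex] at this
    rcases this with h | h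
    exacts [h.le, h.1.le]
  refine ⟨Tuple.sort f, fun x => ?_, ?_⟩
  · have h1 := Tuple.comp_sort_eq_comp_iff_monotone.2 hbm
    have h2 := (Tuple.comp_sort_eq_comp_iff_monotone (f := b) (σ := 1)).2 (by simpa using hb)
    exact congrFun (h1.trans h2.symm) x
  · refine Finset.mem_filter.2 ⟨Finset.mem_univ _, fun x y hxy h => ?_⟩
    have := hm.strictMono_of_injective (hf.comp (Tuple.sort f).injective) hxy
    simp only [Function.comp, f, Prod.Lex.toLex_lt_toLex] at this
    rcases this with h' | h'
    exacts [absurd h h'.ne, h'.2]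

theorem eq_of_mem_riffles (hb : Monotone b) {r r' s : Equiv.Perm (Fin n)}
    (hr : ∀ x, b (r x) = b x) (hr' : ∀ x, b (r' x) = b x) (hs : s ∈ riffles b r)
    (hs' : s ∈ riffles b r') : r = r' := by
  have := Tuple.unique_monotone (f := fun x => toLex (b x, s.symm x))
    (strictMono_of_mem_riffles hb hr hs).monotone (strictMono_of_mem_riffles hb hr' hs').monotone
  ext x
  have h := congrFun this x
  simp only [Function.comp, EmbeddingLike.apply_eq_iff_eq, Prod.mk.injEq] at h
  rw [h.2]

/-- Within a block, `s` and `r` show the cards in the same order, so the reversal and preservation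
requirements can be read off either deck. -/
theorem mem_rearrangements_iff {r s : Equiv.Perm (Fin n)} (hr : ∀ x, b (r x) = b x)
    (hs : s ∈ riffles b r) : r ∈ rearrangements b ↔ Compatible b s := by
  have hs' := (Finset.mem_filter.1 hs).2
  have hr' : ∀ x, b (r.symm x) = b x := fun x => by rw [← hr, r.apply_symm_apply]
  have hs2 : ∀ x y, b x = b y → (s.symm (r x) < s.symm (r y) ↔ x < y) := by
    intro x y h
    rcases lt_trichotomy x y with h1 | rfl | h1
    · simpa [h1] using hs' x y h1 (by rw [hr, hr, h])
    · simp
    · have := hs' y x h1 (by rw [hr, hr, h])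
      simp [h1.not_gt, this.le]
  simp only [rearrangements, Finset.mem_filter, Finset.mem_univ, true_and, Compatible]
  constructor
  · rintro ⟨-, h⟩ x y hxy he
    have e2 := hs2 (r.symm x) (r.symm y) (by rw [hr', hr', he])
    have e3 := hs2 (r.symm y) (r.symm x) (by rw [hr', hr', he])
    have h1 := h (r.symm x) (r.symm y)
    have h2 := h (r.symm y) (r.symm x)
    simp only [hr', he, r.apply_symm_apply] at h1 h2 e2 e3
    have hne : r.symm x ≠ r.symm y := r.symm.injective.ne hxy.ne
    rw [he]
    cases hb : b y <;> simp only [hb] at h1 h2 ⊢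
    · rw [e2]
      by_contra hc
      exact (h2 (lt_of_le_of_ne (not_lt.1 hc) hne.symm) trivial).not_gt hxy
    · rw [e3]
      by_contra hc
      exact (h1 (lt_of_le_of_ne (not_lt.1 hc) hne) trivial).not_gt hxy
  · intro h
    refine ⟨hr, fun x y hxy he => ?_⟩
    have e2 := (hs2 x y he).2 hxy
    have h1 := h (r x) (r y)
    have h2 := h (r y) (r x)
    simp only [hr, he] at h1 h2
    have hne : r x ≠ r y := r.injective.ne hxy.ne
    rw [he]
    cases hb : b y <;> simp only [hb] at h1 h2 ⊢
    · by_contra hc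
      exact (h2 (lt_of_le_of_ne (not_lt.1 hc) hne.symm) trivial).not_gt e2
    · by_contra hc
      exact (h1 (lt_of_le_of_ne (not_lt.1 hc) hne) trivial).not_gt e2

theorem card_riffles {r : Equiv.Perm (Fin n)} (hr : ∀ x, b (r x) = b x) :
    (riffles b r).card = (riffles b 1).card := by
  refine Finset.card_bij (fun s _ => r⁻¹ * s) ?_ ?_ ?_
  · intro s hs
    simp only [riffles, Finset.mem_filter, Finset.mem_univ, true_and] at hs ⊢
    intro x y hxy h
    exact hs x y hxy (by rw [hr, hr]; exact h)
  · intro s _ s' _ h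
    exact mul_left_cancel h
  · intro s hs
    refine ⟨r * s, ?_, by simp⟩
    simp only [riffles, Finset.mem_filter, Finset.mem_univ, true_and] at hs ⊢
    intro x y hxy h
    have e : ∀ z, (r * s).symm (r z) = s.symm z := fun z =>
      congrArg s.symm (r.symm_apply_apply z)
    rw [e, e]
    exact hs x y hxy (by rw [hr, hr] at h; exact h)

-- Every deck comes from exactly one block-preserving rearrangement by a riffle, and the number of
-- riffles does not depend on the rearrangement.
open Classical in
theorem card_stabilizer_mul_card_riffles (hb : Monotone b) :
    (Finset.univ.filter fun g : Equiv.Perm (Fin n) => ∀ x, b (g x) = b x).card *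
      (riffles b 1).card = n.factorial := by
  have h1 : (Finset.univ : Finset (Equiv.Perm (Fin n))) =
      (Finset.univ.filter fun g : Equiv.Perm (Fin n) => ∀ x, b (g x) = b x).biUnion
        (riffles b) := by
    ext s
    simpa using exists_mem_riffles hb s
  have h2 := congrArg Finset.card h1
  rw [Finset.card_biUnion, Finset.sum_congr rfl fun r hr =>
    card_riffles (Finset.mem_filter.1 hr).2, Finset.sum_const, smul_eq_mul, Finset.card_univ,
    Fintype.card_perm, Fintype.card_fin] at h2
  · exact h2.symm
  · intro r hr r' hr' hne
    refine Finset.disjoint_left.2 fun s hs hs' => hne (eq_of_mem_riffles hb (Finset.mem_filter.1 hr).2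
      (Finset.mem_filter.1 hr').2 hs hs')

/-- A strictly increasing self-map of a finite chain satisfies `x ≤ g x`; apply this to `g` and to
its inverse. -/
theorem apply_eq_self_of_strictMonoOn {g : Equiv.Perm (Fin n)} (hg : ∀ x, b (g x) = b x)
    {a : Block} (h : ∀ x y, x < y → b x = a → b y = a → g x < g y) {x : Fin n} (hx : b x = a) :
    g x = x := by
  have key : ∀ {g : Equiv.Perm (Fin n)}, (∀ x, b (g x) = b x) →
      (∀ x y, x < y → b x = a → b y = a → g x < g y) → ∀ x, b x = a → x ≤ g x := by
    intro g hg h x hx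
    let f : {x // b x = a} → {x // b x = a} := fun x => ⟨g x, by rw [hg, x.2]⟩
    have hf : StrictMono f := fun x y hxy => h x y hxy x.2 y.2
    exact hf.le_apply (x := ⟨x, hx⟩)
  have hg' : ∀ x, b (g.symm x) = b x := fun x => by rw [← hg, g.apply_symm_apply]
  refine le_antisymm ?_ (key hg h x hx)
  have h' : ∀ x y, x < y → b x = a → b y = a → g.symm x < g.symm y := by
    intro x y hxy hx hy
    by_contra hc
    have hne : g.symm y ≠ g.symm x := g.symm.injective.ne hxy.ne'
    have := h _ _ (lt_of_le_of_ne (not_lt.1 hc) hne) (by rw [hg', hy]) (by rw [hg', hx])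
    simp only [g.apply_symm_apply] at this
    exact this.not_gt hxy
  simpa using key hg' h' (g x) (by rw [hg, hx])

-- The rearrangements form a coset: one of them, composed with the permutations that move only the
-- cards of the last block.
open Classical in
theorem card_rearrangements (hb : Monotone b) :
    (rearrangements b).card = (Finset.univ.filter fun x => b x = .last).card.factorial := by
  obtain ⟨r, hr⟩ := rearrangements_nonempty b hb
  obtain ⟨hr1, hr2⟩ := (Finset.mem_filter.1 hr).2
  have hr3 : ∀ x, b (r.symm x) = b x := fun x => by rw [← hr1, r.apply_symm_apply]
  have h1 : (rearrangements b).card =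
      (Finset.univ.filter fun g : Equiv.Perm (Fin n) => ∀ x, b x ≠ .last → g x = x).card := by
    symm
    refine Finset.card_bij (fun g _ => r * g) ?_ ?_ ?_
    · intro g hg
      rw [Finset.mem_filter] at hg
      have hg' : ∀ x, b (g x) = b x := by
        intro x
        by_cases hx : b x = .last
        · rw [hx]
          by_contra h
          have := hg.2 (g x) h
          rw [g.injective this] at h
          exact h hx
        · rw [hg.2 x hx]
      refine Finset.mem_filter.2 ⟨Finset.mem_univ _, fun x => by simp [hr1, hg'],
        fun x y hxy h => ?_⟩
      have := hr2 x y hxy h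
      cases hx : b x with
      | last => trivial
      | up i =>
        simp only [hx] at this
        simpa [hg.2 x (by simp [hx]), hg.2 y (by simp [← h, hx])] using this
      | down i =>
        simp only [hx] at this
        simpa [hg.2 x (by simp [hx]), hg.2 y (by simp [← h, hx])] using this
    · intro g _ g' _ h
      exact mul_left_cancel h
    · intro s hs
      obtain ⟨hs1, hs2⟩ := (Finset.mem_filter.1 hs).2
      have hg : ∀ x, b ((r⁻¹ * s) x) = b x := fun x => by simp [hr3, hs1]
      refine ⟨r⁻¹ * s, Finset.mem_filter.2 ⟨Finset.mem_univ _, fun x hx => ?_⟩, by simp⟩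
      refine apply_eq_self_of_strictMonoOn hg (a := b x) (fun y z hyz hy hz => ?_) rfl
      have h1 := hs2 y z hyz (hy.trans hz.symm)
      have h2 := hr2 ((r⁻¹ * s) z) ((r⁻¹ * s) y)
      rw [hg, hg, hy, hz] at h2
      rw [hy] at h1
      by_contra hc
      have hne : (r⁻¹ * s) z ≠ (r⁻¹ * s) y := (r⁻¹ * s).injective.ne hyz.ne'
      have h3 := h2 (lt_of_le_of_ne (not_lt.1 hc) hne) rfl
      have hrs : ∀ w, r ((r⁻¹ * s) w) = s w := fun w => by simp
      rw [hrs, hrs] at h3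
      cases hbx : b x with
      | last => exact hx hbx
      | up i => simp only [hbx] at h1 h3; exact h1.not_gt h3
      | down i => simp only [hbx] at h1 h3; exact h1.not_gt h3
  rw [h1, ← Fintype.card_subtype, ← Fintype.card_subtype, ← Fintype.card_perm]
  refine Fintype.card_congr ((Equiv.subtypeEquivRight fun g => ?_).trans
    (Equiv.Perm.subtypeEquivSubtypePerm fun x => b x = .last).symm)
  rfl

end

-- The multinomial coefficient counts the riffles and the factorial counts the rearrangements. This
-- is why the two uniform choices cancel the multinomial weight up to `1 / l!`, with `l` the size of
-- the last block.
open Classical in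
theorem multinomial_mul_factorial {n : ℕ} (c : Sizes Block n) :
    c.1.multinomial * (c.1 .last).factorial =
      (rearrangements (blockOf c)).card * (riffles (blockOf c) 1).card := by
  have h1 := card_stabilizer_mul_card_riffles (blockOf_monotone c)
  have h2 : (Finset.univ.filter fun g : Equiv.Perm (Fin n) =>
      ∀ x, blockOf c (g x) = blockOf c x).card = ∏ a ∈ c.1.support, (c.1 a).factorial := by
    have := DomMulAct.stabilizer_card' (blockOf c)
    rw [Fintype.card_subtype] at this
    simp only [Fintype.card_subtype, card_blockOf_eq] at this
    have hs : Finset.image (blockOf c) Finset.univ = c.1.support := by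
      ext a
      rw [Finsupp.mem_support_iff, ← card_blockOf_eq c a]
      simp [Finset.filter_eq_empty_iff]
    rw [← hs, ← this]
    congr 1
    ext g
    simp [funext_iff]
  have h3 := Nat.multinomial_spec c.1.support c.1
  rw [show ∑ i ∈ c.1.support, c.1 i = n from c.2, ← Finsupp.multinomial_eq] at h3
  have h4 := card_rearrangements (blockOf_monotone c)
  rw [card_blockOf_eq] at h4
  have hpos : 0 < ∏ a ∈ c.1.support, (c.1 a).factorial :=
    Finset.prod_pos fun a _ => Nat.factorial_pos _
  rw [h2, ← h3] at h1
  rw [h4, Nat.eq_of_mul_eq_mul_left hpos h1, mul_comm]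

open Classical in
/-- The law of the `ω`-shuffle is the law of the standardization of a sequence of independent
letters. -/
theorem shuffle_apply (ω : ThomaSimplex) {n : ℕ} (t : Equiv.Perm (Fin n)) :
    shuffle ω n t = (lettersLaw ω n) {x | std x = t} := by
  rw [lettersLaw_std_eq_tsum_sizes, shuffle, PMF.bind_apply]
  refine tsum_congr fun c => ?_
  rw [PMF.bind_apply, tsum_fintype]
  have hmul : multinomialLaw ω.blockLaw n c =
      (c.1.multinomial : ℝ≥0∞) * c.1.prod (fun b m => ω.blockLaw b ^ m) := rfl
  set R := rearrangements (blockOf c) with hR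
  set F := (riffles (blockOf c) 1).card with hF
  -- The second uniform law has the same normalization for all intermediate decks, so the weight of
  -- a pair is constant on admissible pairs.
  have hterm : ∀ r : Equiv.Perm (Fin n),
      PMF.uniformOfFinset R (rearrangements_nonempty _ (blockOf_monotone c)) r *
        PMF.uniformOfFinset (riffles (blockOf c) r) (riffles_nonempty _ r) t =
      if r ∈ R ∧ t ∈ riffles (blockOf c) r then (R.card : ℝ≥0∞)⁻¹ * (F : ℝ≥0∞)⁻¹ else 0 := by
    intro r
    rw [PMF.uniformOfFinset_apply, PMF.uniformOfFinset_apply]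
    by_cases h1 : r ∈ R
    · rw [card_riffles (Finset.mem_filter.1 h1).2.1]
      by_cases h2 : t ∈ riffles (blockOf c) r <;> simp [h1, h2, hF]
    · simp [h1]
  have hcard : (c.1.multinomial : ℝ≥0∞) * ((R.card : ℝ≥0∞)⁻¹ * (F : ℝ≥0∞)⁻¹) =
      ((c.1 .last).factorial : ℝ≥0∞)⁻¹ := by
    have h1 := multinomial_mul_factorial c
    have h2 : (R.card : ℝ≥0∞) ≠ 0 := by
      exact_mod_cast (Finset.card_pos.2 (rearrangements_nonempty _ (blockOf_monotone c))).ne'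
    have h3 : ((c.1 .last).factorial : ℝ≥0∞) ≠ 0 := by exact_mod_cast Nat.factorial_ne_zero _
    refine ENNReal.eq_inv_of_mul_eq_one_left ?_
    rw [← ENNReal.mul_inv (Or.inl h2) (Or.inl (ENNReal.natCast_ne_top _)), mul_right_comm]
    have h4 : (c.1.multinomial : ℝ≥0∞) * ((c.1 .last).factorial : ℝ≥0∞) = R.card * F := by
      exact_mod_cast h1
    have h5 : (F : ℝ≥0∞) ≠ 0 := by
      exact_mod_cast (Finset.card_pos.2 (riffles_nonempty _ 1)).ne'
    rw [h4]
    exact ENNReal.mul_inv_cancel (mul_ne_zero h2 h5)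
      (ENNReal.mul_ne_top (ENNReal.natCast_ne_top _) (ENNReal.natCast_ne_top _))
  rw [Finset.sum_congr rfl fun r _ => hterm r, hmul]
  obtain ⟨r, hr, hrt⟩ := exists_mem_riffles (blockOf_monotone c) t
  have hiff := mem_rearrangements_iff hr hrt
  -- Given the sizes, `t` has a single possible intermediate deck `r`, which is admissible exactly
  -- when `t` is compatible with the blocks.
  rw [Finset.sum_eq_single r]
  · by_cases hc : Compatible (blockOf c) t
    · rw [if_pos ⟨hiff.2 hc, hrt⟩, if_pos hc, mul_right_comm, hcard, mul_comm]
    · rw [if_neg fun h => hc (hiff.1 h.1), if_neg hc, mul_zero]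
  · intro r' _ hne
    refine if_neg fun h => hne ?_
    exact eq_of_mem_riffles (blockOf_monotone c) (Finset.mem_filter.1 h.1).2.1 hr h.2 hrt
  · simp

/-! The probability that a random word is increasing is a complete homogeneous function. -/

/-- If the power series `Q i` has logarithmic derivative `∑ p (k + 1) X ^ k`, then the
coefficients of the product are the complete homogeneous functions. -/
theorem specialize_completeHom_of_derivative {R ι : Type*} [CommRing R] [Algebra ℚ R]
    (Q : ι → PowerSeries R) (p : ι → ℕ → R) (hQ0 : ∀ i, PowerSeries.constantCoeff (Q i) = 1)
    (hQ : ∀ i, PowerSeries.derivative R (Q i) = Q i * PowerSeries.mk (p i)) (s : Finset ι) (n : ℕ) :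
    specialize (fun k => ∑ i ∈ s, p i k) (completeHom n) =
      PowerSeries.coeff n (∏ i ∈ s, Q i) := by
  classical
  have hG : ∀ s : Finset ι, PowerSeries.derivative R (∏ i ∈ s, Q i) =
      (∏ i ∈ s, Q i) * PowerSeries.mk fun k => ∑ i ∈ s, p i k := by
    intro s
    induction s using Finset.induction_on with
    | empty => simp; ext; simp
    | insert a s ha ih =>
      have : (PowerSeries.mk fun m => ∑ i ∈ insert a s, p i m) =
          PowerSeries.mk (p a) + PowerSeries.mk fun m => ∑ i ∈ s, p i m := by
        ext m; simp [Finset.sum_insert ha]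
      rw [Finset.prod_insert ha, Derivation.leibniz, ih, hQ, this]
      simp only [smul_eq_mul]
      ring
  induction n using Nat.strong_induction_on with
  | _ n ih =>
    cases n with
    | zero => simp [completeHom, PowerSeries.coeff_zero_eq_constantCoeff_apply, map_prod, hQ0]
    | succ n =>
      have h1 := congrArg (PowerSeries.coeff n) (hG s)
      rw [PowerSeries.coeff_derivative, mul_comm (∏ i ∈ s, _), PowerSeries.coeff_mul,
        Finset.Nat.sum_antidiagonal_eq_sum_range_succ_mk, Finset.sum_range] at h1
      rw [completeHom, map_mul, map_sum]
      have h2 : ∀ k : Fin (n + 1), specialize (fun k => ∑ i ∈ s, p i k)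
          (MvPolynomial.X (k : ℕ) * completeHom (n - k)) =
          PowerSeries.coeff (k : ℕ) (PowerSeries.mk fun m => ∑ i ∈ s, p i m) *
            PowerSeries.coeff (n - k) (∏ i ∈ s, Q i) := by
        intro k
        rw [map_mul, ih (n - k) (by omega)]
        simp [specialize]
      rw [Finset.sum_congr rfl fun k _ => h2 k, ← h1]
      have h3 : specialize (fun k => ∑ i ∈ s, p i k) (MvPolynomial.C ((n + 1 : ℚ)⁻¹)) =
          algebraMap ℚ R ((n + 1 : ℚ)⁻¹) := by simp [specialize]
      have h4 : ((n : R) + 1) = algebraMap ℚ R (n + 1) := by simp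
      rw [h3, h4, mul_left_comm, ← map_mul, inv_mul_cancel₀ (by positivity), map_one, mul_one]

/-- The value of the complete homogeneous function `h_m` on a block of weight one. -/
noncomputable def Block.homCoeff : Block → ℕ → ℝ
  | .up _, _ => 1
  | .down _, m => if m ≤ 1 then 1 else 0
  | .last, m => (m.factorial : ℝ)⁻¹

/-- The value of the power sum `p_(k+1)` on a block of weight one. -/
noncomputable def Block.powCoeff : Block → ℕ → ℝ
  | .up _, _ => 1
  | .down _, k => (-1) ^ k
  | .last, k => if k = 0 then 1 else 0

theorem Block.homCoeff_zero (b : Block) : b.homCoeff 0 = 1 := by cases b <;> simp [homCoeff]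

/-- Newton's recursion for the series 1/(1 - z), 1 + z and exp z, whose logarithmic derivatives are
∑ z^k, ∑ (-z)^k and 1. -/
theorem Block.homCoeff_succ (b : Block) (m : ℕ) : b.homCoeff (m + 1) * (m + 1) =
    ∑ j ∈ range (m + 1), b.homCoeff (m - j) * b.powCoeff j := by
  cases b with
  | up i => simp [homCoeff, powCoeff]
  | down i =>
    simp only [homCoeff, powCoeff]
    cases m with
    | zero => simp
    | succ m =>
      rw [Finset.sum_range_succ, Finset.sum_range_succ, Finset.sum_eq_zero]
      · simp [pow_succ]
      · intro j hj
        rw [Finset.mem_range] at hj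
        rw [if_neg (by omega), zero_mul]
  | last =>
    rw [Finset.sum_eq_single 0]
    · simp only [homCoeff, powCoeff, if_true, Nat.factorial_succ, Nat.cast_mul, Nat.sub_zero]
      have : ((m : ℝ) + 1) ≠ 0 := by positivity
      have := Nat.cast_ne_zero (R := ℝ).2 m.factorial_ne_zero
      push_cast
      field_simp
    · intro j _ hj
      simp [powCoeff, hj]
    · simp

/-- The generating function of the complete homogeneous functions of a block of weight `w`. -/
noncomputable def Block.homSeries (w : ℝ) (b : Block) : PowerSeries ℝ :=
  PowerSeries.mk fun m => b.homCoeff m * w ^ m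

theorem Block.derivative_homSeries (w : ℝ) (b : Block) :
    PowerSeries.derivative ℝ (b.homSeries w) =
      b.homSeries w * PowerSeries.mk fun k => b.powCoeff k * w ^ (k + 1) := by
  ext m
  rw [PowerSeries.coeff_derivative, mul_comm (b.homSeries w), PowerSeries.coeff_mul,
    Finset.Nat.sum_antidiagonal_eq_sum_range_succ_mk]
  simp only [homSeries, PowerSeries.coeff_mk]
  rw [mul_right_comm, b.homCoeff_succ, Finset.sum_mul]
  refine Finset.sum_congr rfl fun j hj => ?_
  rw [Finset.mem_range] at hj
  have : w ^ (m + 1) = w ^ (j + 1) * w ^ (m - j) := by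
    rw [← pow_add]
    congr 1
    omega
  rw [this]
  ring

theorem specialize_completeHom_finset (w : Block → ℝ) (s : Finset Block) (n : ℕ) :
    specialize (fun k => ∑ b ∈ s, b.powCoeff k * w b ^ (k + 1)) (completeHom n) =
      PowerSeries.coeff n (∏ b ∈ s, b.homSeries (w b)) := by
  refine specialize_completeHom_of_derivative (fun b : Block => b.homSeries (w b))
    (fun b k => b.powCoeff k * w b ^ (k + 1)) (fun b => ?_)
    (fun b => b.derivative_homSeries (w b)) s n
  simp [Block.homSeries, ← PowerSeries.coeff_zero_eq_constantCoeff_apply, Block.homCoeff_zero]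

theorem summable_pow_of_le_one {a : ℕ → ℝ} (h0 : ∀ i, 0 ≤ a i) (ha : Summable a)
    (h1 : ∀ i, a i ≤ 1) (k : ℕ) : Summable fun i => a i ^ (k + 1) :=
  Summable.of_nonneg_of_le (fun i => pow_nonneg (h0 i) _)
    (fun i => pow_le_of_le_one (h0 i) (h1 i) k.succ_ne_zero) ha

theorem hasSum_powerSum (ω : ThomaSimplex) (k : ℕ) :
    HasSum (fun b : Block => b.powCoeff k * ω.weight b ^ (k + 1)) (ω.powerSum k) := by
  have h0 : 0 ≤ ∑' i, ω.α i := tsum_nonneg ω.α_nonneg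
  have h0' : 0 ≤ ∑' i, ω.β i := tsum_nonneg ω.β_nonneg
  have h1 : ∀ i, ω.α i ≤ 1 := fun i => by
    have := ω.α_summable.le_tsum i fun j _ => ω.α_nonneg j
    linarith [ω.sum_le_one]
  have h1' : ∀ i, ω.β i ≤ 1 := fun i => by
    have := ω.β_summable.le_tsum i fun j _ => ω.β_nonneg j
    linarith [ω.sum_le_one]
  rw [← Block.equivSum.hasSum_iff]
  refine HasSum.sum (HasSum.sum ?_ ?_) ?_
  · simpa [Function.comp_def, Block.equivSum, Block.powCoeff, ThomaSimplex.weight] using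
      (summable_pow_of_le_one ω.α_nonneg ω.α_summable h1 k).hasSum
  · simpa [Function.comp_def, Block.equivSum, Block.powCoeff, ThomaSimplex.weight] using
      (summable_pow_of_le_one ω.β_nonneg ω.β_summable h1' k).hasSum.mul_left ((-1) ^ k)
  · convert hasSum_unique (β := Unit) _ using 1
    by_cases hk : k = 0 <;> simp [Block.equivSum, Block.powCoeff, ThomaSimplex.weight, hk]

/-- A symmetric function is a polynomial in the power sums, hence continuous for their pointwise
convergence. This gives access to infinitely many blocks from finitely many. -/
theorem tendsto_specialize {ι : Type*} {f : Filter ι} {p : ι → ℕ → ℝ} {q : ℕ → ℝ}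
    (h : ∀ k, Filter.Tendsto (fun i => p i k) f (nhds (q k))) (P : SymFun) :
    Filter.Tendsto (fun i => specialize (p i) P) f (nhds (specialize q P)) := by
  have e : ∀ p : ℕ → ℝ, specialize p P =
      MvPolynomial.eval p (MvPolynomial.map (algebraMap ℚ ℝ) P) := fun p => by
    rw [MvPolynomial.eval_map]; rfl
  simp only [e]
  exact ((MvPolynomial.continuous_eval _).tendsto q).comp (tendsto_pi_nhds.2 h)

/-- A reversed block stays in increasing order only if it has at most one card; this is the source
of the factors 1 + β z. -/
theorem compatible_one_iff {n : ℕ} (c : Sizes Block n) :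
    Compatible (blockOf c) 1 ↔ ∀ j, c.1 (.down j) ≤ 1 := by
  classical
  constructor
  · intro h j
    rw [← card_blockOf_eq c (.down j), Finset.card_le_one]
    intro x hx y hy
    simp only [Finset.mem_filter, Finset.mem_univ, true_and] at hx hy
    by_contra hne
    rcases lt_or_gt_of_ne hne with h' | h'
    · have := h x y h' (hx.trans hy.symm)
      rw [hx] at this
      exact this.not_gt h'
    · have := h y x h' (hy.trans hx.symm)
      rw [hy] at this
      exact this.not_gt h'
  · intro h x y hxy he
    cases hx : blockOf c x with
    | up i => exact hxy
    | last => trivial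
    | down j =>
      have := h j
      rw [← card_blockOf_eq c (.down j), Finset.card_le_one] at this
      exact absurd (this x (by simpa using hx) y (by simpa using he.symm.trans hx)) hxy.ne

open Classical in
theorem increasing_term_eq (ω : ThomaSimplex) {n : ℕ} (c : Sizes Block n) :
    (if Compatible (blockOf c) 1 then (c.1.prod fun b m => ω.blockLaw b ^ m) *
        ((c.1 .last).factorial : ℝ≥0∞)⁻¹ else 0).toReal =
      c.1.prod fun b m => b.homCoeff m * ω.weight b ^ m := by
  have h1 : (c.1.prod fun b m => ω.blockLaw b ^ m).toReal =
      c.1.prod fun b m => ω.weight b ^ m := by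
    simp only [Finsupp.prod, ENNReal.toReal_prod, ENNReal.toReal_pow]
    refine Finset.prod_congr rfl fun b _ => ?_
    congr 1
    exact ENNReal.toReal_ofReal (ω.weight_nonneg b)
  rw [Finsupp.prod_mul, compatible_one_iff]
  split_ifs with h
  · rw [ENNReal.toReal_mul, h1, mul_comm]
    congr 1
    rw [ENNReal.toReal_inv, ENNReal.toReal_natCast, Finsupp.prod,
      Finset.prod_eq_single Block.last]
    · rfl
    · intro b _ hb
      cases b with
      | up i => rfl
      | down j => exact if_pos (h j)
      | last => exact absurd rfl hb
    · intro hb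
      rw [Finsupp.notMem_support_iff.1 hb]
      simp [Block.homCoeff]
  · push Not at h
    obtain ⟨j, hj⟩ := h
    rw [ENNReal.toReal_zero, Finsupp.prod, Finset.prod_eq_zero (i := Block.down j), zero_mul]
    · rw [Finsupp.mem_support_iff]; omega
    · exact if_neg (by omega)

-- The size families supported in a finite set of blocks exhaust all size families as the set grows.
open Classical in
theorem tendsto_sum_finsuppAntidiag {n : ℕ} {f : Sizes Block n → ℝ} {g : (Block →₀ ℕ) → ℝ} {a : ℝ}
    (hf : HasSum f a) (hg : ∀ c : Sizes Block n, g c.1 = f c) :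
    Filter.Tendsto (fun s : Finset Block => ∑ c ∈ s.finsuppAntidiag n, g c) Filter.atTop
      (nhds a) := by
  have hT : Filter.Tendsto (fun s : Finset Block =>
      (s.finsuppAntidiag n).subtype fun c => c.sum (fun _ m => m) = n) Filter.atTop
        Filter.atTop := by
    refine Filter.tendsto_atTop_finset_of_monotone (fun s t hst c hc => ?_) fun c => ?_
    · rw [Finset.mem_subtype, mem_finsuppAntidiag'] at hc ⊢
      exact ⟨hc.1, hc.2.trans hst⟩
    · refine ⟨c.1.support, ?_⟩
      rw [Finset.mem_subtype, mem_finsuppAntidiag']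
      exact ⟨c.2, subset_rfl⟩
  refine (Filter.Tendsto.comp hf hT).congr fun s => ?_
  simp only [Function.comp, ← hg]
  exact Finset.sum_subtype_of_mem g fun c hc => (mem_finsuppAntidiag'.1 hc).1

/-- For finitely many blocks, both sides are the coefficient of degree `n` in a product of block
series; then pass to the limit on both sides along finite sets of blocks. -/
theorem increasingProb_eq_specialize (ω : ThomaSimplex) (n : ℕ) :
    increasingProb ω n = specialize ω.powerSum (completeHom n) := by
  classical
  have h1 := lettersLaw_std_eq_tsum_sizes ω (1 : Equiv.Perm (Fin n))
  have hne : ∑' c : Sizes Block n,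
      (if Compatible (blockOf c) 1 then (c.1.prod fun b m => ω.blockLaw b ^ m) *
        ((c.1 .last).factorial : ℝ≥0∞)⁻¹ else 0) ≠ ∞ := h1 ▸ measure_ne_top _ _
  have hsum : HasSum (fun c : Sizes Block n =>
      c.1.prod fun b m => b.homCoeff m * ω.weight b ^ m) (increasingProb ω n) := by
    rw [increasingProb_eq, Measure.real, h1, ENNReal.tsum_toReal_eq (ENNReal.ne_top_of_tsum_ne_top hne)]
    simp only [← increasing_term_eq]
    exact (ENNReal.summable_toReal hne).hasSum
  have hlim := tendsto_sum_finsuppAntidiag (g := fun c => c.prod fun b m =>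
    b.homCoeff m * ω.weight b ^ m) hsum fun _ => rfl
  have hlim' := tendsto_specialize (fun k => (hasSum_powerSum ω k)) (completeHom n)
  refine tendsto_nhds_unique hlim (hlim'.congr fun s => ?_)
  rw [specialize_completeHom_finset, PowerSeries.coeff_prod]
  refine Finset.sum_congr rfl fun c hc => ?_
  rw [mem_finsuppAntidiag'] at hc
  rw [Finsupp.prod_of_support_subset c hc.2 _ fun b _ => by simp [Block.homCoeff_zero]]
  simp [Block.homSeries]

/-! The law of the shape process. -/

theorem schur_eq_shapeProb (ω : ThomaSimplex) (l : YoungDiagram) :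
    ω.schur l = shapeProb ω l.rowLen := by
  have h0 : ∀ i, l.colLen 0 ≤ i → l.rowLen i = 0 := by
    intro i hi
    by_contra h
    have h1 : (i, 0) ∈ l := YoungDiagram.mem_iff_lt_rowLen.2 (Nat.pos_of_ne_zero h)
    have h2 := YoungDiagram.mem_iff_lt_colLen.1 h1
    omega
  rw [← det_increasingProb ω (l.colLen 0) (fun i j h => l.rowLen_anti i j h) h0,
    ThomaSimplex.schur, schurFun, AlgHom.map_det]
  congr 1
  ext i j
  simp only [AlgHom.mapMatrix_apply, Matrix.map_apply, jacobiTrudi, Matrix.of_apply,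
    increasingProb_eq_specialize]
  split_ifs <;> simp

theorem rowLen_shapeProcess {n : ℕ} (t : Equiv.Perm (Fin n)) (k i : ℕ) :
    (shapeProcess t k).rowLen i = ((rowSeq (List.ofFn t)).take k).count i := by
  rw [shapeProcess, rowLen_insertionShape, rowSeq_take]

theorem lettersLaw_take (ω : ThomaSimplex) {n : ℕ} {p : List ℕ} (hp : IsLattice p)
    (hn : p.length ≤ n) :
    (lettersLaw ω n).real {x | (rowSeq (List.ofFn (std x))).take p.length = p} =
      shapeProb ω fun i => p.count i := by
  obtain ⟨r, rfl⟩ := Nat.exists_eq_add_of_le hn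
  rw [shapeProb_eq ω hp fun _ => rfl, recordProb, Measure.real, Measure.real]
  have h := lettersLaw_append ω (measurableSet_std fun t : Equiv.Perm (Fin p.length) =>
    rowSeq (List.ofFn t) = p) (MeasurableSet.univ (α := Fin r → Block × ℝ))
  rw [measure_univ, mul_one] at h
  rw [← h]
  congr 2
  ext x
  simp [take_rowSeq_std]

/-- Two consecutive prefix contents differ by one unit, which reveals the next letter. Thus a path
of shapes determines the recording sequence. -/
theorem take_eq_take_of_count {p q : List ℕ} {k : ℕ} (hp : k ≤ p.length) (hq : k ≤ q.length)
    (h : ∀ i ≤ k, ∀ j, (p.take i).count j = (q.take i).count j) : p.take k = q.take k := by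
  induction k with
  | zero => simp
  | succ k ih =>
    have ih' := ih (by omega) (by omega) fun i hi => h i (by omega)
    have h1 := h (k + 1) le_rfl
    rw [List.take_succ_eq_append_getElem (by omega), List.take_succ_eq_append_getElem (by omega),
      ih'] at h1 ⊢
    have h2 := h1 p[k]
    simp only [List.count_append, List.count_singleton_self, List.count_singleton] at h2
    by_contra hne
    have : ¬ q[k] = p[k] := fun e => hne (by rw [e])
    simp [this] at h2

theorem addBox_iff {l m : YoungDiagram} :
    AddBox l m ↔ ∃ i, ∀ r, m.rowLen r = l.rowLen r + if r = i then 1 else 0 := by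
  constructor
  · rintro ⟨h1, h2⟩
    obtain ⟨c, hc, hm⟩ := Finset.exists_eq_insert_iff.2 ⟨YoungDiagram.cells_subset_iff.2 h1, h2.symm⟩
    refine ⟨c.1, fun r => ?_⟩
    rw [YoungDiagram.rowLen_eq_card, YoungDiagram.rowLen_eq_card, YoungDiagram.row,
      YoungDiagram.row, ← hm, Finset.filter_insert]
    by_cases hr : c.1 = r
    · rw [if_pos hr, if_pos hr.symm, Finset.card_insert_of_notMem fun h =>
        hc (Finset.mem_filter.1 h).1]
    · rw [if_neg hr, if_neg (Ne.symm hr), add_zero]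
  · rintro ⟨i, hi⟩
    have hcells : m.cells = insert (i, l.rowLen i) l.cells := by
      ext ⟨r, j⟩
      rw [Finset.mem_insert, YoungDiagram.mem_cells, YoungDiagram.mem_cells,
        YoungDiagram.mem_iff_lt_rowLen, YoungDiagram.mem_iff_lt_rowLen, hi, Prod.mk.injEq]
      by_cases hr : r = i
      · subst hr; simp; omega
      · simp [hr]
    have hn : (i, l.rowLen i) ∉ l.cells := by
      rw [YoungDiagram.mem_cells, YoungDiagram.mem_iff_lt_rowLen]
      exact lt_irrefl _
    refine ⟨YoungDiagram.cells_subset_iff.1 ?_, ?_⟩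
    · rw [hcells]; exact Finset.subset_insert _ _
    · rw [YoungDiagram.card, hcells, Finset.card_insert_of_notMem hn]

theorem addBox_shapeProcess {n : ℕ} (t : Equiv.Perm (Fin n)) {k : ℕ} (hk : k < n) :
    AddBox (shapeProcess t k) (shapeProcess t (k + 1)) := by
  have hl : k < (rowSeq (List.ofFn t)).length := by simpa
  refine addBox_iff.2 ⟨(rowSeq (List.ofFn t))[k], fun r => ?_⟩
  rw [rowLen_shapeProcess, rowLen_shapeProcess, List.take_succ_eq_append_getElem hl,
    List.count_append, List.count_singleton]
  simp only [beq_iff_eq, eq_comm (a := r)]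

theorem IsLattice.take {p : List ℕ} (hp : IsLattice p) (k : ℕ) : IsLattice (p.take k) := by
  intro j
  rw [List.take_take]
  exact hp _

/-! ### Transfer to an arbitrary random permutation with the law of the shuffle. -/

section
variable {ω : ThomaSimplex} {n : ℕ} {Ω : Type*} [MeasurableSpace Ω] {P : Measure Ω}
  {σ : Ω → Equiv.Perm (Fin n)}

theorem measurableSet_perm (hσ : ∀ τ, MeasurableSet (σ ⁻¹' {τ})) (Q : Equiv.Perm (Fin n) → Prop) :
    MeasurableSet {w | Q (σ w)} := by
  have : {w | Q (σ w)} = ⋃ t ∈ {t | Q t}, σ ⁻¹' {t} := by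
    ext w; simp
  rw [this]
  exact .biUnion (Set.to_countable _) fun t _ => hσ t

theorem measure_perm_eq (hσ : ∀ τ, MeasurableSet (σ ⁻¹' {τ}))
    (hlaw : ∀ τ, P (σ ⁻¹' {τ}) = shuffle ω n τ) (Q : Equiv.Perm (Fin n) → Prop) :
    P {w | Q (σ w)} = (lettersLaw ω n) {x | Q (std x)} := by
  classical
  have : {w | Q (σ w)} = ⋃ t ∈ Finset.univ.filter Q, σ ⁻¹' {t} := by
    ext w; simp
  rw [this, measure_biUnion_finset _ fun t _ => hσ t, lettersLaw_std]
  · exact Finset.sum_congr rfl fun t _ => (hlaw t).trans (shuffle_apply ω t)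
  · intro s _ t _ hst
    exact Set.disjoint_left.2 fun w hw hw' => hst (hw.symm.trans hw')

/-- The probability of a path depends only on its endpoint: the hypotheses see `p` only as some
lattice word of shape `l`. -/
theorem real_take_eq_schur (hσ : ∀ τ, MeasurableSet (σ ⁻¹' {τ}))
    (hlaw : ∀ τ, P (σ ⁻¹' {τ}) = shuffle ω n τ) {p : List ℕ} (hp : IsLattice p)
    (hn : p.length ≤ n) {l : YoungDiagram} (hl : ∀ i, p.count i = l.rowLen i) :
    P.real {w | (rowSeq (List.ofFn (σ w))).take p.length = p} = ω.schur l := by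
  have h := measure_perm_eq hσ hlaw fun t => (rowSeq (List.ofFn t)).take p.length = p
  rw [Measure.real, h, schur_eq_shapeProb]
  refine (lettersLaw_take ω hp hn).trans ?_
  congr 1
  exact funext hl

theorem forall_shapeProcess_eq_iff {t s : Equiv.Perm (Fin n)} {k : ℕ} (hk : k ≤ n) :
    (∀ i ≤ k, shapeProcess t i = shapeProcess s i) ↔
      (rowSeq (List.ofFn t)).take k = (rowSeq (List.ofFn s)).take k := by
  constructor
  · intro h
    refine take_eq_take_of_count (by simpa) (by simpa) fun i hi j => ?_
    rw [← rowLen_shapeProcess, ← rowLen_shapeProcess, h i hi]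
  · intro h i hi
    refine youngDiagram_ext_rowLen fun j => ?_
    have := congrArg (List.take i) h
    rw [List.take_take, List.take_take, min_eq_left hi] at this
    rw [rowLen_shapeProcess, rowLen_shapeProcess, this]

theorem length_take_rowSeq (t : Equiv.Perm (Fin n)) {k : ℕ} (hk : k ≤ n) :
    ((rowSeq (List.ofFn t)).take k).length = k := by simpa

theorem shapeProcess_zero (t : Equiv.Perm (Fin n)) : shapeProcess t 0 = ⊥ := by
  refine youngDiagram_ext_rowLen fun i => ?_
  rw [rowLen_shapeProcess, List.take_zero, List.count_nil]
  exact (Nat.eq_zero_of_not_pos fun h =>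
    YoungDiagram.notMem_bot (i, 0) (YoungDiagram.mem_iff_lt_rowLen.2 h)).symm

theorem real_shapeProcess (hσ : ∀ τ, MeasurableSet (σ ⁻¹' {τ}))
    (hlaw : ∀ τ, P (σ ⁻¹' {τ}) = shuffle ω n τ) (t : Equiv.Perm (Fin n)) {k : ℕ} (hk : k ≤ n) :
    P.real {w | (rowSeq (List.ofFn (σ w))).take k = (rowSeq (List.ofFn t)).take k} =
      ω.schur (shapeProcess t k) := by
  have := real_take_eq_schur hσ hlaw ((isLattice_rowSeq (List.ofFn t)).take k)
    (by rw [length_take_rowSeq t hk]; exact hk) fun i => (rowLen_shapeProcess t k i).symm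
  rwa [length_take_rowSeq t hk] at this

/-- Some permutation of positive probability visits `l`; the path it follows has probability s_l(ω),
which is at least as large. -/
theorem schur_pos_of_measure_ne_zero [IsProbabilityMeasure P] (hσ : ∀ τ, MeasurableSet (σ ⁻¹' {τ}))
    (hlaw : ∀ τ, P (σ ⁻¹' {τ}) = shuffle ω n τ) {k : ℕ} (hk : k ≤ n) {l : YoungDiagram}
    (h : P ((fun w => shapeProcess (σ w) k) ⁻¹' {l}) ≠ 0) : 0 < ω.schur l := by
  obtain ⟨t, ht, hP⟩ : ∃ t : Equiv.Perm (Fin n), shapeProcess t k = l ∧ P (σ ⁻¹' {t}) ≠ 0 := by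
    by_contra hc
    push Not at hc
    refine h (measure_mono_null (t := ⋃ t ∈ {t : Equiv.Perm (Fin n) | shapeProcess t k = l},
      σ ⁻¹' {t}) (fun w hw => ?_) ((measure_biUnion_null_iff (Set.to_countable _)).2 hc))
    simpa using hw
  rw [← ht, ← real_shapeProcess hσ hlaw t hk, measureReal_def,
    ENNReal.toReal_pos_iff]
  refine ⟨pos_iff_ne_zero.2 fun h0 => hP (measure_mono_null (fun w hw => ?_) h0),
    measure_lt_top _ _⟩
  have : σ w = t := hw
  simp [this]

theorem isMarkovChain_shapeProcess [IsProbabilityMeasure P] (hσ : ∀ τ, MeasurableSet (σ ⁻¹' {τ}))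
    (hlaw : ∀ τ, P (σ ⁻¹' {τ}) = shuffle ω n τ) :
    IsMarkovChain P n (fun k w => shapeProcess (σ w) k) ω.transition := by
  intro k hk x hx y
  have hA : (⋂ i ≤ k, (fun w => shapeProcess (σ w) i) ⁻¹' {x i}) =
      {w | ∀ i ≤ k, shapeProcess (σ w) i = x i} := by
    ext w; simp
  rw [hA] at hx ⊢
  -- A sample point realizing the history provides its recording sequence `p`, and the history
  -- becomes the event that the recording sequence starts with `p`.
  obtain ⟨w, hw⟩ := nonempty_of_measure_ne_zero hx
  set t := σ w with ht
  set p := (rowSeq (List.ofFn t)).take k with hp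
  have hpl : p.length = k := length_take_rowSeq t hk.le
  have hA' : {w | ∀ i ≤ k, shapeProcess (σ w) i = x i} =
      {w | (rowSeq (List.ofFn (σ w))).take k = p} := by
    ext v
    rw [Set.mem_ofPred_eq, Set.mem_ofPred_eq, ← forall_shapeProcess_eq_iff hk.le]
    exact forall₂_congr fun i hi => by rw [hw i hi]
  have hPA := real_shapeProcess hσ hlaw t hk.le
  have hmA : MeasurableSet {w | (rowSeq (List.ofFn (σ w))).take k = p} :=
    measurableSet_perm hσ fun t => (rowSeq (List.ofFn t)).take k = p
  rw [hA', Measure.real, cond_apply hmA, ENNReal.toReal_mul, ENNReal.toReal_inv, ← Measure.real,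
    hPA, ← Measure.real, hw k le_rfl, ThomaSimplex.transition]
  split_ifs with hadd
  · obtain ⟨i, hi⟩ := addBox_iff.1 hadd
    have hcount : ∀ j, (p ++ [i]).count j = y.rowLen j := by
      intro j
      rw [hi, ← hw k le_rfl, rowLen_shapeProcess, List.count_append, List.count_singleton]
      simp only [beq_iff_eq, eq_comm (a := i), hp, ht]
    -- The extended word stays lattice because the rows of the diagram `y` decrease.
    have hlat : IsLattice (p ++ [i]) := by
      refine IsLattice.append ((isLattice_rowSeq _).take k) fun j => ?_
      have h1 := hcount (j + 1)
      have h2 := hcount j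
      rw [List.count_append, List.count_singleton] at h1 h2
      have h3 := y.rowLen_anti j (j + 1) j.le_succ
      rw [List.count_singleton]
      simp only [beq_iff_eq] at h1 h2 ⊢
      have h4 : p.count (j + 1) ≤ p.count j := (isLattice_rowSeq (List.ofFn t)) k j.le_succ
      split_ifs at * <;> omega
    have hB := real_take_eq_schur hσ hlaw hlat (by simp [hpl]; omega) hcount
    rw [show (p ++ [i]).length = k + 1 by simp [hpl]] at hB
    rw [← hB, inv_mul_eq_div]
    -- Given the history `p`, arriving at `y` means that the next recorded row is `i`; so the joint
    -- event is again a prefix event, of probability s_y(ω).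
    congr 2
    ext v
    have hl : k < (rowSeq (List.ofFn (σ v))).length := by simpa
    simp only [Set.mem_inter_iff, Set.mem_ofPred_eq, Set.mem_preimage, Set.mem_singleton_iff]
    constructor
    · rintro ⟨h1, h2⟩
      rw [List.take_succ_eq_append_getElem hl, h1]
      congr 2
      have h3 := hcount (rowSeq (List.ofFn (σ v)))[k]
      rw [← h2, rowLen_shapeProcess, List.take_succ_eq_append_getElem hl, h1, List.count_append,
        List.count_append, List.count_singleton_self, List.count_singleton] at h3
      by_contra hne
      simp [Ne.symm hne] at h3
    · intro h
      have h1 := congrArg (List.take k) h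
      rw [List.take_take, min_eq_left k.le_succ, List.take_left' hpl] at h1
      refine ⟨h1, youngDiagram_ext_rowLen fun j => ?_⟩
      rw [rowLen_shapeProcess, h, hcount]
  · have : {w | (rowSeq (List.ofFn (σ w))).take k = p} ∩
        (fun w => shapeProcess (σ w) (k + 1)) ⁻¹' {y} = ∅ := by
      rw [← hA']
      ext v
      simp only [Set.mem_inter_iff, Set.mem_ofPred_eq, Set.mem_preimage, Set.mem_singleton_iff,
        Set.mem_empty_iff_false, iff_false]
      rintro ⟨h1, h2⟩
      exact hadd (h1 k le_rfl ▸ h2 ▸ addBox_shapeProcess (σ v) hk)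
    rw [this]
    simp

end

end OmegaShuffle

theorem theorem6p4 (ω : OmegaShuffle.ThomaSimplex) (n : ℕ) {Ω : Type*} [MeasurableSpace Ω]
    (P : Measure Ω) [IsProbabilityMeasure P] (σ : Ω → Equiv.Perm (Fin n))
    (hσ : ∀ τ, MeasurableSet (σ ⁻¹' {τ}))
    (hlaw : ∀ τ, P (σ ⁻¹' {τ}) = OmegaShuffle.shuffle ω n τ) :
    (∀ w, OmegaShuffle.shapeProcess (σ w) 0 = ⊥) ∧
    (∀ k ≤ n, ∀ l : YoungDiagram,
      P ((fun w => OmegaShuffle.shapeProcess (σ w) k) ⁻¹' {l}) ≠ 0 → 0 < ω.schur l) ∧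
    OmegaShuffle.IsMarkovChain P n (fun k w => OmegaShuffle.shapeProcess (σ w) k)
      ω.transition :=
  ⟨fun w => OmegaShuffle.shapeProcess_zero (σ w),
    fun _ hk _ h => OmegaShuffle.schur_pos_of_measure_ne_zero hσ hlaw hk h,
    OmegaShuffle.isMarkovChain_shapeProcess hσ hlaw⟩
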